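/- There is a universal constant $K_1\ge 7/2$ such that the following holds with $K=24\sqrt2\,K_1$. Let $d\in\mathbb N$, $d\ge1$, let $T,L>0$, $\Omega=(0,2\pi L)^d$, let $\gamma\in(0,1]$ and $a=(a_1,\dots,a_d)$ with $0<a_j\le 2\pi L$ for all $j$. Let $S\subset\mathbb R^d$ be $(\gamma,a)$-thick, that is, $S$ is Lebesgue measurable and $|S\cap(x+[0,a_1]\times\dots\times[0,a_d])|\ge\gamma\prod_{j=1}^d a_j$ for all $x\in\mathbb R^d$, and put $\omega=S\cap\Omega$. Let $\Delta$ be the self-adjoint Laplacian on $L^2(\Omega)$ with periodic, Dirichlet or Neumann boundary conditions, and consider the controlled heat equation $$\partial_t u-\Delta u=\chi_\omega v\ \text{ on } [0,T]\times\Omega,\qquad u(0,\cdot)=u_0\in L^2(\Omega),$$ with real-valued control $v\in L^2([0,T]\times\Omega)$ and weak (equivalently, mild) solution $u\in C([0,T];L^2(\Omega))$. Then the equation is null-controllable in time $T$: for every $u_0\in L^2(\Omega)$ there is a control $v\in L^2([0,T]\times\Omega)$ such that the solution satisfies $u(T,\cdot)=0$. Moreover, the control cost $$C_T=\sup_{\|u_0\|_{L^2(\Omega)}=1}\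 \inf\bigl\{\|v\|_{L^2([0,T]\times\omega)} : \text{the solution } u \text{ with control } v \text{ satisfies } u(T,\cdot)=0\bigr\}$$ satisfies $$C_T\le C_2^{1/2}\exp\Bigl(\frac{C_2}{2T}\Bigr),\qquad C_2=\Bigl(\frac{K^d}{\gamma}\Bigr)^{K(d+\|a\|_1)},\quad \|a\|_1=a_1+\dots+a_d .$$ The constant $K_1$ does not depend on $d$, $T$, $L$, $\gamma$, $a$, $S$ or the boundary condition. -/

import Mathlib

open Set MeasureTheory
open scoped ENNReal ContDiff RealInnerProductSpace

noncomputable section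

namespace HeatCube

/-- `S ⊆ ℝ^d` is `(γ, a)`-thick: it is Lebesgue measurable and every translate `x + A` of the box
`A = [0, a₁] × ⋯ × [0, a_d]` satisfies `|S ∩ (x + A)| ≥ γ ∏ a_j`. -/
structure IsThick {d : ℕ} (S : Set (Fin d → ℝ)) (γ : ℝ) (a : Fin d → ℝ) : Prop where
  gamma_pos : 0 < γ
  gamma_le_one : γ ≤ 1
  side_pos : ∀ j, 0 < a j
  measurable : NullMeasurableSet S volume
  le_volume : ∀ x : Fin d → ℝ, ENNReal.ofReal (γ * ∏ j, a j) ≤ volume (S ∩ Icc x (x + a))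

/-- The open cube `(0, 2πL)^d`. -/
def cube (d : ℕ) (L : ℝ) : Set (Fin d → ℝ) :=
  Set.univ.pi fun _ => Ioo 0 (2 * Real.pi * L)

/-- The real Hilbert space `L²(Ω)`. -/
abbrev L2 {d : ℕ} (Ω : Set (Fin d → ℝ)) : Type := Lp ℝ 2 (volume.restrict Ω)

/-- The classical partial derivative `∂_j φ`. -/
def partialDeriv {d : ℕ} (j : Fin d) (φ : (Fin d → ℝ) → ℝ) (x : Fin d → ℝ) : ℝ :=
  fderiv ℝ φ x (Pi.single j 1)

/-- `φ ∈ C_c^∞(Ω)`. -/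
structure IsTestFunction {d : ℕ} (Ω : Set (Fin d → ℝ)) (φ : (Fin d → ℝ) → ℝ) : Prop where
  smooth : ContDiff ℝ ∞ φ
  compact : HasCompactSupport φ
  support : tsupport φ ⊆ Ω

/-- `g` is the weak partial derivative `∂_j f` on `Ω`. -/
def HasWeakPartial {d : ℕ} {Ω : Set (Fin d → ℝ)} (j : Fin d) (f g : L2 Ω) : Prop :=
  ∀ φ : (Fin d → ℝ) → ℝ, IsTestFunction Ω φ →
    ∫ x in Ω, f x * partialDeriv j φ x = - ∫ x in Ω, g x * φ x

/-- The pair `p = (u, g)` consists of (the classes in `L²(Ω)` of) the function `φ` and its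
classical gradient. -/
def IsClassicalPair {d : ℕ} {Ω : Set (Fin d → ℝ)} (φ : (Fin d → ℝ) → ℝ)
    (p : L2 Ω × (Fin d → L2 Ω)) : Prop :=
  p.1 =ᵐ[volume.restrict Ω] φ ∧ ∀ j, p.2 j =ᵐ[volume.restrict Ω] partialDeriv j φ

/-- The Sobolev space `H¹(Ω)`, as the set of pairs `(u, ∇u)`. -/
def sobolevH1 {d : ℕ} (Ω : Set (Fin d → ℝ)) : Set (L2 Ω × (Fin d → L2 Ω)) :=
  {p | ∀ j, HasWeakPartial j p.1 (p.2 j)}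

/-- The Sobolev space `H¹₀(Ω)`, as the set of pairs `(u, ∇u)`: the closure of `C_c^∞(Ω)` in the
topology of `H¹(Ω)`. -/
def sobolevH1Zero {d : ℕ} (Ω : Set (Fin d → ℝ)) : Set (L2 Ω × (Fin d → L2 Ω)) :=
  closure {p | ∃ φ, IsTestFunction Ω φ ∧ IsClassicalPair φ p}

/-- The periodic Sobolev space `H¹_per((0, 2πL)^d)`, as the set of pairs `(u, ∇u)`: the closure in
the topology of `H¹` of the smooth functions on `ℝ^d` that are `2πL`-periodic in each variable. -/
def sobolevH1Per (d : ℕ) (L : ℝ) : Set (L2 (cube d L) × (Fin d → L2 (cube d L))) :=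
  closure {p | ∃ φ : (Fin d → ℝ) → ℝ, ContDiff ℝ ∞ φ ∧
    (∀ j x, φ (x + Pi.single j (2 * Real.pi * L)) = φ x) ∧ IsClassicalPair φ p}

/-- The three kinds of boundary conditions. -/
inductive BoundaryCondition
  | periodic
  | dirichlet
  | neumann

/-- The form domain of the Laplacian on the cube with the given boundary condition, as the set of
pairs `(u, ∇u)`. -/
def formDomain (bc : BoundaryCondition) (d : ℕ) (L : ℝ) :
    Set (L2 (cube d L) × (Fin d → L2 (cube d L))) :=
  match bc with
  | .periodic => sobolevH1Per d L
  | .dirichlet => sobolevH1Zero (cube d L)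
  | .neumann => sobolevH1 (cube d L)

/-- `φ` belongs to the domain of the self-adjoint Laplacian `Δ` on the cube with the given boundary
condition, and `Δ φ = f`. Here `-Δ` is the operator of the form `(u, w) ↦ ∫ ∇u · ∇w` on the form
domain, that is, `∫ ∇φ · ∇w = - ∫ f w` for every `w` in the form domain. -/
def IsLaplacian (bc : BoundaryCondition) {d : ℕ} {L : ℝ} (φ f : L2 (cube d L)) : Prop :=
  ∃ g : Fin d → L2 (cube d L), (φ, g) ∈ formDomain bc d L ∧
    ∀ w ∈ formDomain bc d L, ∑ j, ⟪g j, w.2 j⟫ = - ⟪f, w.1⟫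

/-- `v ∈ L²([0,T] × Ω)`, with `Ω` the cube. -/
def IsControl {d : ℕ} (L T : ℝ) (v : ℝ → (Fin d → ℝ) → ℝ) : Prop :=
  MemLp (fun p : ℝ × (Fin d → ℝ) => v p.1 p.2) 2
    ((volume.restrict (Icc 0 T)).prod (volume.restrict (cube d L)))

/-- `u ∈ C([0,T]; L²(Ω))` is the (weak, equivalently mild) solution of `∂_t u - Δ u = χ_ω v`,
`u(0) = u₀`, on the cube `Ω` with the given boundary condition and `ω = S ∩ Ω`: for every `φ` in the
domain of `Δ` and every `t ∈ [0,T]`,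
`⟨u(t), φ⟩ = ⟨u₀, φ⟩ + ∫₀ᵗ (⟨u(s), Δφ⟩ + ∫_ω v(s, x) φ(x) dx) ds`. -/
structure IsSolution (bc : BoundaryCondition) {d : ℕ} {L : ℝ} (S : Set (Fin d → ℝ)) (T : ℝ)
    (u₀ : L2 (cube d L)) (v : ℝ → (Fin d → ℝ) → ℝ) (u : ℝ → L2 (cube d L)) : Prop where
  continuousOn : ContinuousOn u (Icc 0 T)
  initial : u 0 = u₀
  weak : ∀ φ f : L2 (cube d L), IsLaplacian bc φ f → ∀ t ∈ Icc 0 T,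
    ⟪u t, φ⟫ = ⟪u₀, φ⟫ + ∫ s in (0 : ℝ)..t, (⟪u s, f⟫ + ∫ x in S ∩ cube d L, v s x * φ x)

/-- `v ∈ L²([0,T] × Ω)` is a control that drives the initial datum `u₀` to `0` in time `T`. -/
def IsNullControl (bc : BoundaryCondition) {d : ℕ} {L : ℝ} (S : Set (Fin d → ℝ)) (T : ℝ)
    (u₀ : L2 (cube d L)) (v : ℝ → (Fin d → ℝ) → ℝ) : Prop :=
  IsControl L T v ∧ ∃ u : ℝ → L2 (cube d L), IsSolution bc S T u₀ v u ∧ u T = 0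

/-- The heat equation on the cube with control set `S ∩ (0, 2πL)^d` is null-controllable in
time `T`. -/
def IsNullControllable (bc : BoundaryCondition) {d : ℕ} (L : ℝ) (S : Set (Fin d → ℝ)) (T : ℝ) :
    Prop :=
  ∀ u₀ : L2 (cube d L), ∃ v : ℝ → (Fin d → ℝ) → ℝ, IsNullControl bc S T u₀ v

/-- The control cost `C_T`: the supremum over `‖u₀‖ = 1` of the infimum of
`‖v‖_{L²([0,T] × ω)}` over all null controls `v` for `u₀`, with `inf ∅ = ∞`. -/
def controlCost (bc : BoundaryCondition) {d : ℕ} (L : ℝ) (S : Set (Fin d → ℝ)) (T : ℝ) : ℝ≥0∞ :=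
  ⨆ (u₀ : L2 (cube d L)) (_ : ‖u₀‖ = 1),
    ⨅ (v : ℝ → (Fin d → ℝ) → ℝ) (_ : IsNullControl bc S T u₀ v),
      eLpNorm (fun p : ℝ × (Fin d → ℝ) => v p.1 p.2) 2
        ((volume.restrict (Icc 0 T)).prod (volume.restrict (S ∩ cube d L)))

/-- The constant `(K^d / γ)^{K (d + ‖a‖₁)}`, for `a` with positive entries. -/
def costConstant {d : ℕ} (K γ : ℝ) (a : Fin d → ℝ) : ℝ :=
  (K ^ d / γ) ^ (K * ((d : ℝ) + ∑ j, a j))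

end HeatCube

end

/-! ### Remez inequality and quantitative unique continuation on an interval. -/

namespace HeatCube

/-! The proof rests on the duality between control and observation. In an orthonormal basis of
eigenfunctions `e_k` of `-Δ` with eigenvalues `λ_k`, the condition `u(T) = 0` is a moment problem:
the inner product of `v` with `exp(-λ_k (T - t)) e_k` in `L²([0,T] × ω)` has to be `-exp(-λ_k T)
⟪e_k, u₀⟫` for every `k`. By Hahn–Banach and Riesz (`exists_forall_inner_eq`) it has a solution with
`‖v‖ ≤ √C ‖u₀‖` once finite sums of eigenfunctions satisfy an observability inequality with constant
`C` (`observability`, `exists_control`). The solution `u` is then rebuilt from its coefficients,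
each given by Duhamel's formula (`exists_mild_solution`, `isNullControl_of_moments`).

Observability follows from a spectral inequality `‖f‖² ≤ D₀ exp(D₁ Λ) ‖f‖²_{L²(ω)}` for `f` spanned
by eigenfunctions with `λ_k ≤ Λ²`. Frequencies below `Λ` are observed at cost `exp(D₁ Λ)`, those
above have decayed by `exp(-2 Λ² (t - t₀))`, and the quadratic exponent beats the linear one. A
telescoping sum over the dyadic times `T / 2^n`, with `Λ` proportional to `2^n`, turns this into an
estimate of the final energy (`observability_of_interpolation`).

The spectral inequality is proved by real-variable means. The cube is tiled by boxes comparable to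
the thickness box. On an interval, `f` is close to its Taylor polynomial of degree `n`, and a Remez
inequality (`remez`) controls that polynomial by its values on any subset of positive measure;
induction on the dimension with Fubini carries this to boxes (`setIntegral_box_sq_le`). The error is
a pure derivative of order `n + 1` divided by `n!`. Summed over the tiles, it is bounded through
Parseval by `Λ^(n+1) ‖f‖`. Taking `n` proportional to `Λ` makes the error absorbable, while the
Remez constant stays exponential in `Λ` (`spectral_inequality`).

The boundary condition enters only through explicit products of trigonometric functions: they are
complete, and they are weak eigenfunctions for the respective form domain (`exists_isEigensystem`).
-/

lemma exists_separated_points {h : ℝ} (hh : 0 ≤ h) (n : ℕ) :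
    ∀ E : Set ℝ, BddBelow E → ENNReal.ofReal (n * h) < volume E →
      ∃ x : ℕ → ℝ, (∀ i ≤ n, x i ∈ E) ∧ ∀ i < n, x i + h ≤ x (i + 1) := by
  induction n with
  | zero =>
    intro E _ hE
    obtain ⟨y, hy⟩ := nonempty_of_measure_ne_zero (pos_of_gt hE).ne'
    exact ⟨fun _ => y, fun _ _ => hy, fun i hi => absurd hi (Nat.not_lt_zero i)⟩
  | succ n ih =>
    intro E hb hE
    obtain ⟨r, hr0, hr1, hr2⟩ := ENNReal.lt_iff_exists_real_btwn.1 hE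
    have hnh : 0 ≤ ((n + 1 : ℕ) : ℝ) * h := by positivity
    have hr1' : ((n + 1 : ℕ) : ℝ) * h < r := (ENNReal.ofReal_lt_ofReal_iff_of_nonneg hnh).1 hr1
    have hne : E.Nonempty := nonempty_of_measure_ne_zero (pos_of_gt hE).ne'
    -- Greedy choice: `y ∈ E` is so close to `inf E` that discarding `[inf E, y + h]` still leaves
    -- measure greater than `n h`.
    obtain ⟨y, hy, hy'⟩ := Real.lt_sInf_add_pos hne (sub_pos.2 hr1')
    have hsub : E ⊆ Icc (sInf E) (y + h) ∪ (E ∩ Ici (y + h)) := by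
      intro z hz
      rcases le_total z (y + h) with hzy | hzy
      · exact Or.inl ⟨csInf_le hb hz, hzy⟩
      · exact Or.inr ⟨hz, hzy⟩
    have hlt : ENNReal.ofReal (n * h) < volume (E ∩ Ici (y + h)) := by
      by_contra hcon
      rw [not_lt] at hcon
      have h1 : volume E ≤ ENNReal.ofReal (y + h - sInf E) + ENNReal.ofReal (n * h) := by
        refine (measure_mono hsub).trans ((measure_union_le _ _).trans ?_)
        rw [Real.volume_Icc]
        exact add_le_add le_rfl hcon
      have h0 : sInf E ≤ y := csInf_le hb hy
      rw [← ENNReal.ofReal_add (by linarith) (by positivity)] at h1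
      have h2 : ENNReal.ofReal (y + h - sInf E + n * h) ≤ ENNReal.ofReal r := by
        apply ENNReal.ofReal_le_ofReal
        push_cast at hy'
        linarith
      exact absurd (h1.trans h2) (not_le.2 hr2)
    obtain ⟨x, hx1, hx2⟩ := ih (E ∩ Ici (y + h)) (hb.mono inter_subset_left) hlt
    refine ⟨fun i => Nat.casesOn i y x, ?_, ?_⟩
    · intro i hi
      cases i with
      | zero => exact hy
      | succ i => exact (hx1 i (by omega)).1
    · intro i hi
      cases i with
      | zero => exact (hx1 0 (Nat.zero_le _)).2
      | succ i => exact hx2 i (by omega)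

lemma separated_points_sub {h : ℝ} {n : ℕ} {x : ℕ → ℝ} (hx : ∀ i < n, x i + h ≤ x (i + 1))
    (i k : ℕ) (hk : i + k ≤ n) : k * h ≤ x (i + k) - x i := by
  induction k with
  | zero => simp
  | succ k ih =>
    have h1 := ih (by omega)
    have h2 := hx (i + k) (by omega)
    rw [← add_assoc]
    push_cast
    linarith

/-- These are the denominators of the Lagrange basis at equally spaced nodes, the worst case for
nodes with prescribed minimal gaps. -/
lemma prod_abs_sub_erase (n k : ℕ) (hk : k ≤ n) :
    ∏ j ∈ (Finset.range (n + 1)).erase k, |(k : ℝ) - j| = k.factorial * (n - k).factorial := by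
  have hsplit : (Finset.range (n + 1)).erase k = Finset.range k ∪ Finset.Ico (k + 1) (n + 1) := by
    ext j
    simp only [Finset.mem_erase, Finset.mem_range, Finset.mem_union, Finset.mem_Ico]
    omega
  have hdisj : Disjoint (Finset.range k) (Finset.Ico (k + 1) (n + 1)) := by
    rw [Finset.disjoint_left]
    intro j hj hj'
    simp only [Finset.mem_range, Finset.mem_Ico] at hj hj'
    omega
  rw [hsplit, Finset.prod_union hdisj]
  congr 1
  · rw [← Finset.prod_range_reflect, ← Finset.prod_range_add_one_eq_factorial, Nat.cast_prod]
    refine Finset.prod_congr rfl fun j hj => ?_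
    have hj' : j < k := Finset.mem_range.1 hj
    have : ((k - 1 - j : ℕ) : ℝ) = (k : ℝ) - 1 - j := by
      rw [Nat.cast_sub (by omega), Nat.cast_sub (by omega)]; simp
    rw [this, abs_of_nonneg (by linarith [(Nat.cast_nonneg j : (0 : ℝ) ≤ j)])]
    push_cast
    ring
  · rw [Finset.prod_Ico_eq_prod_range, ← Finset.prod_range_add_one_eq_factorial, Nat.cast_prod]
    refine Finset.prod_congr (by congr 1; omega) fun j _ => ?_
    push_cast
    rw [abs_sub_comm, abs_of_nonneg (by linarith [(Nat.cast_nonneg j : (0 : ℝ) ≤ j)])]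
    ring

/-- A Remez type inequality on an interval. -/
lemma remez {p : Polynomial ℝ} {n : ℕ} (hp : p.degree < (n + 1 : ℕ)) {c a m M : ℝ} {E : Set ℝ}
    (ha : 0 < a) (hm : 0 < m) (hma : m ≤ a) (hE : E ⊆ Icc c (c + a))
    (hmE : ENNReal.ofReal m ≤ volume E) (hM : ∀ y ∈ E, |p.eval y| ≤ M) {x : ℝ}
    (hx : x ∈ Icc c (c + a)) : |p.eval x| ≤ (6 * a / m) ^ (n + 1) * M := by
  -- With this gap `n h < m ≤ |E|`, so `E` contains `n + 1` nodes with consecutive distances at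
  -- least `h`, and `p` is its own Lagrange interpolant there. Numerators of the basis are at most
  -- `a`, denominators at least `|k - j| h`.
  set h : ℝ := m / (n + 1) with hh
  have hn1 : (0 : ℝ) < n + 1 := by positivity
  have hhpos : 0 < h := by positivity
  have hlt : ENNReal.ofReal (n * h) < volume E := by
    refine lt_of_lt_of_le ?_ hmE
    rw [ENNReal.ofReal_lt_ofReal_iff hm, hh, mul_div_assoc', div_lt_iff₀ hn1]
    nlinarith
  obtain ⟨y, hy1, hy2⟩ := exists_separated_points hhpos.le n E ⟨c, fun z hz => (hE hz).1⟩ hlt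
  have hM0 : 0 ≤ M := (abs_nonneg _).trans (hM _ (hy1 0 (Nat.zero_le _)))
  have hsep : ∀ i ≤ n, ∀ j ≤ n, |(i : ℝ) - j| * h ≤ |y i - y j| := by
    have key : ∀ i j, i ≤ j → j ≤ n → |(i : ℝ) - j| * h ≤ |y i - y j| := by
      intro i j hij hj
      obtain ⟨k, rfl⟩ := Nat.exists_eq_add_of_le hij
      have h1 := separated_points_sub hy2 i k hj
      rw [abs_sub_comm (y i)]
      refine le_trans ?_ (h1.trans (le_abs_self _))
      push_cast
      rw [show (i : ℝ) - (i + k) = -k by ring, abs_neg, abs_of_nonneg (Nat.cast_nonneg k)]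
    intro i hi j hj
    rcases le_total i j with hij | hij
    · exact key i j hij hj
    · rw [abs_sub_comm, abs_sub_comm (y i)]
      exact key j i hij hi
  have hinj : Set.InjOn y (Finset.range (n + 1) : Finset ℕ) := by
    intro i hi j hj hij
    simp only [Finset.coe_range, Set.mem_Iio] at hi hj
    have h1 := hsep i (by omega) j (by omega)
    rw [hij, sub_self, abs_zero] at h1
    have h2 : |(i : ℝ) - j| = 0 := by
      refine le_antisymm ?_ (abs_nonneg _)
      by_contra hcon
      nlinarith [not_le.1 hcon]
    rw [abs_eq_zero, sub_eq_zero] at h2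
    exact_mod_cast h2
  have hint := Lagrange.eq_interpolate hinj (f := p) (by simpa using hp)
  have hbasis : ∀ k ∈ Finset.range (n + 1), |(Lagrange.basis (Finset.range (n + 1)) y k).eval x| ≤
      (a / h) ^ n / (k.factorial * (n - k).factorial) := by
    intro k hk
    have hkn : k ≤ n := Nat.lt_succ_iff.1 (Finset.mem_range.1 hk)
    rw [Lagrange.basis, Polynomial.eval_prod, Finset.abs_prod, ← prod_abs_sub_erase n k hkn]
    have hcard : ((Finset.range (n + 1)).erase k).card = n := by
      rw [Finset.card_erase_of_mem hk]; simp
    calc ∏ j ∈ (Finset.range (n + 1)).erase k, |(Lagrange.basisDivisor (y k) (y j)).eval x|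
        ≤ ∏ j ∈ (Finset.range (n + 1)).erase k, (a / h) / |(k : ℝ) - j| := by
          refine Finset.prod_le_prod (fun _ _ => abs_nonneg _) fun j hj => ?_
          obtain ⟨hjk, hj⟩ := Finset.mem_erase.1 hj
          have hjn : j ≤ n := Nat.lt_succ_iff.1 (Finset.mem_range.1 hj)
          have hkj : 0 < |(k : ℝ) - j| := by
            rw [abs_pos, sub_ne_zero]
            exact_mod_cast hjk.symm
          have h1 : |x - y j| ≤ a := by
            have := hE (hy1 j hjn)
            rw [abs_le]
            constructor <;> linarith [hx.1, hx.2, this.1, this.2]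
          simp only [Lagrange.basisDivisor, Polynomial.eval_mul, Polynomial.eval_C,
            Polynomial.eval_sub, Polynomial.eval_X]
          rw [abs_mul, abs_inv, div_div, mul_comm, ← div_eq_mul_inv]
          refine div_le_div₀ ha.le h1 (by positivity) ?_
          rw [mul_comm]
          exact hsep k hkn j hjn
      _ = (a / h) ^ n / ∏ j ∈ (Finset.range (n + 1)).erase k, |(k : ℝ) - j| := by
          rw [Finset.prod_div_distrib, Finset.prod_const, hcard]
  have hsum : |p.eval x| ≤ ∑ k ∈ Finset.range (n + 1),
      M * ((a / h) ^ n / (k.factorial * (n - k).factorial)) := by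
    rw [hint, Lagrange.interpolate_apply, Polynomial.eval_finsetSum]
    refine (Finset.abs_sum_le_sum_abs _ _).trans (Finset.sum_le_sum fun k hk => ?_)
    rw [Polynomial.eval_mul, Polynomial.eval_C, abs_mul]
    exact mul_le_mul (hM _ (hy1 k (Nat.lt_succ_iff.1 (Finset.mem_range.1 hk)))) (hbasis k hk)
      (abs_nonneg _) hM0
  have hbinom : ∑ k ∈ Finset.range (n + 1), (1 : ℝ) / (k.factorial * (n - k).factorial) =
      2 ^ n / n.factorial := by
    have h2 := Nat.sum_range_choose n
    have h3 : (2 : ℝ) ^ n = ∑ k ∈ Finset.range (n + 1), (n.choose k : ℝ) := by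
      exact_mod_cast h2.symm
    rw [h3, Finset.sum_div]
    refine Finset.sum_congr rfl fun k hk => ?_
    rw [Nat.cast_choose ℝ (Nat.lt_succ_iff.1 (Finset.mem_range.1 hk))]
    field_simp
  -- The left side equals `(n+1)^(n+1) / (n+1)!`, one term of the exponential series at `n + 1`. It
  -- cancels the growth hidden in `a / h = (a / m) (n + 1)`.
  have hfact : ((n : ℝ) + 1) ^ n / n.factorial ≤ 3 ^ (n + 1) := by
    have h1 := Real.pow_div_factorial_le_exp (x := (n : ℝ) + 1) (by positivity) (n + 1)
    have h2 : ((n : ℝ) + 1) ^ (n + 1) / (n + 1).factorial = ((n : ℝ) + 1) ^ n / n.factorial := by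
      rw [Nat.factorial_succ, pow_succ']
      push_cast
      exact mul_div_mul_left _ _ hn1.ne'
    rw [h2] at h1
    refine h1.trans ?_
    have h3 : Real.exp ((n : ℝ) + 1) = Real.exp 1 ^ (n + 1) := by
      rw [← Real.exp_nat_mul]; push_cast; ring_nf
    rw [h3]
    exact pow_le_pow_left₀ (Real.exp_pos 1).le Real.exp_one_lt_three.le _
  have ham : 1 ≤ a / m := by rwa [one_le_div hm]
  calc |p.eval x| ≤ ∑ k ∈ Finset.range (n + 1),
        M * ((a / h) ^ n / (k.factorial * (n - k).factorial)) := hsum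
    _ = M * (a / h) ^ n * (2 ^ n / n.factorial) := by
        rw [← hbinom, Finset.mul_sum]
        refine Finset.sum_congr rfl fun k _ => ?_
        ring
    _ = M * ((2 * (a / m)) ^ n * (((n : ℝ) + 1) ^ n / n.factorial)) := by
        have h1 : a / h = a / m * (n + 1) := by rw [hh]; field_simp
        rw [h1, mul_pow, mul_pow]
        ring
    _ ≤ M * ((2 * (a / m)) ^ (n + 1) * 3 ^ (n + 1)) := by
        gcongr
        · linarith
        · omega
    _ = (6 * a / m) ^ (n + 1) * M := by
        rw [← mul_pow, mul_comm M]
        congr 2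
        ring

/-- Cauchy–Schwarz against the constant function, read off from the nonnegativity of the variance of
`g`. -/
lemma sq_setIntegral_le {g : ℝ → ℝ} (hg : Continuous g) {c a : ℝ} (ha : 0 < a) :
    (∫ t in Icc c (c + a), g t) ^ 2 ≤ a * ∫ t in Icc c (c + a), g t ^ 2 := by
  set m := (∫ t in Icc c (c + a), g t) / a with hm
  have hi : IntegrableOn g (Icc c (c + a)) := hg.integrableOn_Icc
  have hi2 : IntegrableOn (fun t => g t ^ 2) (Icc c (c + a)) := (hg.pow 2).integrableOn_Icc
  have hvol : volume.real (Icc c (c + a)) = a := by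
    rw [Real.volume_real_Icc_of_le (by linarith)]; ring
  have h0 : 0 ≤ ∫ t in Icc c (c + a), (g t - m) ^ 2 := integral_nonneg fun t => sq_nonneg _
  have h1 : ∫ t in Icc c (c + a), (g t - m) ^ 2 =
      (∫ t in Icc c (c + a), g t ^ 2) - 2 * m * (∫ t in Icc c (c + a), g t) + m ^ 2 * a := by
    have : ∀ t, (g t - m) ^ 2 = g t ^ 2 - 2 * m * g t + m ^ 2 := fun t => by ring
    simp_rw [this]
    rw [integral_add, integral_sub, integral_const_mul, setIntegral_const, hvol, smul_eq_mul]
    · ring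
    · exact hi2
    · exact hi.const_mul _
    · exact hi2.sub (hi.const_mul _)
    · exact integrableOn_const (by simp)
  have h2 : (∫ t in Icc c (c + a), g t) = m * a := by rw [hm]; field_simp
  rw [h1, h2] at h0
  rw [h2]
  nlinarith

/-- The polynomial is the Taylor polynomial at the left endpoint. The kernel of the integral
remainder is at most `a^n / n!`, and Cauchy–Schwarz turns the remaining `L¹` norm into an `L²` norm.
-/
lemma exists_taylor_polynomial {f : ℝ → ℝ} {n : ℕ} (hf : ContDiff ℝ (n + 1 : ℕ) f) {c a : ℝ}
    (ha : 0 < a) : ∃ p : Polynomial ℝ, p.degree < (n + 1 : ℕ) ∧ ∀ x ∈ Icc c (c + a),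
      (f x - p.eval x) ^ 2 ≤ (a ^ n / n.factorial) ^ 2 *
        (a * ∫ t in Icc c (c + a), iteratedDeriv (n + 1) f t ^ 2) := by
  have hcont : Continuous (iteratedDeriv (n + 1) f) := hf.continuous_iteratedDeriv _ le_rfl
  refine ⟨∑ k ∈ Finset.range (n + 1), Polynomial.C ((k.factorial : ℝ)⁻¹ * iteratedDeriv k f c) *
    (Polynomial.X - Polynomial.C c) ^ k, ?_, ?_⟩
  · refine lt_of_le_of_lt (Polynomial.degree_sum_le _ _) ?_
    rw [Finset.sup_lt_iff (by exact WithBot.bot_lt_coe _)]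
    intro k hk
    rw [Polynomial.C_mul']
    refine lt_of_le_of_lt (Polynomial.degree_smul_le _ _) ?_
    rw [Polynomial.degree_pow, Polynomial.degree_X_sub_C, nsmul_one]
    exact_mod_cast Finset.mem_range.1 hk
  · intro x hx
    -- The left endpoint is treated apart: derivatives within the degenerate interval `[c, c]` are
    -- not determined.
    rcases hx.1.eq_or_lt with rfl | hcx
    · have h0 : f c - Polynomial.eval c (∑ k ∈ Finset.range (n + 1), Polynomial.C
          ((k.factorial : ℝ)⁻¹ * iteratedDeriv k f c) *
            (Polynomial.X - Polynomial.C c) ^ k) = 0 := by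
        rw [Polynomial.eval_finsetSum, Finset.sum_range_succ']
        simp
      rw [h0, zero_pow two_ne_zero]
      have : 0 ≤ ∫ t in Icc c (c + a), iteratedDeriv (n + 1) f t ^ 2 :=
        integral_nonneg fun t => sq_nonneg _
      positivity
    have huniq : UniqueDiffOn ℝ (uIcc c x) := uniqueDiffOn_uIcc hcx.ne
    have hT := taylor_integral_remainder (x := x) (x₀ := c) (n := n) hf.contDiffOn
    rw [taylor_within_apply] at hT
    have hd : ∀ k ≤ n + 1, ∀ t ∈ uIcc c x,
        iteratedDerivWithin k f (uIcc c x) t = iteratedDeriv k f t := by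
      intro k hk t ht
      exact iteratedDerivWithin_eq_iteratedDeriv huniq
        ((hf.of_le (by exact_mod_cast hk)).contDiffAt) ht
    have hpoly : Polynomial.eval x (∑ k ∈ Finset.range (n + 1), Polynomial.C
          ((k.factorial : ℝ)⁻¹ * iteratedDeriv k f c) * (Polynomial.X - Polynomial.C c) ^ k) =
        ∑ k ∈ Finset.range (n + 1), ((k.factorial : ℝ)⁻¹ * (x - c) ^ k) •
          iteratedDerivWithin k f (uIcc c x) c := by
      rw [Polynomial.eval_finsetSum]
      refine Finset.sum_congr rfl fun k hk => ?_
      rw [hd k (Finset.mem_range.1 hk).le c left_mem_uIcc]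
      simp only [Polynomial.eval_mul, Polynomial.eval_C, Polynomial.eval_pow, Polynomial.eval_sub,
        Polynomial.eval_X, smul_eq_mul]
      ring
    rw [hpoly, hT, intervalIntegral.integral_of_le hcx.le]
    have hb : |∫ t in Ioc c x, ((x - t) ^ n / (n.factorial : ℝ)) •
        iteratedDerivWithin (n + 1) f (uIcc c x) t| ≤
        a ^ n / n.factorial * ∫ t in Icc c (c + a), |iteratedDeriv (n + 1) f t| := by
      have hint : IntegrableOn (fun t => a ^ n / n.factorial * |iteratedDeriv (n + 1) f t|)
          (Icc c (c + a)) := (continuous_const.mul hcont.abs).integrableOn_Icc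
      rw [← integral_const_mul]
      have hsub : Ioc c x ⊆ Icc c (c + a) := fun t ht => ⟨ht.1.le, ht.2.trans hx.2⟩
      calc |∫ t in Ioc c x, ((x - t) ^ n / (n.factorial : ℝ)) •
              iteratedDerivWithin (n + 1) f (uIcc c x) t|
          ≤ ∫ t in Ioc c x, a ^ n / n.factorial * |iteratedDeriv (n + 1) f t| := by
            rw [← Real.norm_eq_abs]
            refine norm_integral_le_of_norm_le (hint.mono_set hsub) ?_
            refine (ae_restrict_iff' measurableSet_Ioc).2 (ae_of_all _ fun t ht => ?_)
            rw [hd (n + 1) le_rfl t (by rw [uIcc_of_le hcx.le]; exact Ioc_subset_Icc_self ht),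
              norm_smul, Real.norm_eq_abs, Real.norm_eq_abs, abs_div, abs_pow,
              abs_of_nonneg (by linarith [ht.2] : 0 ≤ x - t), Nat.abs_cast]
            gcongr
            · linarith [ht.2]
            · linarith [ht.1, hx.2]
        _ ≤ _ := setIntegral_mono_set hint (ae_of_all _ fun t => by positivity)
            hsub.eventuallyLE
    have h1 := sq_setIntegral_le hcont.abs (c := c) ha
    simp only [sq_abs] at h1
    calc (∫ t in Ioc c x, ((x - t) ^ n / (n.factorial : ℝ)) •
              iteratedDerivWithin (n + 1) f (uIcc c x) t) ^ 2
        ≤ (a ^ n / n.factorial * ∫ t in Icc c (c + a), |iteratedDeriv (n + 1) f t|) ^ 2 := by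
          rw [← sq_abs]; gcongr
      _ = (a ^ n / n.factorial) ^ 2 * (∫ t in Icc c (c + a), |iteratedDeriv (n + 1) f t|) ^ 2 := by
          ring
      _ ≤ _ := by gcongr

set_option maxHeartbeats 400000 in
/-- A quantitative unique continuation estimate for smooth functions on an interval. -/
lemma setIntegral_Icc_sq_le {f : ℝ → ℝ} {n : ℕ} (hf : ContDiff ℝ (n + 1 : ℕ) f) {c a ρ : ℝ}
    {E : Set ℝ} (ha : 0 < a) (hρ : 0 < ρ) (hE : E ⊆ Icc c (c + a))
    (hvol : ENNReal.ofReal (ρ * a) ≤ volume E) :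
    ∫ t in Icc c (c + a), f t ^ 2 ≤ (12 / ρ) ^ (4 * (n + 1)) * ((∫ t in E, f t ^ 2) +
      (a ^ (n + 1) / n.factorial) ^ 2 * ∫ t in Icc c (c + a), iteratedDeriv (n + 1) f t ^ 2) := by
  obtain ⟨p, hp, hfp⟩ := exists_taylor_polynomial hf (c := c) ha
  have hI : IntegrableOn (fun t => f t ^ 2) (Icc c (c + a)) :=
    (hf.continuous.pow 2).integrableOn_Icc
  have hvolI : volume (Icc c (c + a)) = ENNReal.ofReal a := by rw [Real.volume_Icc]; congr 1; ring
  have hfin : volume E ≠ ⊤ := ne_top_of_le_ne_top (by simp [hvolI]) (measure_mono hE)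
  set e := volume.real E with he
  have he1 : ρ * a ≤ e := (ENNReal.ofReal_le_iff_le_toReal hfin).1 hvol
  have he2 : e ≤ a := by
    have := measureReal_mono hE (μ := volume) (by simp)
    rwa [Real.volume_real_Icc_of_le (by linarith), add_sub_cancel_left] at this
  have he0 : 0 < e := lt_of_lt_of_le (by positivity) he1
  have hρ1 : ρ ≤ 1 := by nlinarith
  set B : ℝ := (12 / ρ) ^ (n + 1) with hB
  have hρ12 : 12 ≤ 12 / ρ := by rw [le_div_iff₀ hρ]; linarith
  have hB1 : 12 / ρ ≤ B := le_self_pow₀ (by linarith) (by omega)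
  set J := ∫ t in Icc c (c + a), iteratedDeriv (n + 1) f t ^ 2 with hJ
  have hJ0 : 0 ≤ J := integral_nonneg fun t => sq_nonneg _
  set δ := a ^ n / n.factorial * Real.sqrt (a * J) with hδ
  have hδ0 : 0 ≤ δ := by positivity
  have hδ2 : δ ^ 2 = (a ^ n / n.factorial) ^ 2 * (a * J) := by
    rw [hδ, mul_pow, Real.sq_sqrt (by positivity)]
  have hfp' : ∀ x ∈ Icc c (c + a), |f x - p.eval x| ≤ δ := by
    intro x hx
    refine abs_le_of_sq_le_sq ?_ hδ0
    rw [hδ2]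
    exact hfp x hx
  set s := ∫ t in E, f t ^ 2 with hs
  have hs0 : 0 ≤ s := integral_nonneg fun t => sq_nonneg _
  have hC : (0 : ℝ) < (12 / ρ) ^ (4 * (n + 1)) := by positivity
  -- A number `s'` strictly above the integral over `E` keeps the threshold `ε` positive even if `f`
  -- vanishes on `E`; afterwards `s'` decreases to `s`.
  have key : ∀ s', s < s' → (∫ t in Icc c (c + a), f t ^ 2) ≤ (12 / ρ) ^ (4 * (n + 1)) *
      (s' + (a ^ (n + 1) / n.factorial) ^ 2 * J) := by
    intro s' hs'
    set ε := 2 * s' / e with hε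
    have hs'0 : 0 < s' := hs0.trans_lt hs'
    have hε0 : 0 < ε := by positivity
    have hmeas : Measurable f := hf.continuous.measurable
    have hEI : IntegrableOn (fun t => f t ^ 2) E := hI.mono_set hE
    have hmk : ε * volume.real (E ∩ {x | ε ≤ f x ^ 2}) ≤ s := by
      have h := mul_meas_ge_le_integral_of_nonneg (ae_of_all _ fun t => sq_nonneg (f t)) hEI ε
      have hm : MeasurableSet {x | ε ≤ f x ^ 2} := measurableSet_le measurable_const (hmeas.pow_const 2)
      rwa [measureReal_restrict_apply hm, inter_comm] at h
    -- Markov's inequality: `f² < ε` holds on at least half of `E`. There the Taylor polynomial is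
    -- at most `√ε + δ`, and Remez with measure `ρ a / 2` produces the base `6 a / (ρ a / 2) = 12 /
    -- ρ`.
    have hmk2 : volume.real (E ∩ {x | ε ≤ f x ^ 2}) ≤ e / 2 := by
      rw [hε, div_mul_eq_mul_div, div_le_iff₀ he0] at hmk
      nlinarith [measureReal_nonneg (μ := volume) (s := E ∩ {x | ε ≤ f x ^ 2})]
    have hsplit : e ≤ volume.real (E ∩ {x | f x ^ 2 < ε}) +
        volume.real (E ∩ {x | ε ≤ f x ^ 2}) := by
      refine le_trans (measureReal_mono ?_ ?_) (measureReal_union_le _ _)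
      · intro x hx
        rcases lt_or_ge (f x ^ 2) ε with h | h
        · exact Or.inl ⟨hx, h⟩
        · exact Or.inr ⟨hx, h⟩
      · exact ne_top_of_le_ne_top hfin (measure_mono (by simp))
    have hE' : ENNReal.ofReal (ρ * a / 2) ≤ volume (E ∩ {x | f x ^ 2 < ε}) := by
      rw [ENNReal.ofReal_le_iff_le_toReal (ne_top_of_le_ne_top hfin (measure_mono inter_subset_left))]
      change _ ≤ volume.real _
      linarith
    have hpE : ∀ y ∈ E ∩ {x | f x ^ 2 < ε}, |p.eval y| ≤ Real.sqrt ε + δ := by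
      intro y hy
      have h1 : |f y| ≤ Real.sqrt ε := Real.abs_le_sqrt hy.2.le
      have h2 := hfp' y (hE hy.1)
      have h3 : p.eval y = f y - (f y - p.eval y) := by ring
      rw [h3]
      exact (abs_sub _ _).trans (add_le_add h1 h2)
    have hfb : ∀ x ∈ Icc c (c + a), f x ^ 2 ≤ 2 * B ^ 2 * ε + 8 * B ^ 2 * δ ^ 2 := by
      intro x hx
      have h1 := remez hp ha (by positivity) (by nlinarith) (inter_subset_left.trans hE) hE' hpE hx
      have h4 : 6 * a / (ρ * a / 2) = 12 / ρ := by field_simp; norm_num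
      rw [h4, ← hB] at h1
      have h2 := hfp' x hx
      have h3 : |f x| ≤ B * Real.sqrt ε + 2 * (B * δ) := by
        have h5 : f x = p.eval x + (f x - p.eval x) := by ring
        rw [h5]
        refine (abs_add_le _ _).trans ((add_le_add h1 h2).trans ?_)
        have h6 : 1 * δ ≤ B * δ := mul_le_mul_of_nonneg_right (by linarith) hδ0
        linarith [mul_add B (Real.sqrt ε) δ]
      have h6 : f x ^ 2 ≤ (B * Real.sqrt ε + 2 * (B * δ)) ^ 2 := by
        rw [← sq_abs]; gcongr
      have h7 : Real.sqrt ε ^ 2 = ε := Real.sq_sqrt hε0.le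
      nlinarith [sq_nonneg (B * Real.sqrt ε - 2 * (B * δ))]
    have hint : ∫ t in Icc c (c + a), f t ^ 2 ≤ a * (2 * B ^ 2 * ε + 8 * B ^ 2 * δ ^ 2) := by
      have h := setIntegral_mono_on hI (integrableOn_const (by simp)) measurableSet_Icc hfb
      rwa [setIntegral_const, Real.volume_real_Icc_of_le (by linarith), add_sub_cancel_left,
        smul_eq_mul] at h
    have haε : a * ε ≤ 2 * s' / ρ := by
      rw [hε, mul_div_assoc', div_le_div_iff₀ he0 hρ]
      nlinarith
    have haδ : a * δ ^ 2 = (a ^ (n + 1) / n.factorial) ^ 2 * J := by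
      rw [hδ2]; ring
    have hD0 : 0 ≤ (a ^ (n + 1) / n.factorial) ^ 2 * J := by positivity
    -- Since `B ≥ 12 / ρ`, the stray factor `8 / ρ` is absorbed by doubling the power of `B`; hence
    -- the exponent `4 (n + 1)`.
    have hpow : 8 / ρ * B ^ 2 ≤ (12 / ρ) ^ (4 * (n + 1)) := by
      have h1 : (12 / ρ) ^ (4 * (n + 1)) = B ^ 2 * B ^ 2 := by
        rw [hB, ← pow_mul, ← pow_add]; congr 1; ring
      rw [h1]
      have h2 : 8 / ρ ≤ 12 / ρ := by gcongr; norm_num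
      have h3 : B ≤ B ^ 2 := le_self_pow₀ (by linarith) two_ne_zero
      exact mul_le_mul_of_nonneg_right (by linarith) (sq_nonneg B)
    have h8 : 8 ≤ 8 / ρ := by rw [le_div_iff₀ hρ]; linarith
    calc ∫ t in Icc c (c + a), f t ^ 2 ≤ 2 * B ^ 2 * (a * ε) + 8 * B ^ 2 * (a * δ ^ 2) := by
          linarith
      _ ≤ 2 * B ^ 2 * (2 * s' / ρ) + 8 * B ^ 2 * (a * δ ^ 2) := by gcongr
      _ ≤ 8 / ρ * B ^ 2 * (s' + (a ^ (n + 1) / n.factorial) ^ 2 * J) := by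
          rw [haδ]
          have h9 : 2 * B ^ 2 * (2 * s' / ρ) = 4 / ρ * B ^ 2 * s' := by ring
          rw [h9, mul_add]
          gcongr
          norm_num
      _ ≤ _ := mul_le_mul_of_nonneg_right hpow (add_nonneg hs'0.le hD0)
  have h1 : (∫ t in Icc c (c + a), f t ^ 2) / (12 / ρ) ^ (4 * (n + 1)) -
      (a ^ (n + 1) / n.factorial) ^ 2 * J ≤ s := by
    refine le_of_forall_gt_imp_ge_of_dense fun s' hs' => ?_
    have := key s' hs'
    rw [mul_comm, ← div_le_iff₀ hC] at this
    linarith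
  rw [sub_le_iff_le_add, div_le_iff₀ hC] at h1
  linarith

end HeatCube

/-! ### Unique continuation on boxes, by induction on the dimension. -/

namespace HeatCube

/-- Splitting off the zeroth coordinate. -/
abbrev consEquiv (d : ℕ) : (Fin (d + 1) → ℝ) ≃ᵐ ℝ × (Fin d → ℝ) :=
  MeasurableEquiv.piFinSuccAbove (fun _ => ℝ) 0

lemma consEquiv_symm_apply {d : ℕ} (z : ℝ × (Fin d → ℝ)) :
    (consEquiv d).symm z = (Fin.cons z.1 z.2 : Fin (d + 1) → ℝ) := by
  simp [consEquiv, MeasurableEquiv.piFinSuccAbove, Fin.insertNthEquiv]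

lemma consEquiv_symm_preimage {d : ℕ} (A : Set (Fin (d + 1) → ℝ)) :
    (consEquiv d).symm ⁻¹' A =
      {z : ℝ × (Fin d → ℝ) | (Fin.cons z.1 z.2 : Fin (d + 1) → ℝ) ∈ A} := by
  ext z
  rw [mem_preimage, consEquiv_symm_apply]
  rfl

lemma continuous_cons {d : ℕ} :
    Continuous fun z : ℝ × (Fin d → ℝ) => (Fin.cons z.1 z.2 : Fin (d + 1) → ℝ) := by
  refine continuous_pi fun j => ?_
  refine Fin.cases ?_ (fun i => ?_) j
  · simpa using continuous_fst
  · simp only [Fin.cons_succ]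
    fun_prop

lemma setIntegral_consEquiv {d : ℕ} (F : (Fin (d + 1) → ℝ) → ℝ) (A : Set (Fin (d + 1) → ℝ)) :
    ∫ x in A, F x = ∫ z in {z : ℝ × (Fin d → ℝ) | (Fin.cons z.1 z.2 : Fin (d + 1) → ℝ) ∈ A},
      F (Fin.cons z.1 z.2) := by
  have hmp := (volume_preserving_piFinSuccAbove (fun _ : Fin (d + 1) => ℝ) 0).symm
  have h := hmp.setIntegral_preimage_emb (consEquiv d).symm.measurableEmbedding F A
  rw [← h, consEquiv_symm_preimage]
  simp only [consEquiv_symm_apply]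

lemma volume_consEquiv {d : ℕ} (A : Set (Fin (d + 1) → ℝ)) :
    volume A = volume {z : ℝ × (Fin d → ℝ) | (Fin.cons z.1 z.2 : Fin (d + 1) → ℝ) ∈ A} := by
  have hmp := (volume_preserving_piFinSuccAbove (fun _ : Fin (d + 1) => ℝ) 0).symm
  have h := hmp.measure_preimage_emb (consEquiv d).symm.measurableEmbedding A
  rw [← h, consEquiv_symm_preimage]

lemma cons_mem_Icc_iff {d : ℕ} (c a : Fin (d + 1) → ℝ) (z : ℝ × (Fin d → ℝ)) :
    (Fin.cons z.1 z.2 : Fin (d + 1) → ℝ) ∈ Icc c (c + a) ↔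
      z ∈ Icc (c 0) (c 0 + a 0) ×ˢ Icc (Fin.tail c) (Fin.tail c + Fin.tail a) := by
  simp only [mem_Icc, Pi.le_def, Fin.forall_fin_succ, mem_prod, Fin.cons_zero, Fin.cons_succ,
    Pi.add_apply, Fin.tail]
  tauto

lemma volume_Icc_add {d : ℕ} (c a : Fin d → ℝ) :
    volume (Icc c (c + a)) = ∏ j, ENNReal.ofReal (a j) := by
  rw [Real.volume_Icc_pi]
  simp

/-- If `E ⊆ I × Q` has density at least `ρ` then many slices of `E` have density at
least `ρ / 2`. -/
lemma volume_dense_slices {d : ℕ} {E : Set (ℝ × (Fin d → ℝ))} (hE : MeasurableSet E) {c a ρ P : ℝ}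
    {Q : Set (Fin d → ℝ)} (ha : 0 < a) (hρ : 0 < ρ) (hP : 0 ≤ P) (hQ : MeasurableSet Q)
    (hQP : volume Q = ENNReal.ofReal P)
    (hsub : E ⊆ Icc c (c + a) ×ˢ Q) (hvol : ENNReal.ofReal (ρ * (a * P)) ≤ volume E) :
    ENNReal.ofReal (ρ / 2 * P) ≤
      volume (Q ∩ {y | ENNReal.ofReal (ρ / 2 * a) ≤ volume ((fun t => (t, y)) ⁻¹' E)}) := by
  set G := Q ∩ {y | ENNReal.ofReal (ρ / 2 * a) ≤ volume ((fun t => (t, y)) ⁻¹' E)} with hG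
  have hmeas : Measurable fun y => volume ((fun t : ℝ => (t, y)) ⁻¹' E) :=
    measurable_measure_prodMk_right hE
  have hGm : MeasurableSet G := hQ.inter (measurableSet_le measurable_const hmeas)
  -- A slice over `G` has measure at most `a`, and a slice over the rest of `Q` at most `ρ a / 2`.
  -- Integrating, the sparse slices account for at most half of `ρ a P`, so `G` carries the other
  -- half.
  have hslice : ∀ y, volume ((fun t : ℝ => (t, y)) ⁻¹' E) ≤
      G.indicator (fun _ => ENNReal.ofReal a) y +
        Q.indicator (fun _ => ENNReal.ofReal (ρ / 2 * a)) y := by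
    intro y
    have h1 : volume ((fun t : ℝ => (t, y)) ⁻¹' E) ≤ ENNReal.ofReal a := by
      have : (fun t : ℝ => (t, y)) ⁻¹' E ⊆ Icc c (c + a) := fun t ht => (hsub ht).1
      refine (measure_mono this).trans ?_
      rw [Real.volume_Icc, add_sub_cancel_left]
    by_cases hyG : y ∈ G
    · rw [indicator_of_mem hyG]
      exact h1.trans le_self_add
    · rw [indicator_of_notMem hyG, zero_add]
      by_cases hyQ : y ∈ Q
      · rw [indicator_of_mem hyQ]
        by_contra hcon
        exact hyG ⟨hyQ, (not_le.1 hcon).le⟩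
      · have : (fun t : ℝ => (t, y)) ⁻¹' E = ∅ := by
          ext t
          simp only [mem_preimage, mem_empty_iff_false, iff_false]
          exact fun ht => hyQ (hsub ht).2
        rw [this, measure_empty]
        exact zero_le
  have h2 : volume E ≤ ENNReal.ofReal a * volume G + ENNReal.ofReal (ρ / 2 * a) *
      ENNReal.ofReal P := by
    rw [Measure.volume_eq_prod, Measure.prod_apply_symm hE]
    refine (lintegral_mono hslice).trans ?_
    rw [lintegral_add_left (measurable_const.indicator hGm), lintegral_indicator hGm,
      lintegral_indicator hQ, setLIntegral_const, setLIntegral_const, hQP]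
  have hGfin : volume G ≠ ⊤ :=
    ne_top_of_le_ne_top (by simp [hQP]) (measure_mono (inter_subset_left (t := _)))
  have h3 := hvol.trans h2
  rw [← ENNReal.ofReal_toReal hGfin, ← ENNReal.ofReal_mul ha.le,
    ← ENNReal.ofReal_mul (by positivity), ← ENNReal.ofReal_add (by positivity) (by positivity),
    ENNReal.ofReal_le_ofReal_iff (by positivity)] at h3
  rw [ENNReal.ofReal_le_iff_le_toReal hGfin]
  have h4 : a * (ρ / 2 * P) ≤ a * (volume G).toReal := by linarith
  exact le_of_mul_le_mul_left h4 ha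

/-- A quantitative unique continuation estimate for smooth functions on a box. -/
lemma setIntegral_box_sq_le {n : ℕ} {σ : ℝ} (hσ : 0 < σ) (hσ1 : σ ≤ 1) (d : ℕ) :
    ∀ {f : (Fin d → ℝ) → ℝ} {g : Fin d → (Fin d → ℝ) → ℝ} {c a : Fin d → ℝ} {ρ : ℝ}
      {E : Set (Fin d → ℝ)}, Continuous f → (∀ j, Continuous (g j)) →
      (∀ j x, ContDiff ℝ (n + 1 : ℕ) fun t => f (Function.update x j t)) →
      (∀ j x t, iteratedDeriv (n + 1) (fun t => f (Function.update x j t)) t =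
        g j (Function.update x j t)) → (∀ j, 0 < a j) → σ * 2 ^ d ≤ ρ →
      E ⊆ Icc c (c + a) → MeasurableSet E → ENNReal.ofReal (ρ * ∏ j, a j) ≤ volume E →
      ∫ x in Icc c (c + a), f x ^ 2 ≤ ((12 / σ) ^ (4 * (n + 1))) ^ d * ((∫ x in E, f x ^ 2) +
        ∑ j, (a j ^ (n + 1) / n.factorial) ^ 2 * ∫ x in Icc c (c + a), g j x ^ 2) := by
  have hσ12 : 1 ≤ 12 / σ := by rw [le_div_iff₀ hσ]; linarith
  set R : ℝ := (12 / σ) ^ (4 * (n + 1)) with hR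
  have hR1 : 1 ≤ R := one_le_pow₀ hσ12
  clear_value R
  induction d with
  | zero =>
    intro f g c a ρ E _ _ _ _ _ hρ _ _ hvol
    have hρ0 : 0 < ρ := lt_of_lt_of_le (by positivity) hρ
    have hne : E.Nonempty := nonempty_of_measure_ne_zero
      (lt_of_lt_of_le (by simpa using hρ0) hvol).ne'
    have hE : E = univ := Subsingleton.eq_univ_of_nonempty hne
    have hI : Icc c (c + a) = univ := Subsingleton.eq_univ_of_nonempty ⟨c, by simp⟩
    rw [hE, hI]
    simp
  | succ d ih =>
    intro f g c a ρ E hf hg hfd hfg ha hρ hEsub hEm hvol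
    have hρ0 : 0 < ρ := lt_of_lt_of_le (by positivity) hρ
    set I : Set ℝ := Icc (c 0) (c 0 + a 0) with hI
    set Q : Set (Fin d → ℝ) := Icc (Fin.tail c) (Fin.tail c + Fin.tail a) with hQ
    set F : ℝ × (Fin d → ℝ) → ℝ := fun z => f (Fin.cons z.1 z.2) with hF
    set Γ : Fin (d + 1) → ℝ × (Fin d → ℝ) → ℝ := fun j z => g j (Fin.cons z.1 z.2) with hΓ
    have hFc : Continuous F := hf.comp continuous_cons
    have hΓc : ∀ j, Continuous (Γ j) := fun j => (hg j).comp continuous_cons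
    set E' : Set (ℝ × (Fin d → ℝ)) := {z | (Fin.cons z.1 z.2 : Fin (d + 1) → ℝ) ∈ E} with hE'
    have hE'm : MeasurableSet E' := continuous_cons.measurable hEm
    have hE'sub : E' ⊆ I ×ˢ Q := fun z hz => (cons_mem_Icc_iff c a z).1 (hEsub hz)
    have hbox : {z : ℝ × (Fin d → ℝ) | (Fin.cons z.1 z.2 : Fin (d + 1) → ℝ) ∈ Icc c (c + a)} =
        I ×ˢ Q := by
      ext z
      exact cons_mem_Icc_iff c a z
    have htail : ∀ j, 0 < Fin.tail a j := fun j => ha _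
    set P : ℝ := ∏ j, Fin.tail a j with hP
    have hP0 : 0 ≤ P := Finset.prod_nonneg fun j _ => (htail j).le
    have hQP : volume Q = ENNReal.ofReal P := by
      rw [hQ, volume_Icc_add, ENNReal.ofReal_prod_of_nonneg fun j _ => (htail j).le]
    have hprod : ∏ j, a j = a 0 * P := by rw [Fin.prod_univ_succ]; rfl
    rw [hprod, volume_consEquiv] at hvol
    have hQm : MeasurableSet Q := measurableSet_Icc
    -- The base points `G` of dense slices have density at least `ρ / 2` in `Q`. For fixed `t` the
    -- induction hypothesis passes from `Q` to `G`; for fixed `y ∈ G` the one-dimensional estimate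
    -- passes from the segment to the slice of `E`. The density is halved once per dimension, which
    -- the condition `σ 2^d ≤ ρ` provides for.
    have hGvol := volume_dense_slices hE'm (ha 0) hρ0 hP0 hQm hQP hE'sub hvol
    set G := Q ∩ {y | ENNReal.ofReal (ρ / 2 * a 0) ≤ volume ((fun t => (t, y)) ⁻¹' E')} with hG
    have hGm : MeasurableSet G := hQm.inter
      (measurableSet_le measurable_const (measurable_measure_prodMk_right hE'm))
    have hGQ : G ⊆ Q := inter_subset_left
    have hcomp : IsCompact (I ×ˢ Q) := isCompact_Icc.prod isCompact_Icc
    have hint : ∀ H : ℝ × (Fin d → ℝ) → ℝ, Continuous H → IntegrableOn (fun z => H z ^ 2) (I ×ˢ Q) :=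
      fun H hH => (hH.pow 2).continuousOn.integrableOn_compact hcomp
    have hintG : ∀ H : ℝ × (Fin d → ℝ) → ℝ, Continuous H → IntegrableOn (fun z => H z ^ 2) (I ×ˢ G) :=
      fun H hH => (hint H hH).mono_set (prod_mono le_rfl hGQ)
    have hmar : ∀ (H : ℝ × (Fin d → ℝ) → ℝ), Continuous H → ∀ A : Set (Fin d → ℝ), A ⊆ Q →
        Integrable (fun t => ∫ y in A, H (t, y) ^ 2) (volume.restrict I) := by
      intro H hH A hA
      have h := (hint H hH).mono_set (prod_mono le_rfl hA)
      rw [IntegrableOn, Measure.volume_eq_prod, ← Measure.prod_restrict] at h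
      exact h.integral_prod_left
    have hfub : ∀ (H : ℝ × (Fin d → ℝ) → ℝ), Continuous H → ∀ A : Set (Fin d → ℝ), A ⊆ Q →
        ∫ z in I ×ˢ A, H z ^ 2 = ∫ t in I, ∫ y in A, H (t, y) ^ 2 := by
      intro H hH A hA
      rw [Measure.volume_eq_prod]
      exact setIntegral_prod _ ((hint H hH).mono_set (prod_mono le_rfl hA))
    have hcube : ∀ H : (Fin (d + 1) → ℝ) → ℝ, ∫ x in Icc c (c + a), H x ^ 2 =
        ∫ z in I ×ˢ Q, H (Fin.cons z.1 z.2) ^ 2 := by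
      intro H
      rw [setIntegral_consEquiv (fun x => H x ^ 2), hbox]
    have hEint : ∫ x in E, f x ^ 2 = ∫ z in E', F z ^ 2 :=
      setIntegral_consEquiv (fun x => f x ^ 2) E
    set ε : Fin (d + 1) → ℝ := fun j => (a j ^ (n + 1) / n.factorial) ^ 2 with hε
    have hε0 : ∀ j, 0 ≤ ε j := fun j => sq_nonneg _
    -- the first coordinate frozen
    have hstep1 : ∀ t ∈ I, ∫ y in Q, F (t, y) ^ 2 ≤ R ^ d * ((∫ y in G, F (t, y) ^ 2) +
        ∑ j : Fin d, ε j.succ * ∫ y in Q, Γ j.succ (t, y) ^ 2) := by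
      intro t _
      have hupd : ∀ (j : Fin d) (y : Fin d → ℝ) (s : ℝ),
          (Fin.cons t (Function.update y j s) : Fin (d + 1) → ℝ) =
            Function.update (Fin.cons t y : Fin (d + 1) → ℝ) j.succ s := by
        intro j y s
        rw [Fin.cons_update]
      refine ih (f := fun y => F (t, y)) (g := fun j y => Γ j.succ (t, y)) (ρ := ρ / 2)
        (hFc.comp (Continuous.prodMk_right t)) (fun j => (hΓc _).comp (Continuous.prodMk_right t))
        ?_ ?_ htail ?_ hGQ hGm hGvol
      · intro j y
        simp only [hF, hupd]
        exact hfd j.succ _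
      · intro j y s
        simp only [hF, hΓ, hupd]
        exact hfg j.succ _ s
      · rw [pow_succ] at hρ
        linarith
    have hA : ∫ z in I ×ˢ Q, F z ^ 2 ≤ R ^ d * ((∫ z in I ×ˢ G, F z ^ 2) +
        ∑ j : Fin d, ε j.succ * ∫ z in I ×ˢ Q, Γ j.succ z ^ 2) := by
      rw [hfub F hFc Q le_rfl, hfub F hFc G hGQ]
      have : ∀ j : Fin d, ∫ z in I ×ˢ Q, Γ j.succ z ^ 2 = ∫ t in I, ∫ y in Q, Γ j.succ (t, y) ^ 2 :=
        fun j => hfub _ (hΓc _) Q le_rfl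
      simp_rw [this]
      have hi2 : ∀ j ∈ (Finset.univ : Finset (Fin d)), Integrable
          (fun t => ε j.succ * ∫ y in Q, Γ j.succ (t, y) ^ 2) (volume.restrict I) :=
        fun j _ => (hmar _ (hΓc _) Q le_rfl).const_mul _
      have hi1 := hmar F hFc G hGQ
      calc ∫ t in I, ∫ y in Q, F (t, y) ^ 2 ≤ ∫ t in I, R ^ d * ((∫ y in G, F (t, y) ^ 2) +
            ∑ j : Fin d, ε j.succ * ∫ y in Q, Γ j.succ (t, y) ^ 2) :=
            setIntegral_mono_on (hmar F hFc Q le_rfl)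
              ((hi1.add (integrable_finsetSum _ hi2)).const_mul _) measurableSet_Icc hstep1
        _ = _ := by
            rw [integral_const_mul, integral_add hi1 (integrable_finsetSum _ hi2),
              integral_finsetSum _ hi2]
            simp_rw [integral_const_mul]
    -- the other coordinates frozen
    have hstep2 : ∀ y ∈ G, ∫ t in I, F (t, y) ^ 2 ≤
        R * ((∫ t in I, E'.indicator (fun z => F z ^ 2) (t, y)) +
          ε 0 * ∫ t in I, Γ 0 (t, y) ^ 2) := by
      intro y hy
      have hupd : ∀ s : ℝ, (Fin.cons s y : Fin (d + 1) → ℝ) =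
          Function.update (Fin.cons 0 y : Fin (d + 1) → ℝ) 0 s := by
        intro s
        rw [Fin.update_cons_zero]
      have hFy : (fun t => F (t, y)) =
          fun t => f (Function.update (Fin.cons 0 y : Fin (d + 1) → ℝ) 0 t) :=
        funext fun t => congrArg f (hupd t)
      have hs : (fun t => (t, y)) ⁻¹' E' ⊆ I := fun t ht => (hE'sub ht).1
      have hsm : MeasurableSet ((fun t => (t, y)) ⁻¹' E') := measurable_prodMk_right hE'm
      have hden : ENNReal.ofReal (σ * a 0) ≤ volume ((fun t => (t, y)) ⁻¹' E') := by
        refine le_trans (ENNReal.ofReal_le_ofReal ?_) hy.2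
        have h2 : (1 : ℝ) ≤ 2 ^ d := one_le_pow₀ one_le_two
        rw [pow_succ] at hρ
        have : σ ≤ ρ / 2 := by nlinarith
        exact mul_le_mul_of_nonneg_right this (ha 0).le
      have h := setIntegral_Icc_sq_le (f := fun t => F (t, y)) (n := n)
        (by rw [hFy]; exact hfd 0 _) (ha 0) hσ hs hden
      have h1 : ∀ t, iteratedDeriv (n + 1) (fun t => F (t, y)) t = Γ 0 (t, y) := by
        intro t
        rw [hFy, hfg 0 _ t, ← hupd]
      simp only [h1] at h
      have h2 : ∫ t in I, E'.indicator (fun z => F z ^ 2) (t, y) =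
          ∫ t in (fun t => (t, y)) ⁻¹' E', F (t, y) ^ 2 := by
        have h3 : (fun t => E'.indicator (fun z => F z ^ 2) (t, y)) =
            ((fun t => (t, y)) ⁻¹' E').indicator fun t => F (t, y) ^ 2 := rfl
        rw [h3, setIntegral_indicator hsm, inter_eq_self_of_subset_right hs]
      rw [h2, hR]
      exact h
    have hIG : Integrable (fun z : ℝ × (Fin d → ℝ) => F z ^ 2)
        ((volume.restrict I).prod (volume.restrict G)) := by
      rw [Measure.prod_restrict, ← Measure.volume_eq_prod]
      exact hintG F hFc
    have hIG0 : Integrable (fun z : ℝ × (Fin d → ℝ) => Γ 0 z ^ 2)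
        ((volume.restrict I).prod (volume.restrict G)) := by
      rw [Measure.prod_restrict, ← Measure.volume_eq_prod]
      exact hintG _ (hΓc 0)
    have hIGE := hIG.indicator hE'm
    have hswap : ∀ H : ℝ × (Fin d → ℝ) → ℝ, Integrable H
        ((volume.restrict I).prod (volume.restrict G)) →
        ∫ z in I ×ˢ G, H z = ∫ y in G, ∫ t in I, H (t, y) := by
      intro H hH
      rw [Measure.volume_eq_prod, ← Measure.prod_restrict, integral_prod_symm _ hH]
    have hB : ∫ z in I ×ˢ G, F z ^ 2 ≤ R * ((∫ z in E', F z ^ 2) +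
        ε 0 * ∫ z in I ×ˢ Q, Γ 0 z ^ 2) := by
      have h1 : ∫ z in I ×ˢ G, F z ^ 2 ≤ R * ((∫ z in I ×ˢ G, E'.indicator (fun z => F z ^ 2) z) +
          ε 0 * ∫ z in I ×ˢ G, Γ 0 z ^ 2) := by
        rw [hswap _ hIG, hswap _ hIGE, hswap _ hIG0]
        have hj1 := hIGE.integral_prod_right
        have hj2 := hIG0.integral_prod_right.const_mul (ε 0)
        refine (setIntegral_mono_on hIG.integral_prod_right ((hj1.add hj2).const_mul R) hGm
          hstep2).trans_eq ?_
        rw [integral_const_mul, integral_add' hj1 hj2, integral_const_mul]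
      refine h1.trans ?_
      have h2 : ∫ z in I ×ˢ G, E'.indicator (fun z => F z ^ 2) z ≤ ∫ z in E', F z ^ 2 := by
        rw [setIntegral_indicator hE'm]
        exact setIntegral_mono_set ((hint F hFc).mono_set hE'sub)
          (ae_of_all _ fun z => sq_nonneg _) (inter_subset_right (s := _)).eventuallyLE
      have h3 : ∫ z in I ×ˢ G, Γ 0 z ^ 2 ≤ ∫ z in I ×ˢ Q, Γ 0 z ^ 2 :=
        setIntegral_mono_set (hint _ (hΓc 0)) (ae_of_all _ fun z => sq_nonneg _)
          (prod_mono le_rfl hGQ).eventuallyLE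
      have := hε0 0
      gcongr
    rw [hcube, hEint]
    simp_rw [hcube]
    rw [Fin.sum_univ_succ]
    have hS : 0 ≤ ∑ j : Fin d, ε j.succ * ∫ z in I ×ˢ Q, Γ j.succ z ^ 2 :=
      Finset.sum_nonneg fun j _ => mul_nonneg (hε0 _) (integral_nonneg fun z => sq_nonneg _)
    calc ∫ z in I ×ˢ Q, F z ^ 2 ≤ R ^ d * ((∫ z in I ×ˢ G, F z ^ 2) +
          ∑ j : Fin d, ε j.succ * ∫ z in I ×ˢ Q, Γ j.succ z ^ 2) := hA
      _ ≤ R ^ d * (R * ((∫ z in E', F z ^ 2) + ε 0 * ∫ z in I ×ˢ Q, Γ 0 z ^ 2) +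
          R * ∑ j : Fin d, ε j.succ * ∫ z in I ×ˢ Q, Γ j.succ z ^ 2) := by
          gcongr
          exact le_mul_of_one_le_left hS hR1
      _ = _ := by rw [pow_succ]; ring

end HeatCube

/-! ### Tiling of the cube, and orthonormal tensor products on it. -/

namespace HeatCube

/-- Tiles of side at least `a` contain a translate of the thickness box, and sides at most `2 a`
cost only a factor `2` in density per direction. The witness is the integer part of `ℓ / a`. -/
lemma exists_tile_count {ℓ a : ℝ} (ha : 0 < a) (haℓ : a ≤ ℓ) :
    ∃ n : ℕ, 0 < n ∧ a ≤ ℓ / n ∧ ℓ / n ≤ 2 * a := by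
  have h1 : 1 ≤ ℓ / a := by rwa [one_le_div ha]
  have hn : 1 ≤ ⌊ℓ / a⌋₊ := Nat.le_floor (by simpa using h1)
  have hn' : (1 : ℝ) ≤ (⌊ℓ / a⌋₊ : ℝ) := by exact_mod_cast hn
  have h2 := Nat.floor_le (zero_le_one.trans h1)
  have h3 := Nat.lt_floor_add_one (ℓ / a)
  refine ⟨⌊ℓ / a⌋₊, hn, ?_, ?_⟩
  · rw [le_div_iff₀ (by linarith)]
    rw [le_div_iff₀ ha] at h2
    linarith
  · rw [div_le_iff₀ (by linarith)]
    rw [div_lt_iff₀ ha] at h3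
    nlinarith

lemma cube_ae_eq_Icc (d : ℕ) (L : ℝ) :
    cube d L =ᵐ[volume] Icc (0 : Fin d → ℝ) (fun _ => 2 * Real.pi * L) :=
  Measure.univ_pi_Ioo_ae_eq_Icc (μ := fun _ : Fin d => (volume : Measure ℝ)) (f := 0)
    (g := fun _ => 2 * Real.pi * L)

lemma measurableSet_cube (d : ℕ) (L : ℝ) : MeasurableSet (cube d L) :=
  MeasurableSet.univ_pi fun _ => measurableSet_Ioo

lemma integrableOn_cube {d : ℕ} {L : ℝ} {f : (Fin d → ℝ) → ℝ} (hf : Continuous f) :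
    IntegrableOn f (cube d L) :=
  (hf.continuousOn.integrableOn_compact isCompact_Icc).mono_set_ae (cube_ae_eq_Icc d L).le

/-- A quantitative unique continuation estimate for smooth functions on the cube and a thick
set. -/
lemma setIntegral_cube_sq_le {d n : ℕ} {L γ : ℝ} {a : Fin d → ℝ} {S : Set (Fin d → ℝ)}
    (hS : IsThick S γ a) (hL : 0 < L) (ha : ∀ j, a j ≤ 2 * Real.pi * L) {f : (Fin d → ℝ) → ℝ}
    {g : Fin d → (Fin d → ℝ) → ℝ} (hf : Continuous f) (hg : ∀ j, Continuous (g j))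
    (hfd : ∀ j x, ContDiff ℝ (n + 1 : ℕ) fun t => f (Function.update x j t))
    (hfg : ∀ j x t, iteratedDeriv (n + 1) (fun t => f (Function.update x j t)) t =
      g j (Function.update x j t)) :
    ∫ x in cube d L, f x ^ 2 ≤ ((12 * 4 ^ d / γ) ^ (4 * (n + 1))) ^ d *
      ((∫ x in S ∩ cube d L, f x ^ 2) +
        ∑ j, ((2 * a j) ^ (n + 1) / n.factorial) ^ 2 * ∫ x in cube d L, g j x ^ 2) := by
  set ℓ := 2 * Real.pi * L with hℓ
  have hℓ0 : 0 < ℓ := by positivity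
  have hγ := hS.gamma_pos
  choose N hN0 hN1 hN2 using fun j => exists_tile_count (hS.side_pos j) (ha j)
  have hNpos : ∀ j, (0 : ℝ) < N j := fun j => by exact_mod_cast hN0 j
  set h : Fin d → ℝ := fun j => ℓ / N j with hh
  have hh0 : ∀ j, 0 < h j := fun j => div_pos hℓ0 (hNpos j)
  -- Thick sets are only null measurable, whereas the box estimate slices honest measurable sets.
  obtain ⟨S', hS'S, hS'm, hS'⟩ := hS.measurable.exists_measurable_subset_ae_eq
  set c : (∀ j, Fin (N j)) → Fin d → ℝ := fun m j => (m j : ℕ) * h j with hc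
  -- Half-open tiles are exactly disjoint and are recognised by the integer parts of `x j / h j`;
  -- they agree with closed boxes up to null sets.
  set B : (∀ j, Fin (N j)) → Set (Fin d → ℝ) :=
    fun m => univ.pi fun j => Ico (c m j) ((c m + h) j) with hB
  have hBm : ∀ m, MeasurableSet (B m) := fun m => MeasurableSet.univ_pi fun _ => measurableSet_Ico
  have hBI : ∀ m, B m =ᵐ[volume] Icc (c m) (c m + h) := fun m =>
    Measure.univ_pi_Ico_ae_eq_Icc (μ := fun _ : Fin d => (volume : Measure ℝ))
  have hBsub : ∀ m, B m ⊆ Icc (c m) (c m + h) := fun m x hx =>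
    ⟨fun j => (hx j (mem_univ _)).1, fun j => (hx j (mem_univ _)).2.le⟩
  have hmem : ∀ m x, x ∈ B m ↔ ∀ j, 0 ≤ x j ∧ ⌊x j / h j⌋₊ = m j := by
    intro m x
    simp only [hB, mem_univ_pi, mem_Ico, Pi.add_apply, hc]
    refine forall_congr' fun j => ?_
    constructor
    · rintro ⟨h1, h2⟩
      have h3 : 0 ≤ x j := le_trans (mul_nonneg (Nat.cast_nonneg _) (hh0 j).le) h1
      refine ⟨h3, (Nat.floor_eq_iff (div_nonneg h3 (hh0 j).le)).2 ⟨?_, ?_⟩⟩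
      · rwa [le_div_iff₀ (hh0 j)]
      · rw [div_lt_iff₀ (hh0 j)]; linarith
    · rintro ⟨h1, h2⟩
      rw [Nat.floor_eq_iff (div_nonneg h1 (hh0 j).le), le_div_iff₀ (hh0 j),
        div_lt_iff₀ (hh0 j)] at h2
      exact ⟨h2.1, by linarith [h2.2]⟩
  have hdisj : Pairwise (Function.onFun Disjoint B) := by
    intro m m' hmm
    rw [Function.onFun, Set.disjoint_left]
    intro x hx hx'
    refine hmm (funext fun j => Fin.ext ?_)
    rw [← (((hmem m x).1 hx) j).2, ← (((hmem m' x).1 hx') j).2]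
  have hunion : (⋃ m, B m) = univ.pi fun _ : Fin d => Ico (0 : ℝ) ℓ := by
    ext x
    simp only [mem_iUnion, mem_univ_pi, hmem, mem_Ico]
    constructor
    · rintro ⟨m, hm⟩ j
      refine ⟨(hm j).1, ?_⟩
      have h1 : ⌊x j / h j⌋₊ < N j := by rw [(hm j).2]; exact (m j).2
      have h2 := (Nat.floor_lt (div_nonneg (hm j).1 (hh0 j).le)).1 h1
      rwa [div_lt_iff₀ (hh0 j), hh, mul_div_cancel₀ _ (hNpos j).ne'] at h2
    · intro hx
      refine ⟨fun j => ⟨⌊x j / h j⌋₊, ?_⟩, fun j => ⟨(hx j).1, rfl⟩⟩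
      rw [Nat.floor_lt (div_nonneg (hx j).1 (hh0 j).le), div_lt_iff₀ (hh0 j), hh,
        mul_div_cancel₀ _ (hNpos j).ne']
      exact (hx j).2
  have hTcube : (⋃ m, B m) =ᵐ[volume] cube d L := by
    rw [hunion]
    exact (Measure.univ_pi_Ico_ae_eq_Icc (μ := fun _ : Fin d => (volume : Measure ℝ)) (f := 0)
      (g := fun _ => ℓ)).trans (cube_ae_eq_Icc d L).symm
  have hsum : ∀ H : (Fin d → ℝ) → ℝ, Continuous H →
      ∫ x in cube d L, H x ^ 2 = ∑ m, ∫ x in Icc (c m) (c m + h), H x ^ 2 := by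
    intro H hH
    rw [← setIntegral_congr_set hTcube, integral_iUnion_fintype hBm hdisj]
    · exact Finset.sum_congr rfl fun m _ => setIntegral_congr_set (hBI m)
    · exact fun m => ((hH.pow 2).continuousOn.integrableOn_compact isCompact_Icc).mono_set
        (hBsub m)
  have hsumS : ∫ x in S ∩ cube d L, f x ^ 2 = ∑ m, ∫ x in S' ∩ B m, f x ^ 2 := by
    have h1 : (⋃ m, S' ∩ B m : Set _) =ᵐ[volume] (S ∩ cube d L : Set _) := by
      rw [← inter_iUnion]
      exact hS'.inter hTcube
    rw [← setIntegral_congr_set h1, integral_iUnion_fintype (fun m => hS'm.inter (hBm m))]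
    · exact fun m m' hmm => (hdisj hmm).mono inter_subset_right inter_subset_right
    · exact fun m => ((hf.pow 2).continuousOn.integrableOn_compact isCompact_Icc).mono_set
        (inter_subset_right.trans (hBsub m))
  have hvol : ∀ m, ENNReal.ofReal (γ / 2 ^ d * ∏ j, h j) ≤ volume (S' ∩ B m) := by
    intro m
    have h1 : (S' ∩ B m : Set _) =ᵐ[volume] (S ∩ Icc (c m) (c m + h) : Set _) :=
      hS'.inter (hBI m)
    rw [measure_congr h1]
    refine le_trans (le_trans (ENNReal.ofReal_le_ofReal ?_) (hS.le_volume (c m)))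
      (measure_mono (inter_subset_inter_right _ (Icc_subset_Icc_right
        (add_le_add le_rfl fun j => hN1 j))))
    have h2 : ∏ j, h j ≤ ∏ j, 2 * a j :=
      Finset.prod_le_prod (fun j _ => (hh0 j).le) fun j _ => hN2 j
    rw [Finset.prod_mul_distrib, Finset.prod_const, Finset.card_univ, Fintype.card_fin] at h2
    calc γ / 2 ^ d * ∏ j, h j ≤ γ / 2 ^ d * (2 ^ d * ∏ j, a j) := by gcongr
      _ = γ * ∏ j, a j := by field_simp
  -- One factor `2^d` is lost because tiles may have sides up to `2 a`, the other in the induction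
  -- on the dimension.
  set σ : ℝ := γ / 4 ^ d with hσ
  have hσ0 : 0 < σ := by positivity
  have hσ1 : σ ≤ 1 := by
    rw [hσ, div_le_one (by positivity)]
    exact hS.gamma_le_one.trans (one_le_pow₀ (by norm_num))
  have hσρ : σ * 2 ^ d ≤ γ / 2 ^ d := by
    have h4 : (4 : ℝ) ^ d = 2 ^ d * 2 ^ d := by rw [← mul_pow]; norm_num
    rw [hσ, h4]
    apply le_of_eq
    field_simp
  have hσX : 12 / σ = 12 * 4 ^ d / γ := by rw [hσ, div_div_eq_mul_div]
  set R : ℝ := ((12 / σ) ^ (4 * (n + 1))) ^ d with hR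
  have hR0 : 0 ≤ R := by positivity
  have hloc := fun m => setIntegral_box_sq_le (n := n) hσ0 hσ1 d hf hg hfd hfg hh0 hσρ
    ((inter_subset_right (s := S')).trans (hBsub m)) (hS'm.inter (hBm m)) (hvol m)
  rw [← hσX, ← hR]
  calc ∫ x in cube d L, f x ^ 2 ≤ ∑ m, R * ((∫ x in S' ∩ B m, f x ^ 2) +
        ∑ j, (h j ^ (n + 1) / n.factorial) ^ 2 * ∫ x in Icc (c m) (c m + h), g j x ^ 2) := by
        rw [hsum f hf]
        exact Finset.sum_le_sum fun m _ => hloc m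
    _ = R * ((∫ x in S ∩ cube d L, f x ^ 2) +
        ∑ j, (h j ^ (n + 1) / n.factorial) ^ 2 * ∫ x in cube d L, g j x ^ 2) := by
        rw [← Finset.mul_sum, Finset.sum_add_distrib, ← hsumS, Finset.sum_comm]
        simp_rw [← Finset.mul_sum]
        congr 3
        exact funext fun j => by rw [hsum _ (hg j)]
    _ ≤ _ := by
        refine mul_le_mul_of_nonneg_left (add_le_add le_rfl (Finset.sum_le_sum fun j _ =>
          mul_le_mul_of_nonneg_right ?_ (integral_nonneg fun x => sq_nonneg _))) hR0
        have := (hh0 j).le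
        have := hN2 j
        gcongr

/-- A complete orthonormal system on `(0, ℓ)` of eigenfunctions `e k` of `-∂²` with
eigenvalues `(μ k)²`. -/
structure IsEigensystem (ℓ : ℝ) {κ : Type} (e : κ → ℝ → ℝ) (μ : κ → ℝ) : Prop where
  smooth : ∀ k, ContDiff ℝ ∞ (e k)
  deriv_deriv : ∀ k, deriv (deriv (e k)) = fun x => -(μ k) ^ 2 * e k x
  integral_mul_self : ∀ k, ∫ x in Ioo 0 ℓ, e k x * e k x = 1
  integral_mul : ∀ k l, k ≠ l → ∫ x in Ioo 0 ℓ, e k x * e l x = 0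
  complete : ∀ g : ℝ → ℝ, IntegrableOn g (Ioo 0 ℓ) → (∀ k, ∫ x in Ioo 0 ℓ, g x * e k x = 0) →
    g =ᵐ[volume.restrict (Ioo 0 ℓ)] 0

/-- The tensor products of the functions `e k`. -/
noncomputable def prodFun {κ : Type} {d : ℕ} (e : κ → ℝ → ℝ) (k : Fin d → κ) (x : Fin d → ℝ) : ℝ :=
  ∏ j, e (k j) (x j)

section Eigensystem

variable {ℓ : ℝ} {κ : Type} {e : κ → ℝ → ℝ} {μ : κ → ℝ} {d : ℕ}

/-- Only derivatives of even order are guaranteed to be multiples of the eigenfunction itself, so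
the unique continuation estimate is later used with `n + 1 = 2 q + 2`. -/
lemma IsEigensystem.iteratedDeriv_two_mul (he : IsEigensystem ℓ e μ) (k : κ) (p : ℕ) :
    iteratedDeriv (2 * p) (e k) = fun x => (-(μ k) ^ 2) ^ p * e k x := by
  induction p with
  | zero => simp
  | succ p ih =>
    have h1 : 2 * (p + 1) = 2 * p + 1 + 1 := by ring
    have hd : Differentiable ℝ (e k) := (he.smooth k).differentiable (by simp)
    have hd' : Differentiable ℝ (deriv (e k)) := by
      have := (he.smooth k).iterate_deriv 1
      exact this.differentiable (by simp)
    rw [h1, iteratedDeriv_succ, iteratedDeriv_succ, ih]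
    have h2 : deriv (fun x => (-(μ k) ^ 2) ^ p * e k x) =
        fun x => (-(μ k) ^ 2) ^ p * deriv (e k) x := by
      ext x
      exact deriv_const_mul _ (hd x)
    rw [h2]
    ext x
    rw [deriv_const_mul _ (hd' x), he.deriv_deriv]
    ring

lemma IsEigensystem.contDiff_prodFun (he : IsEigensystem ℓ e μ) (k : Fin d → κ) :
    ContDiff ℝ ∞ (prodFun e k) :=
  contDiff_prod fun j _ => (he.smooth (k j)).comp (contDiff_apply ℝ ℝ j)

lemma prodFun_update (k : Fin d → κ) (x : Fin d → ℝ) (j : Fin d) (t : ℝ) :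
    prodFun e k (Function.update x j t) =
      (∏ i ∈ Finset.univ.erase j, e (k i) (x i)) * e (k j) t := by
  rw [prodFun, ← Finset.mul_prod_erase _ _ (Finset.mem_univ j), Function.update_self, mul_comm]
  congr 1
  refine Finset.prod_congr rfl fun i hi => ?_
  rw [Function.update_of_ne (Finset.ne_of_mem_erase hi)]

lemma integral_cube_prodFun_mul {L : ℝ} (he : IsEigensystem (2 * Real.pi * L) e μ)
    (k l : Fin d → κ) [Decidable (k = l)] :
    ∫ x in cube d L, prodFun e k x * prodFun e l x = if k = l then 1 else 0 := by
  have h1 : ∫ x in cube d L, prodFun e k x * prodFun e l x =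
      ∏ j, ∫ t in Ioo 0 (2 * Real.pi * L), e (k j) t * e (l j) t := by
    rw [cube, volume_pi, Measure.restrict_pi_pi]
    simp_rw [prodFun, ← Finset.prod_mul_distrib]
    exact integral_fintype_prod_eq_prod (fun j t => e (k j) t * e (l j) t)
  rw [h1]
  split_ifs with hkl
  · subst hkl
    exact Finset.prod_eq_one fun j _ => he.integral_mul_self (k j)
  · obtain ⟨j, hj⟩ := Function.ne_iff.1 hkl
    exact Finset.prod_eq_zero (Finset.mem_univ j) (he.integral_mul _ _ hj)

lemma integral_cube_sum_sq {L : ℝ} (he : IsEigensystem (2 * Real.pi * L) e μ)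
    (s : Finset (Fin d → κ)) (c : (Fin d → κ) → ℝ) :
    ∫ x in cube d L, (∑ k ∈ s, c k * prodFun e k x) ^ 2 = ∑ k ∈ s, c k ^ 2 := by
  classical
  have hc : ∀ k : Fin d → κ, Continuous (prodFun e k) := fun k => (he.contDiff_prodFun k).continuous
  have h1 : ∀ x, (∑ k ∈ s, c k * prodFun e k x) ^ 2 =
      ∑ k ∈ s, ∑ l ∈ s, c k * c l * (prodFun e k x * prodFun e l x) := by
    intro x
    rw [sq, Finset.sum_mul_sum]
    exact Finset.sum_congr rfl fun k _ => Finset.sum_congr rfl fun l _ => by ring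
  simp_rw [h1]
  have hi : ∀ k l, IntegrableOn (fun x => c k * c l * (prodFun e k x * prodFun e l x))
      (cube d L) := fun k l => integrableOn_cube (continuous_const.mul ((hc k).mul (hc l)))
  rw [integral_finsetSum _ fun k _ => integrable_finsetSum _ fun l _ => hi k l]
  refine Finset.sum_congr rfl fun k hk => ?_
  rw [integral_finsetSum _ fun l _ => hi k l]
  simp_rw [integral_const_mul, integral_cube_prodFun_mul he]
  rw [Finset.sum_eq_single k]
  · simp [sq]
  · intro l _ hl
    simp [hl.symm]
  · exact fun h => absurd hk h

end Eigensystem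

end HeatCube

/-! ### The spectral inequality. -/

namespace HeatCube

variable {κ : Type} {e : κ → ℝ → ℝ} {μ : κ → ℝ} {d : ℕ}

/-- A pure derivative of order `2 q + 2` multiplies each coefficient by a power of `μ (k j) ^ 2 ≤ Λ
^ 2`, so Parseval bounds it by `Λ^(2 q + 2)` times the norm. The derivative bound is used only after
summation over the whole cube, hence no tiles have to be singled out as good ones. -/
lemma setIntegral_cube_sum_sq_le {L γ : ℝ} {a : Fin d → ℝ} {S : Set (Fin d → ℝ)}
    (he : IsEigensystem (2 * Real.pi * L) e μ) (hS : IsThick S γ a) (hL : 0 < L)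
    (ha : ∀ j, a j ≤ 2 * Real.pi * L) (s : Finset (Fin d → κ)) (c : (Fin d → κ) → ℝ) {Λ : ℝ}
    (hs : ∀ k ∈ s, ∑ j, μ (k j) ^ 2 ≤ Λ ^ 2) (q : ℕ) :
    ∑ k ∈ s, c k ^ 2 ≤ ((12 * 4 ^ d / γ) ^ (4 * (2 * q + 2))) ^ d *
      ((∫ x in S ∩ cube d L, (∑ k ∈ s, c k * prodFun e k x) ^ 2) +
        ((2 * (∑ j, a j) * Λ) ^ (2 * q + 2) / (2 * q + 1).factorial) ^ 2 * ∑ k ∈ s, c k ^ 2) := by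
  have hγ := hS.gamma_pos
  have hcont : ∀ c : (Fin d → κ) → ℝ, Continuous fun x => ∑ k ∈ s, c k * prodFun e k x :=
    fun c => continuous_finsetSum _ fun k _ =>
      continuous_const.mul (he.contDiff_prodFun k).continuous
  have hslice : ∀ (j : Fin d) (x : Fin d → ℝ),
      (fun t => ∑ k ∈ s, c k * prodFun e k (Function.update x j t)) =
        fun t => ∑ k ∈ s, (c k * ∏ i ∈ Finset.univ.erase j, e (k i) (x i)) * e (k j) t := by
    intro j x
    funext t
    exact Finset.sum_congr rfl fun k _ => by rw [prodFun_update, mul_assoc]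
  have hsm : ∀ (n : ℕ) (k : κ) (C : ℝ), ContDiff ℝ n fun t => C * e k t :=
    fun n k C => contDiff_const.mul ((he.smooth k).of_le (by exact_mod_cast le_top))
  have h := setIntegral_cube_sq_le (n := 2 * q + 1) hS hL ha
    (f := fun x => ∑ k ∈ s, c k * prodFun e k x)
    (g := fun j x => ∑ k ∈ s, (c k * (-(μ (k j)) ^ 2) ^ (q + 1)) * prodFun e k x)
    (hcont c) (fun j => hcont _)
    (fun j x => by
      rw [hslice]
      exact ContDiff.sum fun k _ => hsm _ _ _)
    (fun j x t => by
      rw [hslice, iteratedDeriv_fun_sum fun k _ => (hsm _ _ _).contDiffAt]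
      refine Finset.sum_congr rfl fun k _ => ?_
      rw [iteratedDeriv_const_mul_field, show 2 * q + 1 + 1 = 2 * (q + 1) by ring,
        he.iteratedDeriv_two_mul, prodFun_update]
      ring)
  rw [integral_cube_sum_sq he] at h
  simp_rw [integral_cube_sum_sq he] at h
  refine h.trans ?_
  have hC : 0 ≤ ∑ k ∈ s, c k ^ 2 := Finset.sum_nonneg fun k _ => sq_nonneg _
  have hA : 0 ≤ ∑ j, a j := Finset.sum_nonneg fun j _ => (hS.side_pos j).le
  have hg : ∀ j, ∑ k ∈ s, (c k * (-(μ (k j)) ^ 2) ^ (q + 1)) ^ 2 ≤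
      (Λ ^ (2 * q + 2)) ^ 2 * ∑ k ∈ s, c k ^ 2 := by
    intro j
    rw [Finset.mul_sum]
    refine Finset.sum_le_sum fun k hk => ?_
    have h1 : μ (k j) ^ 2 ≤ Λ ^ 2 := le_trans
      (Finset.single_le_sum (f := fun j => μ (k j) ^ 2) (fun _ _ => sq_nonneg _)
        (Finset.mem_univ j)) (hs k hk)
    have h2 : (c k * (-(μ (k j)) ^ 2) ^ (q + 1)) ^ 2 = ((μ (k j) ^ 2) ^ (q + 1)) ^ 2 * c k ^ 2 := by
      rw [neg_pow (μ (k j) ^ 2), mul_pow, mul_pow, ← pow_mul, mul_comm (q + 1), pow_mul]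
      norm_num
      ring
    rw [h2, show Λ ^ (2 * q + 2) = (Λ ^ 2) ^ (q + 1) by rw [← pow_mul]; ring_nf]
    gcongr
  -- A sum of equal powers of nonnegative numbers is at most that power of their sum; this is how
  -- `‖a‖₁` appears.
  have hsuma : ∑ j, ((2 * a j) ^ (2 * q + 2)) ^ 2 ≤ ((2 * ∑ j, a j) ^ (2 * q + 2)) ^ 2 := by
    simp_rw [← pow_mul]
    rw [Finset.mul_sum]
    obtain ⟨r, hr⟩ : ∃ r, (2 * q + 2) * 2 = r + 1 := ⟨4 * q + 3, by ring⟩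
    rw [hr]
    calc ∑ j, (2 * a j) ^ (r + 1) ≤ ∑ j, (∑ i, 2 * a i) ^ r * (2 * a j) := by
          refine Finset.sum_le_sum fun j _ => ?_
          rw [pow_succ]
          have h0 := fun i => (hS.side_pos i).le
          have h1 : 2 * a j ≤ ∑ i, 2 * a i := Finset.single_le_sum (f := fun i => 2 * a i)
            (fun i _ => by linarith [h0 i]) (Finset.mem_univ j)
          have := h0 j
          gcongr
      _ = _ := by rw [← Finset.mul_sum, pow_succ]
  gcongr
  calc ∑ j, ((2 * a j) ^ (2 * q + 1 + 1) / ((2 * q + 1).factorial : ℝ)) ^ 2 *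
        ∑ k ∈ s, (c k * (-(μ (k j)) ^ 2) ^ (q + 1)) ^ 2
      ≤ ∑ j, ((2 * a j) ^ (2 * q + 1 + 1) / ((2 * q + 1).factorial : ℝ)) ^ 2 *
        ((Λ ^ (2 * q + 2)) ^ 2 * ∑ k ∈ s, c k ^ 2) :=
        Finset.sum_le_sum fun j _ => mul_le_mul_of_nonneg_left (hg j) (sq_nonneg _)
    _ = (∑ j, ((2 * a j) ^ (2 * q + 2)) ^ 2) *
        ((Λ ^ (2 * q + 2) / ((2 * q + 1).factorial : ℝ)) ^ 2 * ∑ k ∈ s, c k ^ 2) := by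
        rw [Finset.sum_mul]
        exact Finset.sum_congr rfl fun j _ => by ring
    _ ≤ ((2 * ∑ j, a j) ^ (2 * q + 2)) ^ 2 *
        ((Λ ^ (2 * q + 2) / ((2 * q + 1).factorial : ℝ)) ^ 2 * ∑ k ∈ s, c k ^ 2) := by gcongr
    _ = _ := by rw [mul_pow (2 * ∑ j, a j)]; ring

/-- Combine `(n+1)^n ≤ 3^(n+1) n!` with `n + 1 ≤ 2^n`: the base `6 = 2 · 3` is chosen so that
everything cancels except a factor `1/2`. -/
lemma pow_div_factorial_le_half {y : ℝ} (hy : 0 ≤ y) {n : ℕ} (hn : 6 * y ≤ n + 1) :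
    y ^ (n + 1) / n.factorial ≤ 1 / 2 := by
  have h1 := Real.pow_div_factorial_le_exp (x := (n : ℝ) + 1) (by positivity) (n + 1)
  have h3 : Real.exp ((n : ℝ) + 1) ≤ 3 ^ (n + 1) := by
    have : Real.exp ((n : ℝ) + 1) = Real.exp 1 ^ (n + 1) := by
      rw [← Real.exp_nat_mul]; push_cast; ring_nf
    rw [this]
    exact pow_le_pow_left₀ (Real.exp_pos 1).le Real.exp_one_lt_three.le _
  have hn1 : (0 : ℝ) < n + 1 := by positivity
  have h4 : ((n : ℝ) + 1) ^ n ≤ 3 ^ (n + 1) * n.factorial := by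
    have h5 := h1.trans h3
    rw [div_le_iff₀ (by positivity), Nat.factorial_succ, pow_succ' ((n : ℝ) + 1)] at h5
    push_cast at h5
    refine le_of_mul_le_mul_left ?_ hn1
    linarith
  have h6 : ((n : ℝ) + 1) ≤ 2 ^ n := by
    have : n + 1 ≤ 2 ^ n := Nat.lt_two_pow_self
    exact_mod_cast this
  rw [div_le_iff₀ (by positivity)]
  calc y ^ (n + 1) ≤ ((n + 1) / 6) ^ (n + 1) := by
        gcongr
        linarith
    _ = (n + 1) * ((n : ℝ) + 1) ^ n / 6 ^ (n + 1) := by rw [div_pow, pow_succ' ((n : ℝ) + 1)]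
    _ ≤ 2 ^ n * (3 ^ (n + 1) * n.factorial) / 6 ^ (n + 1) := by gcongr
    _ = 1 / 2 * n.factorial := by
        rw [show (6 : ℝ) = 2 * 3 by norm_num, mul_pow, pow_succ (2 : ℝ)]
        field_simp

/-- The base of the constants in the spectral inequality. -/
noncomputable def specBase (d : ℕ) (γ : ℝ) : ℝ := 12 * 4 ^ d / γ

/-- The constant factor in the spectral inequality. -/
noncomputable def specFactor (d : ℕ) (γ : ℝ) : ℝ := 2 * specBase d γ ^ (16 * d)

/-- The constant in the exponent of the spectral inequality. -/
noncomputable def specRate {d : ℕ} (γ : ℝ) (a : Fin d → ℝ) : ℝ :=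
  48 * d * (∑ j, a j) * specBase d γ ^ (2 * d) * Real.log (specBase d γ)

lemma twelve_le_specBase {γ : ℝ} (hγ : 0 < γ) (hγ1 : γ ≤ 1) (d : ℕ) : 12 ≤ specBase d γ := by
  rw [specBase, le_div_iff₀ hγ]
  have : (1 : ℝ) ≤ 4 ^ d := one_le_pow₀ (by norm_num)
  linarith

/-- The spectral inequality. -/
theorem spectral_inequality {L γ : ℝ} {a : Fin d → ℝ} {S : Set (Fin d → ℝ)}
    (he : IsEigensystem (2 * Real.pi * L) e μ) (hS : IsThick S γ a) (hL : 0 < L)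
    (ha : ∀ j, a j ≤ 2 * Real.pi * L) (s : Finset (Fin d → κ)) (c : (Fin d → κ) → ℝ) {Λ : ℝ}
    (hΛ : 0 ≤ Λ) (hs : ∀ k ∈ s, ∑ j, μ (k j) ^ 2 ≤ Λ ^ 2) :
    ∑ k ∈ s, c k ^ 2 ≤ specFactor d γ * Real.exp (specRate γ a * Λ) *
      ∫ x in S ∩ cube d L, (∑ k ∈ s, c k * prodFun e k x) ^ 2 := by
  set X := specBase d γ with hX
  have hX12 : 12 ≤ X := twelve_le_specBase hS.gamma_pos hS.gamma_le_one d
  have hX0 : 0 < X := by linarith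
  have hA : 0 ≤ ∑ j, a j := Finset.sum_nonneg fun j _ => (hS.side_pos j).le
  -- The Remez factor `X^(4 (2 q + 2) d)` has the same exponent structure as the Taylor error and is
  -- absorbed into its base. The choice `q = ⌈3 y⌉` gives `6 y ≤ 2 q + 2`, so the total error is at
  -- most half of `C`.
  set y : ℝ := X ^ (2 * d) * (2 * (∑ j, a j) * Λ) with hy
  have hy0 : 0 ≤ y := by positivity
  set q : ℕ := ⌈3 * y⌉₊ with hq
  have hq1 : 3 * y ≤ q := Nat.le_ceil _
  have hq2 : (q : ℝ) ≤ 3 * y + 1 := (Nat.ceil_lt_add_one (by positivity)).le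
  have h := setIntegral_cube_sum_sq_le he hS hL ha s c hs q
  set I := ∫ x in S ∩ cube d L, (∑ k ∈ s, c k * prodFun e k x) ^ 2 with hI
  have hI0 : 0 ≤ I := integral_nonneg fun x => sq_nonneg _
  set C := ∑ k ∈ s, c k ^ 2 with hC
  have hC0 : 0 ≤ C := Finset.sum_nonneg fun k _ => sq_nonneg _
  set R : ℝ := (X ^ (4 * (2 * q + 2))) ^ d with hR
  have hhalf := pow_div_factorial_le_half hy0 (n := 2 * q + 1) (by push_cast; linarith)
  have herr : R * ((2 * (∑ j, a j) * Λ) ^ (2 * q + 2) / (2 * q + 1).factorial) ^ 2 ≤ 1 / 2 := by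
    have h1 : R * ((2 * (∑ j, a j) * Λ) ^ (2 * q + 2) / (2 * q + 1).factorial) ^ 2 =
        (y ^ (2 * q + 1 + 1) / (2 * q + 1).factorial) ^ 2 := by
      rw [hy, mul_pow (X ^ (2 * d)), mul_div_assoc, mul_pow (_ ^ _), hR]
      congr 1
      rw [← pow_mul, ← pow_mul, ← pow_mul]
      congr 1
      ring
    rw [h1]
    have h2 : 0 ≤ y ^ (2 * q + 1 + 1) / ((2 * q + 1).factorial : ℝ) := by positivity
    nlinarith
  have hmain : C ≤ 2 * R * I := by
    change C ≤ R * (I + _) at h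
    nlinarith
  -- From `q ≤ 3 y + 1` the exponent `(8 q + 8) d` is at most `16 d + 24 d y`; the first term goes
  -- into the factor, the second into the rate, which is linear in `Λ`.
  have hRb : 2 * R ≤ specFactor d γ * Real.exp (specRate γ a * Λ) := by
    rw [specFactor, specRate, ← hX, mul_assoc 2]
    gcongr
    have hlog : 0 ≤ Real.log X := Real.log_nonneg (by linarith)
    have hXexp : ∀ m : ℕ, X ^ m = Real.exp (m * Real.log X) := fun m => by
      rw [← Real.log_pow, Real.exp_log (by positivity)]
    rw [hR, ← pow_mul, hXexp, hXexp (16 * d), ← Real.exp_add]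
    apply Real.exp_le_exp.2
    have h1 : ((4 * (2 * q + 2) * d : ℕ) : ℝ) ≤ (16 * d : ℕ) + 24 * d * y := by
      push_cast
      nlinarith [(Nat.cast_nonneg d : (0 : ℝ) ≤ d)]
    calc ((4 * (2 * q + 2) * d : ℕ) : ℝ) * Real.log X
        ≤ ((16 * d : ℕ) + 24 * d * y) * Real.log X := by gcongr
      _ = _ := by rw [hy]; ring
  exact hmain.trans (mul_le_mul_of_nonneg_right hRb hI0)

end HeatCube

/-! ### Completeness of the cosine, sine and full trigonometric systems. -/

namespace HeatCube

lemma ae_eq_zero_of_forall_integral_mul_continuous {ℓ : ℝ} {g : ℝ → ℝ}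
    (hg : IntegrableOn g (Ioo 0 ℓ))
    (h : ∀ φ : ℝ → ℝ, Continuous φ → ∫ x in Ioo 0 ℓ, g x * φ x = 0) :
    g =ᵐ[volume.restrict (Ioo 0 ℓ)] 0 := by
  have h1 := isOpen_Ioo.ae_eq_zero_of_integral_contDiff_smul_eq_zero (μ := (volume : Measure ℝ))
    (hg.locallyIntegrableOn) (fun φ hφ _ hsupp => by
      have h2 := h φ hφ.continuous
      rw [← setIntegral_eq_integral_of_forall_compl_eq_zero (s := Ioo 0 ℓ)]
      · simpa [mul_comm] using h2
      · intro x hx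
        rw [image_eq_zero_of_notMem_tsupport fun hx' => hx (hsupp hx'), zero_smul])
  exact (ae_restrict_iff' measurableSet_Ioo).2 h1

lemma integrableOn_mul_continuous {ℓ : ℝ} {g φ : ℝ → ℝ} (hg : IntegrableOn g (Ioo 0 ℓ))
    (hφ : Continuous φ) : IntegrableOn (fun x => g x * φ x) (Ioo 0 ℓ) := by
  obtain ⟨C, hC⟩ := (isCompact_Icc (a := (0 : ℝ)) (b := ℓ)).exists_bound_of_continuousOn
    hφ.continuousOn
  refine Integrable.mul_bdd (c := C) hg hφ.aestronglyMeasurable ?_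
  exact (ae_restrict_iff' measurableSet_Ioo).2
    (ae_of_all _ fun x hx => hC x (Ioo_subset_Icc_self hx))

/-- Product-to-sum formulas upgrade orthogonality to cosines to orthogonality to all polynomials in
`cos (π x / ℓ)`. This cosine is injective on `[0, ℓ]`, so every continuous function there is a
continuous function of it, and Weierstrass approximation applies. Uniform approximation needs only
`g ∈ L¹`, which suits the Fubini argument for tensor products. -/
lemma ae_eq_zero_of_integral_mul_cos {ℓ : ℝ} (hℓ : 0 < ℓ) {g : ℝ → ℝ}
    (hg : IntegrableOn g (Ioo 0 ℓ))
    (h : ∀ k : ℕ, ∫ x in Ioo 0 ℓ, g x * Real.cos (k * (Real.pi / ℓ * x)) = 0) :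
    g =ᵐ[volume.restrict (Ioo 0 ℓ)] 0 := by
  have hint : ∀ φ : ℝ → ℝ, Continuous φ → IntegrableOn (fun x => g x * φ x) (Ioo 0 ℓ) :=
    fun φ hφ => integrableOn_mul_continuous hg hφ
  have hpow : ∀ (n k : ℕ), ∫ x in Ioo 0 ℓ, g x *
      (Real.cos (Real.pi / ℓ * x) ^ n * Real.cos (k * (Real.pi / ℓ * x))) = 0 := by
    intro n
    induction n with
    | zero => simpa using h
    | succ n ih =>
      intro k
      cases k with
      | zero =>
        refine Eq.trans ?_ (ih 1)
        congr 1
        funext x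
        simp only [Nat.cast_zero, zero_mul, Real.cos_zero, Nat.cast_one, one_mul, mul_one]
        ring
      | succ k =>
        have h1 : ∀ x : ℝ, g x * (Real.cos (Real.pi / ℓ * x) ^ (n + 1) *
            Real.cos ((k + 1 : ℕ) * (Real.pi / ℓ * x))) =
            (1 / 2) * (g x * (Real.cos (Real.pi / ℓ * x) ^ n *
              Real.cos ((k + 2 : ℕ) * (Real.pi / ℓ * x)))) + (1 / 2) * (g x *
              (Real.cos (Real.pi / ℓ * x) ^ n * Real.cos (k * (Real.pi / ℓ * x)))) := by
          intro x
          set θ := Real.pi / ℓ * x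
          have h2 : ((k + 2 : ℕ) : ℝ) * θ = (k + 1 : ℕ) * θ + θ := by push_cast; ring
          have h3 : (k : ℝ) * θ = (k + 1 : ℕ) * θ - θ := by push_cast; ring
          rw [h2, h3, Real.cos_add, Real.cos_sub]
          ring
        simp_rw [h1]
        rw [integral_add, integral_const_mul, integral_const_mul, ih, ih]
        · simp
        · exact (hint _ (by fun_prop)).const_mul _
        · exact (hint _ (by fun_prop)).const_mul _
  have hpoly : ∀ p : Polynomial ℝ, ∫ x in Ioo 0 ℓ, g x * p.eval (Real.cos (Real.pi / ℓ * x)) = 0 := by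
    intro p
    simp_rw [Polynomial.eval_eq_sum_range, Finset.mul_sum]
    rw [integral_finsetSum]
    · refine Finset.sum_eq_zero fun i _ => ?_
      have h1 : ∀ x, g x * (p.coeff i * Real.cos (Real.pi / ℓ * x) ^ i) =
          p.coeff i * (g x * (Real.cos (Real.pi / ℓ * x) ^ i *
            Real.cos ((0 : ℕ) * (Real.pi / ℓ * x)))) := fun x => by simp; ring
      simp_rw [h1]
      rw [integral_const_mul, hpow, mul_zero]
    · exact fun i _ => hint _ (by fun_prop)
  refine ae_eq_zero_of_forall_integral_mul_continuous hg fun φ hφ => ?_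
  have hψ : Continuous fun s : ℝ => φ (ℓ / Real.pi * Real.arccos s) :=
    hφ.comp (continuous_const.mul Real.continuous_arccos)
  set M := ∫ x in Ioo 0 ℓ, |g x| with hM
  have hM0 : 0 ≤ M := integral_nonneg fun x => abs_nonneg _
  have key : ∀ ε > 0, |∫ x in Ioo 0 ℓ, g x * φ x| ≤ ε * M := by
    intro ε hε
    obtain ⟨p, hp⟩ := exists_polynomial_near_of_continuousOn (-1) 1 _ hψ.continuousOn ε hε
    have h1 : ∫ x in Ioo 0 ℓ, g x * φ x =
        ∫ x in Ioo 0 ℓ, g x * (φ x - p.eval (Real.cos (Real.pi / ℓ * x))) := by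
      simp_rw [mul_sub]
      rw [integral_sub (hint φ hφ) (hint _ (by fun_prop)), hpoly, sub_zero]
    rw [h1, hM, ← integral_const_mul, ← Real.norm_eq_abs]
    refine norm_integral_le_of_norm_le (hg.abs.const_mul ε) ?_
    refine (ae_restrict_iff' measurableSet_Ioo).2 (ae_of_all _ fun x hx => ?_)
    have h2 := hp (Real.cos (Real.pi / ℓ * x)) ⟨Real.neg_one_le_cos _, Real.cos_le_one _⟩
    rw [Real.arccos_cos, show ℓ / Real.pi * (Real.pi / ℓ * x) = x by field_simp] at h2
    · rw [Real.norm_eq_abs, abs_mul, mul_comm, abs_sub_comm]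
      exact mul_le_mul_of_nonneg_right h2.le (abs_nonneg _)
    · have := hx.1; positivity
    · rw [div_mul_eq_mul_div, div_le_iff₀ hℓ]
      exact mul_le_mul_of_nonneg_left hx.2.le Real.pi_pos.le
  have h0 : |∫ x in Ioo 0 ℓ, g x * φ x| ≤ 0 := by
    refine le_of_forall_pos_le_add fun δ hδ => ?_
    refine (key (δ / (M + 1)) (by positivity)).trans ?_
    rw [zero_add, div_mul_eq_mul_div, div_le_iff₀ (by positivity)]
    nlinarith
  exact abs_nonpos_iff.1 h0

/-- Reduction to the cosine system for `g` times `sin (π x / ℓ)`, a weight that is positive inside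
the interval. -/
lemma ae_eq_zero_of_integral_mul_sin {ℓ : ℝ} (hℓ : 0 < ℓ) {g : ℝ → ℝ}
    (hg : IntegrableOn g (Ioo 0 ℓ))
    (h : ∀ k : ℕ, ∫ x in Ioo 0 ℓ, g x * Real.sin ((k + 1 : ℕ) * (Real.pi / ℓ * x)) = 0) :
    g =ᵐ[volume.restrict (Ioo 0 ℓ)] 0 := by
  have h' : ∀ k : ℕ, ∫ x in Ioo 0 ℓ, g x * Real.sin (k * (Real.pi / ℓ * x)) = 0 := by
    intro k
    cases k with
    | zero => simp
    | succ k => exact h k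
  have hint : ∀ φ : ℝ → ℝ, Continuous φ → IntegrableOn (fun x => g x * φ x) (Ioo 0 ℓ) :=
    fun φ hφ => integrableOn_mul_continuous hg hφ
  have h1 := ae_eq_zero_of_integral_mul_cos hℓ (hint (fun x => Real.sin (Real.pi / ℓ * x))
    (by fun_prop)) (fun k => by
      cases k with
      | zero =>
        have := h 0
        simpa using this
      | succ k =>
        have h2 : ∀ x : ℝ, g x * Real.sin (Real.pi / ℓ * x) *
            Real.cos ((k + 1 : ℕ) * (Real.pi / ℓ * x)) =
            (1 / 2) * (g x * Real.sin ((k + 2 : ℕ) * (Real.pi / ℓ * x))) -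
            (1 / 2) * (g x * Real.sin (k * (Real.pi / ℓ * x))) := by
          intro x
          set θ := Real.pi / ℓ * x
          have h2 : ((k + 2 : ℕ) : ℝ) * θ = (k + 1 : ℕ) * θ + θ := by push_cast; ring
          have h3 : (k : ℝ) * θ = (k + 1 : ℕ) * θ - θ := by push_cast; ring
          rw [h2, h3, Real.sin_add, Real.sin_sub]
          ring
        simp_rw [h2]
        rw [integral_sub, integral_const_mul, integral_const_mul, h', h']
        · simp
        · exact (hint _ (by fun_prop)).const_mul _
        · exact (hint _ (by fun_prop)).const_mul _)
  filter_upwards [h1, ae_restrict_mem measurableSet_Ioo] with x hx hx'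
  have hpos : 0 < Real.sin (Real.pi / ℓ * x) := by
    refine Real.sin_pos_of_pos_of_lt_pi ?_ ?_
    · have := hx'.1; positivity
    · rw [div_mul_eq_mul_div, div_lt_iff₀ hℓ]
      exact mul_lt_mul_of_pos_left hx'.2 Real.pi_pos
  exact (mul_eq_zero.1 hx).resolve_right hpos.ne'

/-- Fold the interval at its midpoint: the parts of `g` even and odd under `x ↦ ℓ - x` are tested by
the cosines and the sines of the half interval. -/
lemma ae_eq_zero_of_integral_mul_cos_sin {ℓ : ℝ} (hℓ : 0 < ℓ) {g : ℝ → ℝ}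
    (hg : IntegrableOn g (Ioo 0 ℓ))
    (hc : ∀ k : ℕ, ∫ x in Ioo 0 ℓ, g x * Real.cos (k * (2 * Real.pi / ℓ * x)) = 0)
    (hs : ∀ k : ℕ, ∫ x in Ioo 0 ℓ, g x * Real.sin (k * (2 * Real.pi / ℓ * x)) = 0) :
    g =ᵐ[volume.restrict (Ioo 0 ℓ)] 0 := by
  have hℓ2 : 0 < ℓ / 2 := by linarith
  have hII : ∀ (f : ℝ → ℝ) (b : ℝ), 0 ≤ b → ∫ x in Ioo 0 b, f x = ∫ x in (0 : ℝ)..b, f x :=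
    fun f b hb => by rw [intervalIntegral.integral_of_le hb, integral_Ioc_eq_integral_Ioo]
  have hgI : IntervalIntegrable g volume 0 ℓ := by
    rw [intervalIntegrable_iff_integrableOn_Ioo_of_le hℓ.le]; exact hg
  have hg1 : IntervalIntegrable g volume 0 (ℓ / 2) :=
    hgI.mono_set (by rw [uIcc_of_le hℓ.le, uIcc_of_le hℓ2.le]; exact Icc_subset_Icc_right (by linarith))
  have hg2 : IntervalIntegrable g volume (ℓ / 2) ℓ :=
    hgI.mono_set (by
      rw [uIcc_of_le hℓ.le, uIcc_of_le (by linarith)]; exact Icc_subset_Icc_left (by linarith))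
  have hg3 : IntervalIntegrable (fun x => g (ℓ - x)) volume 0 (ℓ / 2) := by
    have := hg2.symm.comp_sub_left ℓ
    simpa [show ℓ - ℓ / 2 = ℓ / 2 by ring] using this
  have hfold : ∀ (φ : ℝ → ℝ) (τ : ℝ), Continuous φ → (∀ x, φ (ℓ - x) = τ * φ x) →
      ∫ x in Ioo 0 ℓ, g x * φ x = ∫ x in Ioo 0 (ℓ / 2), (g x + τ * g (ℓ - x)) * φ x := by
    intro φ τ hφ hφτ
    rw [hII _ _ hℓ.le, hII _ _ hℓ2.le,
      ← intervalIntegral.integral_add_adjacent_intervals (hg1.mul_continuousOn hφ.continuousOn)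
        (hg2.mul_continuousOn hφ.continuousOn)]
    have h1 : ∫ x in ℓ / 2..ℓ, g x * φ x = ∫ x in (0 : ℝ)..ℓ / 2, g (ℓ - x) * φ (ℓ - x) := by
      rw [intervalIntegral.integral_comp_sub_left (fun x => g x * φ x) ℓ]
      congr 1 <;> ring
    rw [h1, ← intervalIntegral.integral_add (hg1.mul_continuousOn hφ.continuousOn)]
    · refine intervalIntegral.integral_congr fun x _ => ?_
      simp only [hφτ]
      ring
    · have : (fun x => g (ℓ - x) * φ (ℓ - x)) = fun x => g (ℓ - x) * (τ * φ x) := by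
        funext x; rw [hφτ]
      rw [this]
      exact hg3.mul_continuousOn (by fun_prop)
  have hgsum : ∀ τ : ℝ, IntegrableOn (fun x => g x + τ * g (ℓ - x)) (Ioo 0 (ℓ / 2)) := by
    intro τ
    have := hg1.add (hg3.const_mul τ)
    rwa [intervalIntegrable_iff_integrableOn_Ioo_of_le hℓ2.le] at this
  have harg : ∀ (k : ℕ) (x : ℝ), (k : ℝ) * (Real.pi / (ℓ / 2) * x) =
      k * (2 * Real.pi / ℓ * x) := fun k x => by field_simp
  have href : ∀ (k : ℕ) (x : ℝ), (k : ℝ) * (2 * Real.pi / ℓ * (ℓ - x)) =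
      k * (2 * Real.pi) - k * (2 * Real.pi / ℓ * x) := fun k x => by field_simp
  have heven := ae_eq_zero_of_integral_mul_cos hℓ2 (hgsum 1) (fun k => by
    simp_rw [harg]
    rw [← hfold _ 1 (by fun_prop), hc]
    intro x
    rw [href, Real.cos_nat_mul_two_pi_sub, one_mul])
  have hodd := ae_eq_zero_of_integral_mul_sin hℓ2 (hgsum (-1)) (fun k => by
    simp_rw [harg]
    rw [← hfold _ (-1) (by fun_prop), hs]
    intro x
    rw [href, Real.sin_nat_mul_two_pi_sub]
    ring)
  have hboth : ∀ᵐ x, x ∈ Ioo 0 (ℓ / 2) → g x = 0 ∧ g (ℓ - x) = 0 := by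
    have h1 := (ae_restrict_iff' measurableSet_Ioo).1 heven
    have h2 := (ae_restrict_iff' measurableSet_Ioo).1 hodd
    filter_upwards [h1, h2] with x hx1 hx2 hx
    have h3 := hx1 hx
    have h4 := hx2 hx
    simp only [Pi.zero_apply] at h3 h4
    constructor <;> linarith
  have hqmp : Measure.QuasiMeasurePreserving (fun x : ℝ => ℓ - x) volume volume :=
    quasiMeasurePreserving_sub_left volume ℓ
  refine (ae_restrict_iff' measurableSet_Ioo).2 ?_
  filter_upwards [hboth, hqmp.ae hboth, Measure.ae_ne volume (ℓ / 2)] with x h1 h2 h3 hx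
  rcases lt_or_gt_of_ne h3 with h4 | h4
  · exact (h1 ⟨hx.1, h4⟩).1
  · have h5 := (h2 ⟨by linarith [hx.2], by linarith⟩).2
    rwa [sub_sub_cancel] at h5

end HeatCube

/-! ### The one-dimensional eigensystems and completeness of tensor products. -/

namespace HeatCube

/-- The general solution of `f'' = -w² f`. -/
noncomputable def trigFun (A B w x : ℝ) : ℝ := A * Real.cos (w * x) + B * Real.sin (w * x)

lemma contDiff_trigFun (A B w : ℝ) : ContDiff ℝ ∞ (trigFun A B w) := by
  unfold trigFun
  fun_prop

lemma hasDerivAt_trigFun (A B w x : ℝ) :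
    HasDerivAt (trigFun A B w) (trigFun (B * w) (-(A * w)) w x) x := by
  have h : HasDerivAt (fun y : ℝ => w * y) w x := by
    simpa using (hasDerivAt_id x).const_mul w
  have := (h.cos.const_mul A).add (h.sin.const_mul B)
  refine this.congr_deriv ?_
  simp only [trigFun]
  ring

lemma deriv_trigFun (A B w : ℝ) : deriv (trigFun A B w) = trigFun (B * w) (-(A * w)) w :=
  funext fun x => (hasDerivAt_trigFun A B w x).deriv

lemma deriv_deriv_trigFun (A B w : ℝ) :
    deriv (deriv (trigFun A B w)) = fun x => -w ^ 2 * trigFun A B w x := by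
  rw [deriv_trigFun, deriv_trigFun]
  funext x
  simp only [trigFun]
  ring

lemma integral_trigFun {ℓ : ℝ} (hℓ : 0 < ℓ) {A B w : ℝ} (hw : w ≠ 0) (hsin : Real.sin (w * ℓ) = 0)
    (hcos : B = 0 ∨ Real.cos (w * ℓ) = 1) : ∫ x in Ioo 0 ℓ, trigFun A B w x = 0 := by
  rw [← integral_Ioc_eq_integral_Ioo, ← intervalIntegral.integral_of_le hℓ.le]
  have h : ∀ x ∈ uIcc 0 ℓ, HasDerivAt (trigFun (-(B / w)) (A / w) w) (trigFun A B w x) x := by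
    intro x _
    refine (hasDerivAt_trigFun _ _ _ x).congr_deriv ?_
    simp only [trigFun]
    field_simp
  rw [intervalIntegral.integral_eq_sub_of_hasDerivAt h
    ((contDiff_trigFun _ _ _).continuous.intervalIntegrable _ _)]
  simp only [trigFun, hsin]
  rcases hcos with hB | hc
  · simp [hB]
  · simp [hc]

lemma integral_trigFun_zero {ℓ : ℝ} (hℓ : 0 < ℓ) (A B : ℝ) :
    ∫ x in Ioo 0 ℓ, trigFun A B 0 x = ℓ * A := by
  simp [trigFun, hℓ.le]

/-- The Neumann eigenfunctions on `(0, ℓ)`. -/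
noncomputable def neumannFun (ℓ : ℝ) (k : ℕ) : ℝ → ℝ :=
  trigFun (Real.sqrt ((if k = 0 then 1 else 2) / ℓ)) 0 (k * (Real.pi / ℓ))

/-- The Dirichlet eigenfunctions on `(0, ℓ)`. -/
noncomputable def dirichletFun (ℓ : ℝ) (k : ℕ) : ℝ → ℝ :=
  trigFun 0 (Real.sqrt (2 / ℓ)) ((k + 1 : ℕ) * (Real.pi / ℓ))

/-- The periodic eigenfunctions on `(0, ℓ)`. -/
noncomputable def periodicFun (ℓ : ℝ) (k : ℤ) : ℝ → ℝ :=
  trigFun (Real.sqrt (1 / ℓ)) (Real.sqrt (1 / ℓ)) (k * (2 * Real.pi / ℓ))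

lemma integral_trigFun_int {ℓ : ℝ} (hℓ : 0 < ℓ) (A : ℝ) {m : ℤ} (hm : m ≠ 0) :
    ∫ x in Ioo 0 ℓ, trigFun A 0 (m * (Real.pi / ℓ)) x = 0 := by
  refine integral_trigFun hℓ ?_ ?_ (Or.inl rfl)
  · have := Real.pi_pos
    have : (m : ℝ) ≠ 0 := by exact_mod_cast hm
    positivity
  · rw [mul_assoc, div_mul_cancel₀ _ hℓ.ne', Real.sin_int_mul_pi]

lemma integral_trigFun_two_int {ℓ : ℝ} (hℓ : 0 < ℓ) (A B : ℝ) {m : ℤ} (hm : m ≠ 0) :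
    ∫ x in Ioo 0 ℓ, trigFun A B (m * (2 * Real.pi / ℓ)) x = 0 := by
  have h : (m : ℝ) * (2 * Real.pi / ℓ) * ℓ = m * (2 * Real.pi) := by field_simp
  refine integral_trigFun hℓ ?_ ?_ (Or.inr ?_)
  · have := Real.pi_pos
    have : (m : ℝ) ≠ 0 := by exact_mod_cast hm
    positivity
  · rw [h, show (m : ℝ) * (2 * Real.pi) = ((2 * m : ℤ) : ℝ) * Real.pi by push_cast; ring,
      Real.sin_int_mul_pi]
  · rw [h, Real.cos_int_mul_two_pi]

lemma isEigensystem_neumann {ℓ : ℝ} (hℓ : 0 < ℓ) :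
    IsEigensystem ℓ (neumannFun ℓ) fun k => k * (Real.pi / ℓ) := by
  have hmul : ∀ (k l : ℕ) (x : ℝ), neumannFun ℓ k x * neumannFun ℓ l x =
      trigFun (Real.sqrt ((if k = 0 then 1 else 2) / ℓ) *
        Real.sqrt ((if l = 0 then 1 else 2) / ℓ) / 2) 0 (((k : ℤ) + l : ℤ) * (Real.pi / ℓ)) x +
      trigFun (Real.sqrt ((if k = 0 then 1 else 2) / ℓ) *
        Real.sqrt ((if l = 0 then 1 else 2) / ℓ) / 2) 0 (((k : ℤ) - l : ℤ) * (Real.pi / ℓ)) x := by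
    intro k l x
    simp only [neumannFun, trigFun]
    push_cast
    simp only [add_mul, sub_mul, Real.cos_add, Real.cos_sub]
    ring
  have hint : ∀ A B w : ℝ, IntegrableOn (trigFun A B w) (Ioo 0 ℓ) := fun A B w =>
    (contDiff_trigFun A B w).continuous.integrableOn_Icc.mono_set Ioo_subset_Icc_self
  refine ⟨fun k => contDiff_trigFun _ _ _, fun k => deriv_deriv_trigFun _ _ _, ?_, ?_, ?_⟩
  · intro k
    simp_rw [hmul]
    rw [integral_add (hint _ _ _) (hint _ _ _), sub_self, Int.cast_zero, zero_mul,
      integral_trigFun_zero hℓ]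
    rcases eq_or_ne k 0 with rfl | hk
    · rw [Nat.cast_zero, add_zero, Int.cast_zero, zero_mul, integral_trigFun_zero hℓ,
        Real.mul_self_sqrt (by positivity)]
      simp only [if_true]
      field_simp
      norm_num
    · rw [integral_trigFun_int hℓ _ (by omega), Real.mul_self_sqrt (by positivity), if_neg hk]
      field_simp
      norm_num
  · intro k l hkl
    simp_rw [hmul]
    rw [integral_add (hint _ _ _) (hint _ _ _), integral_trigFun_int hℓ _ (by omega),
      integral_trigFun_int hℓ _ (by omega), add_zero]
  · intro g hg h
    refine ae_eq_zero_of_integral_mul_cos hℓ hg fun k => ?_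
    have h1 := h k
    have h2 : ∀ x, g x * neumannFun ℓ k x = Real.sqrt ((if k = 0 then 1 else 2) / ℓ) *
        (g x * Real.cos (k * (Real.pi / ℓ * x))) := by
      intro x
      simp only [neumannFun, trigFun, mul_assoc]
      ring
    simp_rw [h2] at h1
    rw [integral_const_mul] at h1
    refine (mul_eq_zero.1 h1).resolve_left (Real.sqrt_pos.2 ?_).ne'
    split_ifs <;> positivity

lemma isEigensystem_dirichlet {ℓ : ℝ} (hℓ : 0 < ℓ) :
    IsEigensystem ℓ (dirichletFun ℓ) fun k => (k + 1 : ℕ) * (Real.pi / ℓ) := by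
  have hmul : ∀ (k l : ℕ) (x : ℝ), dirichletFun ℓ k x * dirichletFun ℓ l x =
      trigFun (1 / ℓ) 0 (((k : ℤ) - l : ℤ) * (Real.pi / ℓ)) x -
      trigFun (1 / ℓ) 0 (((k : ℤ) + l + 2 : ℤ) * (Real.pi / ℓ)) x := by
    intro k l x
    have h1 : Real.sqrt (2 / ℓ) * Real.sqrt (2 / ℓ) = 2 / ℓ := Real.mul_self_sqrt (by positivity)
    have h2 : (((k : ℤ) - l : ℤ) : ℝ) * (Real.pi / ℓ) * x =
        (k + 1 : ℕ) * (Real.pi / ℓ) * x - (l + 1 : ℕ) * (Real.pi / ℓ) * x := by push_cast; ring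
    have h3 : (((k : ℤ) + l + 2 : ℤ) : ℝ) * (Real.pi / ℓ) * x =
        (k + 1 : ℕ) * (Real.pi / ℓ) * x + (l + 1 : ℕ) * (Real.pi / ℓ) * x := by push_cast; ring
    simp only [dirichletFun, trigFun]
    rw [h2, h3, Real.cos_add, Real.cos_sub]
    linear_combination (Real.sin ((k + 1 : ℕ) * (Real.pi / ℓ) * x) *
      Real.sin ((l + 1 : ℕ) * (Real.pi / ℓ) * x)) * h1
  have hint : ∀ A B w : ℝ, IntegrableOn (trigFun A B w) (Ioo 0 ℓ) := fun A B w =>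
    (contDiff_trigFun A B w).continuous.integrableOn_Icc.mono_set Ioo_subset_Icc_self
  refine ⟨fun k => contDiff_trigFun _ _ _, fun k => deriv_deriv_trigFun _ _ _, ?_, ?_, ?_⟩
  · intro k
    simp_rw [hmul]
    rw [integral_sub (hint _ _ _) (hint _ _ _), sub_self, Int.cast_zero, zero_mul,
      integral_trigFun_zero hℓ, integral_trigFun_int hℓ _ (by omega), sub_zero,
      mul_one_div_cancel hℓ.ne']
  · intro k l hkl
    simp_rw [hmul]
    rw [integral_sub (hint _ _ _) (hint _ _ _), integral_trigFun_int hℓ _ (by omega),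
      integral_trigFun_int hℓ _ (by omega), sub_zero]
  · intro g hg h
    refine ae_eq_zero_of_integral_mul_sin hℓ hg fun k => ?_
    have h1 := h k
    have h2 : ∀ x, g x * dirichletFun ℓ k x = Real.sqrt (2 / ℓ) *
        (g x * Real.sin ((k + 1 : ℕ) * (Real.pi / ℓ * x))) := by
      intro x
      simp only [dirichletFun, trigFun, mul_assoc]
      ring
    simp_rw [h2] at h1
    rw [integral_const_mul] at h1
    exact (mul_eq_zero.1 h1).resolve_left (Real.sqrt_pos.2 (by positivity)).ne'

lemma isEigensystem_periodic {ℓ : ℝ} (hℓ : 0 < ℓ) :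
    IsEigensystem ℓ (periodicFun ℓ) fun k => k * (2 * Real.pi / ℓ) := by
  -- The functions `cos + sin`, indexed by all integers, form one real family with a single
  -- normalisation: the products reduce to `cos` of the difference, which detects `k = l`, and `sin`
  -- of the sum, which always integrates to zero.
  have hmul : ∀ (k l : ℤ) (x : ℝ), periodicFun ℓ k x * periodicFun ℓ l x =
      trigFun (1 / ℓ) 0 ((k - l : ℤ) * (2 * Real.pi / ℓ)) x +
      trigFun 0 (1 / ℓ) ((k + l : ℤ) * (2 * Real.pi / ℓ)) x := by
    intro k l x
    have h1 : Real.sqrt (1 / ℓ) * Real.sqrt (1 / ℓ) = 1 / ℓ := Real.mul_self_sqrt (by positivity)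
    simp only [periodicFun, trigFun]
    push_cast
    simp only [add_mul, sub_mul, Real.sin_add, Real.cos_sub]
    linear_combination ((Real.cos (k * (2 * Real.pi / ℓ) * x) +
      Real.sin (k * (2 * Real.pi / ℓ) * x)) * (Real.cos (l * (2 * Real.pi / ℓ) * x) +
      Real.sin (l * (2 * Real.pi / ℓ) * x))) * h1
  have hint : ∀ A B w : ℝ, IntegrableOn (trigFun A B w) (Ioo 0 ℓ) := fun A B w =>
    (contDiff_trigFun A B w).continuous.integrableOn_Icc.mono_set Ioo_subset_Icc_self
  refine ⟨fun k => contDiff_trigFun _ _ _, fun k => deriv_deriv_trigFun _ _ _, ?_, ?_, ?_⟩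
  · intro k
    simp_rw [hmul]
    rw [integral_add (hint _ _ _) (hint _ _ _), sub_self, Int.cast_zero, zero_mul,
      integral_trigFun_zero hℓ, mul_one_div_cancel hℓ.ne']
    rcases eq_or_ne k 0 with rfl | hk
    · rw [add_zero, Int.cast_zero, zero_mul, integral_trigFun_zero hℓ]
      simp
    · rw [integral_trigFun_two_int hℓ _ _ (by omega), add_zero]
  · intro k l hkl
    simp_rw [hmul]
    rw [integral_add (hint _ _ _) (hint _ _ _), integral_trigFun_two_int hℓ _ _ (by omega)]
    rcases eq_or_ne (k + l) 0 with h0 | h0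
    · rw [h0, Int.cast_zero, zero_mul, integral_trigFun_zero hℓ]
      simp
    · rw [integral_trigFun_two_int hℓ _ _ h0, add_zero]
  · intro g hg h
    have hg' : ∀ k : ℤ, IntegrableOn (fun x => g x * periodicFun ℓ k x) (Ioo 0 ℓ) :=
      fun k => integrableOn_mul_continuous hg (contDiff_trigFun _ _ _).continuous
    have hs : 0 < Real.sqrt (1 / ℓ) := Real.sqrt_pos.2 (by positivity)
    refine ae_eq_zero_of_integral_mul_cos_sin hℓ hg (fun k => ?_) (fun k => ?_)
    · have h2 : ∀ x, g x * Real.cos (k * (2 * Real.pi / ℓ * x)) = 1 / (2 * Real.sqrt (1 / ℓ)) *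
          (g x * periodicFun ℓ (k : ℤ) x + g x * periodicFun ℓ (-(k : ℤ)) x) := by
        intro x
        have h3 : -(k : ℝ) * (2 * Real.pi / ℓ) * x = -((k : ℝ) * (2 * Real.pi / ℓ) * x) := by ring
        simp only [periodicFun, trigFun]
        push_cast
        rw [h3, Real.cos_neg, Real.sin_neg, ← mul_assoc (k : ℝ)]
        field_simp
        ring
      simp_rw [h2]
      rw [integral_const_mul, integral_add (hg' _) (hg' _), h, h]
      simp
    · have h2 : ∀ x, g x * Real.sin (k * (2 * Real.pi / ℓ * x)) = 1 / (2 * Real.sqrt (1 / ℓ)) *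
          (g x * periodicFun ℓ (k : ℤ) x - g x * periodicFun ℓ (-(k : ℤ)) x) := by
        intro x
        have h3 : -(k : ℝ) * (2 * Real.pi / ℓ) * x = -((k : ℝ) * (2 * Real.pi / ℓ) * x) := by ring
        simp only [periodicFun, trigFun]
        push_cast
        rw [h3, Real.cos_neg, Real.sin_neg, ← mul_assoc (k : ℝ)]
        field_simp
        ring
      simp_rw [h2]
      rw [integral_const_mul, integral_sub (hg' _) (hg' _), h, h]
      simp

/-- The tensor products of a complete system are complete. -/
lemma IsEigensystem.ae_eq_zero {ℓ : ℝ} {κ : Type} [Countable κ] {e : κ → ℝ → ℝ} {μ : κ → ℝ}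
    (he : IsEigensystem ℓ e μ) (d : ℕ) : ∀ f : (Fin d → ℝ) → ℝ,
    IntegrableOn f (univ.pi fun _ => Ioo 0 ℓ) →
    (∀ k : Fin d → κ, ∫ x in univ.pi fun _ => Ioo 0 ℓ, f x * prodFun e k x = 0) →
    ∀ᵐ x, x ∈ (univ.pi fun _ : Fin d => Ioo 0 ℓ) → f x = 0 := by
  induction d with
  | zero =>
    intro f _ h
    have h1 := h Fin.elim0
    have huniv : (univ.pi fun _ : Fin 0 => Ioo 0 ℓ) = univ := by
      ext x; simp
    rw [huniv, Measure.restrict_univ] at h1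
    have hdirac : (volume : Measure (Fin 0 → ℝ)) = Measure.dirac 0 := by
      rw [volume_pi, Measure.pi_of_empty _ 0]
    rw [hdirac, integral_dirac] at h1
    refine ae_of_all _ fun x _ => ?_
    rw [Subsingleton.elim x 0]
    simpa [prodFun] using h1
  | succ d ih =>
    intro f hf h
    set Q : Set (Fin d → ℝ) := univ.pi fun _ => Ioo 0 ℓ with hQ
    have hQm : MeasurableSet Q := MeasurableSet.univ_pi fun _ => measurableSet_Ioo
    have hcube : {z : ℝ × (Fin d → ℝ) | (Fin.cons z.1 z.2 : Fin (d + 1) → ℝ) ∈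
        univ.pi fun _ => Ioo 0 ℓ} = Ioo 0 ℓ ×ˢ Q := by
      ext z
      simp only [mem_ofPred_eq, mem_univ_pi, Fin.forall_fin_succ, Fin.cons_zero, Fin.cons_succ,
        mem_prod, hQ]
    have hmp := (volume_preserving_piFinSuccAbove (fun _ : Fin (d + 1) => ℝ) 0).symm
    have hF : Integrable (fun z : ℝ × (Fin d → ℝ) => f (Fin.cons z.1 z.2))
        ((volume.restrict (Ioo 0 ℓ)).prod (volume.restrict Q)) := by
      rw [Measure.prod_restrict, ← Measure.volume_eq_prod, ← hcube, ← consEquiv_symm_preimage]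
      have h1 := (hmp.integrableOn_comp_preimage (consEquiv d).symm.measurableEmbedding
        (f := f) (s := univ.pi fun _ => Ioo 0 ℓ)).2 hf
      simp only [Function.comp_def, consEquiv_symm_apply] at h1
      exact h1
    have hbd : ∀ k : κ, ∃ C, ∀ x ∈ Ioo 0 ℓ, ‖e k x‖ ≤ C := by
      intro k
      obtain ⟨C, hC⟩ := (isCompact_Icc (a := (0 : ℝ)) (b := ℓ)).exists_bound_of_continuousOn
        (he.smooth k).continuous.continuousOn
      exact ⟨C, fun x hx => hC x (Ioo_subset_Icc_self hx)⟩
    have hFk : ∀ k : κ, Integrable (fun z : ℝ × (Fin d → ℝ) => f (Fin.cons z.1 z.2) * e k z.1)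
        ((volume.restrict (Ioo 0 ℓ)).prod (volume.restrict Q)) := by
      intro k
      obtain ⟨C, hC⟩ := hbd k
      refine hF.mul_bdd (c := C)
        ((he.smooth k).continuous.comp continuous_fst).aestronglyMeasurable ?_
      rw [Measure.prod_restrict]
      exact (ae_restrict_iff' (measurableSet_Ioo.prod hQm)).2
        (ae_of_all _ fun z hz => hC z.1 hz.1)
    have hpQ : ∀ k' : Fin d → κ, ∃ C, ∀ y ∈ Q, ‖prodFun e k' y‖ ≤ C := by
      intro k'
      obtain ⟨C, hC⟩ := (isCompact_Icc (a := (0 : Fin d → ℝ))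
        (b := fun _ => ℓ)).exists_bound_of_continuousOn
        (he.contDiff_prodFun k').continuous.continuousOn
      exact ⟨C, fun y hy => hC y ⟨fun j => (hy j (mem_univ _)).1.le,
        fun j => (hy j (mem_univ _)).2.le⟩⟩
    -- Integrating out the first variable against `e k` leaves an integrable function of the other
    -- variables whose tensor coefficients all vanish, so the induction hypothesis applies.
    have hG : ∀ k : κ, ∀ᵐ y, y ∈ Q → ∫ t in Ioo 0 ℓ, f (Fin.cons t y) * e k t = 0 := by
      intro k
      refine ih _ (hFk k).integral_prod_right fun k' => ?_
      have h1 := h (Fin.cons k k')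
      rw [setIntegral_consEquiv (fun x => f x * prodFun e (Fin.cons k k') x), hcube,
        Measure.volume_eq_prod, ← Measure.prod_restrict] at h1
      have h2 : ∀ z : ℝ × (Fin d → ℝ), f (Fin.cons z.1 z.2) *
          prodFun e (Fin.cons k k' : Fin (d + 1) → κ) (Fin.cons z.1 z.2) =
          f (Fin.cons z.1 z.2) * e k z.1 * prodFun e k' z.2 := by
        intro z
        simp only [prodFun, Fin.prod_univ_succ, Fin.cons_zero, Fin.cons_succ]
        ring
      simp_rw [h2] at h1
      obtain ⟨C, hC⟩ := hpQ k'
      have h3 : Integrable (fun z : ℝ × (Fin d → ℝ) =>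
          f (Fin.cons z.1 z.2) * e k z.1 * prodFun e k' z.2)
          ((volume.restrict (Ioo 0 ℓ)).prod (volume.restrict Q)) := by
        refine (hFk k).mul_bdd (c := C)
          ((he.contDiff_prodFun k').continuous.comp continuous_snd).aestronglyMeasurable ?_
        rw [Measure.prod_restrict]
        exact (ae_restrict_iff' (measurableSet_Ioo.prod hQm)).2
          (ae_of_all _ fun z hz => hC z.2 hz.2)
      rw [integral_prod_symm _ h3] at h1
      simpa only [integral_mul_const] using h1
    have hslice : ∀ᵐ y ∂volume.restrict Q,
        ∀ᵐ t ∂volume.restrict (Ioo 0 ℓ), f (Fin.cons t y) = 0 := by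
      -- Countability of the index set allows one exceptional null set for all `k`; then almost
      -- every slice is killed by one-dimensional completeness.
      have h1 : ∀ᵐ y ∂volume.restrict Q, ∀ k, ∫ t in Ioo 0 ℓ, f (Fin.cons t y) * e k t = 0 :=
        ae_all_iff.2 fun k => (ae_restrict_iff' hQm).2 (hG k)
      filter_upwards [h1, hF.prod_left_ae] with y hy hy'
      exact he.complete _ hy' hy
    have hae : ∀ᵐ z ∂(volume.restrict (Ioo 0 ℓ)).prod (volume.restrict Q),
        f (Fin.cons z.1 z.2) = 0 := by
      have h1 : ∫ z, ‖f (Fin.cons z.1 z.2)‖ ∂(volume.restrict (Ioo 0 ℓ)).prod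
          (volume.restrict Q) = 0 := by
        rw [integral_prod_symm _ hF.norm]
        refine integral_eq_zero_of_ae ?_
        filter_upwards [hslice] with y hy
        refine integral_eq_zero_of_ae ?_
        filter_upwards [hy] with t ht
        rw [ht, norm_zero, Pi.zero_apply]
      have h2 := (integral_eq_zero_iff_of_nonneg (fun z => norm_nonneg _) hF.norm).1 h1
      filter_upwards [h2] with z hz
      exact norm_eq_zero.1 hz
    rw [Measure.prod_restrict, ae_restrict_iff' (measurableSet_Ioo.prod hQm),
      ← Measure.volume_eq_prod] at hae
    have hmp' := volume_preserving_piFinSuccAbove (fun _ : Fin (d + 1) => ℝ) 0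
    have h5 := hmp'.quasiMeasurePreserving.ae hae
    filter_upwards [h5] with x hx hxQ
    have h6 : (Fin.cons ((consEquiv d) x).1 ((consEquiv d) x).2 : Fin (d + 1) → ℝ) = x := by
      rw [← consEquiv_symm_apply, MeasurableEquiv.symm_apply_apply]
    rw [← h6]
    refine hx ?_
    rw [← hcube, mem_ofPred_eq]
    rw [← h6] at hxQ
    exact hxQ

end HeatCube

/-! ### Partial derivatives, integration by parts and boundary cutoffs. -/

namespace HeatCube

open Filter Topology

variable {d : ℕ}

/-- The tensor product of the functions `h j`. -/
noncomputable def tensor (h : Fin d → ℝ → ℝ) (x : Fin d → ℝ) : ℝ := ∏ j, h j (x j)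

lemma contDiff_tensor {h : Fin d → ℝ → ℝ} (hh : ∀ j, ContDiff ℝ ∞ (h j)) :
    ContDiff ℝ ∞ (tensor h) :=
  contDiff_prod fun j _ => (hh j).comp (contDiff_apply ℝ ℝ j)

lemma partialDeriv_eq_deriv {φ : (Fin d → ℝ) → ℝ} {x : Fin d → ℝ} (hφ : DifferentiableAt ℝ φ x)
    (j : Fin d) : partialDeriv j φ x = deriv (fun t => φ (Function.update x j t)) (x j) := by
  have h1 : HasFDerivAt φ (fderiv ℝ φ x) (Function.update x j (x j)) := by
    rw [Function.update_eq_self]; exact hφ.hasFDerivAt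
  exact (h1.comp_hasDerivAt (x j) (hasDerivAt_update x j (x j))).deriv.symm

lemma contDiff_partialDeriv {φ : (Fin d → ℝ) → ℝ} (hφ : ContDiff ℝ ∞ φ) (j : Fin d) :
    ContDiff ℝ ∞ (partialDeriv j φ) :=
  (hφ.fderiv_right (m := ∞) (by simp)).clm_apply contDiff_const

lemma tensor_eq_mul (h : Fin d → ℝ → ℝ) (j : Fin d) (x : Fin d → ℝ) :
    tensor h x = h j (x j) * ∏ i ∈ Finset.univ.erase j, h i (x i) :=
  (Finset.mul_prod_erase _ _ (Finset.mem_univ j)).symm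

lemma tensor_update (h : Fin d → ℝ → ℝ) (j : Fin d) (g : ℝ → ℝ) (x : Fin d → ℝ) :
    tensor (Function.update h j g) x = g (x j) * ∏ i ∈ Finset.univ.erase j, h i (x i) := by
  rw [tensor_eq_mul _ j, Function.update_self]
  congr 1
  refine Finset.prod_congr rfl fun i hi => ?_
  rw [Function.update_of_ne (Finset.ne_of_mem_erase hi)]

lemma partialDeriv_tensor {h : Fin d → ℝ → ℝ} (hh : ∀ j, ContDiff ℝ ∞ (h j)) (j : Fin d) :
    partialDeriv j (tensor h) = tensor (Function.update h j (deriv (h j))) := by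
  funext x
  rw [partialDeriv_eq_deriv ((contDiff_tensor hh).differentiable (by simp) x), tensor_update]
  have h1 : (fun t => tensor h (Function.update x j t)) =
      fun t => h j t * ∏ i ∈ Finset.univ.erase j, h i (x i) := by
    funext t
    rw [tensor_eq_mul h j, Function.update_self]
    congr 1
    refine Finset.prod_congr rfl fun i hi => ?_
    rw [Function.update_of_ne (Finset.ne_of_mem_erase hi)]
  rw [h1, deriv_mul_const ((hh j).differentiable (by simp) _)]

lemma partialDeriv_mul {φ ψ : (Fin d → ℝ) → ℝ} {x : Fin d → ℝ} (hφ : DifferentiableAt ℝ φ x)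
    (hψ : DifferentiableAt ℝ ψ x) (j : Fin d) :
    partialDeriv j (fun y => φ y * ψ y) x =
      partialDeriv j φ x * ψ x + φ x * partialDeriv j ψ x := by
  simp only [partialDeriv]
  rw [fderiv_fun_mul hφ hψ]
  simp only [add_apply, smul_apply, smul_eq_mul]
  ring

/-- Integration by parts against a test function. -/
lemma setIntegral_mul_partialDeriv {Ω : Set (Fin d → ℝ)} {ψ η : (Fin d → ℝ) → ℝ}
    (hψ : ContDiff ℝ ∞ ψ) (hη : IsTestFunction Ω η) (j : Fin d) :
    ∫ x in Ω, ψ x * partialDeriv j η x = -∫ x in Ω, partialDeriv j ψ x * η x := by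
  have hη0 : ∀ x, x ∉ Ω → η x = 0 := fun x hx =>
    image_eq_zero_of_notMem_tsupport fun h => hx (hη.support h)
  have hsupp : tsupport (partialDeriv j η) ⊆ tsupport η :=
    tsupport_fderiv_apply_subset ℝ (Pi.single j 1 : Fin d → ℝ)
  have hDη0 : ∀ x, x ∉ Ω → partialDeriv j η x = 0 := fun x hx =>
    image_eq_zero_of_notMem_tsupport fun h => hx (hη.support (hsupp h))
  have hDη := contDiff_partialDeriv hη.smooth j
  have hDηc : HasCompactSupport (partialDeriv j η) :=
    hη.compact.of_isClosed_subset (isClosed_tsupport _) hsupp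
  rw [setIntegral_eq_integral_of_forall_compl_eq_zero (fun x hx => by rw [hDη0 x hx, mul_zero]),
    setIntegral_eq_integral_of_forall_compl_eq_zero (fun x hx => by rw [hη0 x hx, mul_zero])]
  have h1 : Integrable fun x => partialDeriv j ψ x * η x :=
    ((contDiff_partialDeriv hψ j).continuous.mul
      hη.smooth.continuous).integrable_of_hasCompactSupport hη.compact.mul_left
  have h2 : Integrable fun x => ψ x * partialDeriv j η x :=
    (hψ.continuous.mul hDη.continuous).integrable_of_hasCompactSupport hDηc.mul_left
  have h3 : Integrable fun x => ψ x * η x :=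
    (hψ.continuous.mul hη.smooth.continuous).integrable_of_hasCompactSupport hη.compact.mul_left
  exact integral_mul_fderiv_eq_neg_fderiv_mul_of_integrable (μ := volume) (f := ψ) (g := η)
    (v := (Pi.single j 1 : Fin d → ℝ)) h1 h2 h3 (fun x _ => hψ.differentiable (by simp) x)
    (fun x _ => hη.smooth.differentiable (by simp) x)

/-- By the divergence theorem only the two faces orthogonal to direction `j` contribute, and
periodicity makes them cancel. -/
lemma setIntegral_partialDeriv_periodic {L : ℝ} (hL : 0 < L) {h : (Fin d → ℝ) → ℝ}
    (hh : ContDiff ℝ ∞ h) (hper : ∀ j x, h (x + Pi.single j (2 * Real.pi * L)) = h x) (j : Fin d) :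
    ∫ x in cube d L, partialDeriv j h x = 0 := by
  cases d with
  | zero => exact j.elim0
  | succ n =>
    rw [setIntegral_congr_set (cube_ae_eq_Icc (n + 1) L)]
    set ℓ := 2 * Real.pi * L with hℓ
    have hℓ0 : 0 ≤ ℓ := by positivity
    have hle : (0 : Fin (n + 1) → ℝ) ≤ fun _ => ℓ := fun _ => hℓ0
    have hsum : ∀ x, ∑ i, (if i = j then fderiv ℝ h x else 0) (Pi.single i (1 : ℝ)) =
        partialDeriv j h x := by
      intro x
      rw [Finset.sum_eq_single j]
      · simp [partialDeriv]
      · intro i _ hi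
        simp [hi]
      · simp
    have H := integral_divergence_of_hasFDerivAt_off_countable' (0 : Fin (n + 1) → ℝ)
      (fun _ => ℓ) hle (fun i x => if i = j then h x else 0)
      (fun i x => if i = j then fderiv ℝ h x else 0) ∅ countable_empty
      (fun i => by
        by_cases hi : i = j
        · simp only [hi, if_true]; exact hh.continuous.continuousOn
        · simp only [hi, if_false]; exact continuousOn_const)
      (fun x _ i => by
        by_cases hi : i = j
        · simp only [hi, if_true]
          exact (hh.differentiable (by simp) x).hasFDerivAt
        · simp only [hi, if_false]
          exact hasFDerivAt_const _ _)
      (by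
        simp_rw [hsum]
        exact (contDiff_partialDeriv hh j).continuous.continuousOn.integrableOn_compact
          isCompact_Icc)
    simp_rw [hsum] at H
    rw [H]
    refine Finset.sum_eq_zero fun i _ => ?_
    by_cases hi : i = j
    · subst hi
      simp only [if_true]
      rw [sub_eq_zero]
      congr 1
      funext y
      have hy : (i.insertNth ℓ y : Fin (n + 1) → ℝ) =
          i.insertNth ((0 : Fin (n + 1) → ℝ) i) y + Pi.single i ℓ := by
        ext k
        refine Fin.succAboveCases i ?_ (fun m => ?_) k
        · simp
        · simp
      rw [hy, hper]
    · simp [hi]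

lemma exists_abs_deriv_smoothTransition_le :
    ∃ C, 0 ≤ C ∧ ∀ y, |deriv Real.smoothTransition y| ≤ C ∧
      ((y < 0 ∨ 1 < y) → deriv Real.smoothTransition y = 0) := by
  have hc : Continuous (deriv Real.smoothTransition) :=
    (Real.smoothTransition.contDiff (n := 1)).continuous_deriv (by simp)
  obtain ⟨C, hC⟩ := (isCompact_Icc (a := (0 : ℝ)) (b := 1)).exists_bound_of_continuousOn
    hc.continuousOn
  have h0 : ∀ y : ℝ, (y < 0 ∨ 1 < y) → deriv Real.smoothTransition y = 0 := by
    rintro y (hy | hy)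
    · have : Real.smoothTransition =ᶠ[𝓝 y] fun _ => 0 := by
        filter_upwards [Iio_mem_nhds hy] with z hz
        exact Real.smoothTransition.zero_of_nonpos (le_of_lt hz)
      rw [this.deriv_eq, deriv_const]
    · have : Real.smoothTransition =ᶠ[𝓝 y] fun _ => 1 := by
        filter_upwards [Ioi_mem_nhds hy] with z hz
        exact Real.smoothTransition.one_of_one_le (le_of_lt hz)
      rw [this.deriv_eq, deriv_const]
  have hC0 : 0 ≤ C := (norm_nonneg _).trans (hC 0 (by simp))
  refine ⟨C, hC0, fun y => ⟨?_, h0 y⟩⟩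
  by_cases hy : y ∈ Icc (0 : ℝ) 1
  · exact hC y hy
  · rw [h0 y, abs_zero]
    · exact hC0
    · by_contra hcon
      push Not at hcon
      exact hy ⟨hcon.1, hcon.2⟩

/-- A smooth function that is positive in the cube and vanishes on its boundary. -/
noncomputable def bump (d : ℕ) (ℓ : ℝ) : (Fin d → ℝ) → ℝ :=
  tensor fun _ t => Real.sin (Real.pi / ℓ * t)

lemma sin_pi_div_mul_pos {ℓ t : ℝ} (ht : t ∈ Ioo 0 ℓ) : 0 < Real.sin (Real.pi / ℓ * t) := by
  have hℓ : 0 < ℓ := ht.1.trans ht.2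
  refine Real.sin_pos_of_pos_of_lt_pi ?_ ?_
  · have := ht.1; positivity
  · rw [div_mul_eq_mul_div, div_lt_iff₀ hℓ]
    exact mul_lt_mul_of_pos_left ht.2 Real.pi_pos

lemma contDiff_bump (d : ℕ) (ℓ : ℝ) : ContDiff ℝ ∞ (bump d ℓ) :=
  contDiff_tensor fun _ => by fun_prop

lemma bump_pos {L : ℝ} {x : Fin d → ℝ} (hx : x ∈ cube d L) : 0 < bump d (2 * Real.pi * L) x := by
  unfold bump tensor
  exact Finset.prod_pos fun j _ => sin_pi_div_mul_pos (hx j (mem_univ _))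

lemma mem_cube_of_bump_ne_zero {L : ℝ} (hL : 0 < L) {x : Fin d → ℝ}
    (hx : x ∈ Icc (0 : Fin d → ℝ) (fun _ => 2 * Real.pi * L))
    (hb : bump d (2 * Real.pi * L) x ≠ 0) : x ∈ cube d L := by
  intro j _
  have h1 : Real.sin (Real.pi / (2 * Real.pi * L) * x j) ≠ 0 := by
    unfold bump tensor at hb
    exact (Finset.prod_ne_zero_iff.1 hb) j (Finset.mem_univ j)
  refine ⟨lt_of_le_of_ne (hx.1 j) fun h0 => h1 ?_, lt_of_le_of_ne (hx.2 j) fun h0 => h1 ?_⟩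
  · rw [← h0]; simp
  · have : (2 * Real.pi * L) ≠ 0 := by positivity
    rw [h0, div_mul_cancel₀ _ this, Real.sin_pi]

/-- The cutoff of `ψ` near the boundary of the cube. -/
noncomputable def cutoff (L : ℝ) (n : ℕ) (ψ : (Fin d → ℝ) → ℝ) : (Fin d → ℝ) → ℝ :=
  (cube d L).indicator fun x =>
    ψ x * Real.smoothTransition (n * bump d (2 * Real.pi * L) x - 1)

lemma isOpen_cube (d : ℕ) (L : ℝ) : IsOpen (cube d L) :=
  isOpen_set_pi finite_univ fun _ _ => isOpen_Ioo

lemma contDiff_smoothTransition_bump (d : ℕ) (ℓ : ℝ) (n : ℕ) :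
    ContDiff ℝ ∞ fun x : Fin d → ℝ => Real.smoothTransition (n * bump d ℓ x - 1) :=
  (Real.smoothTransition.contDiff (n := ⊤)).comp
    ((contDiff_const.mul (contDiff_bump d ℓ)).sub contDiff_const)

/-- The support lies in the part of the closed cube where `n * bump ≥ 1`, a compact subset of the
open cube because `bump` vanishes on the boundary. The indicator in the cutoff removes the other
regions where the product of sines is positive. -/
lemma isTestFunction_cutoff {L : ℝ} (hL : 0 < L) {ψ : (Fin d → ℝ) → ℝ} (hψ : ContDiff ℝ ∞ ψ)
    (n : ℕ) : IsTestFunction (cube d L) (cutoff L n ψ) := by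
  set ℓ := 2 * Real.pi * L with hℓ
  set K : Set (Fin d → ℝ) := Icc 0 (fun _ => ℓ) ∩ {x | 1 ≤ n * bump d ℓ x} with hK
  have hclosed : IsClosed {x | 1 ≤ n * bump d ℓ x} :=
    isClosed_le continuous_const (continuous_const.mul (contDiff_bump d ℓ).continuous)
  have hKc : IsCompact K := isCompact_Icc.inter_right hclosed
  have hKsub : K ⊆ cube d L := by
    rintro x ⟨hx1, hx2⟩
    refine mem_cube_of_bump_ne_zero hL hx1 fun h0 => ?_
    simp only [mem_ofPred_eq, hℓ] at hx2
    rw [h0, mul_zero] at hx2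
    linarith
  have hcubeIcc : cube d L ⊆ Icc 0 (fun _ => ℓ) := fun x hx =>
    ⟨fun j => (hx j (mem_univ _)).1.le, fun j => (hx j (mem_univ _)).2.le⟩
  have hzero : ∀ x, x ∉ K → cutoff L n ψ x = 0 := by
    intro x hx
    by_cases hxc : x ∈ cube d L
    · rw [cutoff, indicator_of_mem hxc, Real.smoothTransition.zero_of_nonpos, mul_zero]
      have : ¬ (1 ≤ n * bump d ℓ x) := fun h => hx ⟨hcubeIcc hxc, h⟩
      linarith [not_le.1 this]
    · rw [cutoff, indicator_of_notMem hxc]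
  have hts : tsupport (cutoff L n ψ) ⊆ K :=
    closure_minimal (fun x hx => by
      by_contra h
      exact hx (hzero x h)) hKc.isClosed
  refine ⟨?_, hKc.of_isClosed_subset (isClosed_tsupport _) hts, hts.trans hKsub⟩
  rw [contDiff_iff_contDiffAt]
  intro x
  by_cases hx : x ∈ cube d L
  · have h1 : cutoff L n ψ =ᶠ[𝓝 x] fun x => ψ x * Real.smoothTransition (n * bump d ℓ x - 1) := by
      filter_upwards [(isOpen_cube d L).mem_nhds hx] with y hy
      rw [cutoff, indicator_of_mem hy]
    exact ((hψ.mul (contDiff_smoothTransition_bump d ℓ n)).contDiffAt).congr_of_eventuallyEq h1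
  · have h1 : cutoff L n ψ =ᶠ[𝓝 x] fun _ => 0 := by
      filter_upwards [hKc.isClosed.isOpen_compl.mem_nhds fun h => hx (hKsub h)] with y hy
      exact hzero y hy
    exact contDiffAt_const.congr_of_eventuallyEq h1

lemma abs_cutoff_le {L : ℝ} (ψ : (Fin d → ℝ) → ℝ) (n : ℕ) (x : Fin d → ℝ) :
    |cutoff L n ψ x| ≤ |ψ x| := by
  by_cases hx : x ∈ cube d L
  · rw [cutoff, indicator_of_mem hx, abs_mul, abs_of_nonneg (Real.smoothTransition.nonneg _)]
    exact mul_le_of_le_one_right (abs_nonneg _) (Real.smoothTransition.le_one _)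
  · rw [cutoff, indicator_of_notMem hx, abs_zero]
    exact abs_nonneg _

lemma eventually_two_lt_mul_bump {L : ℝ} {x : Fin d → ℝ} (hx : x ∈ cube d L) :
    ∀ᶠ n : ℕ in atTop, 2 < n * bump d (2 * Real.pi * L) x :=
  (tendsto_natCast_atTop_atTop.atTop_mul_const (bump_pos hx)).eventually_gt_atTop 2

lemma tendsto_cutoff {L : ℝ} (ψ : (Fin d → ℝ) → ℝ) {x : Fin d → ℝ} (hx : x ∈ cube d L) :
    Tendsto (fun n => cutoff L n ψ x) atTop (𝓝 (ψ x)) := by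
  refine tendsto_const_nhds.congr' ?_
  filter_upwards [eventually_two_lt_mul_bump hx] with n hn
  rw [cutoff, indicator_of_mem hx, Real.smoothTransition.one_of_one_le (by linarith), mul_one]

lemma partialDeriv_cutoff {L : ℝ} {ψ : (Fin d → ℝ) → ℝ} (hψ : ContDiff ℝ ∞ ψ) (n : ℕ) (j : Fin d)
    {x : Fin d → ℝ} (hx : x ∈ cube d L) :
    partialDeriv j (cutoff L n ψ) x =
      partialDeriv j ψ x * Real.smoothTransition (n * bump d (2 * Real.pi * L) x - 1) +
      ψ x * (deriv Real.smoothTransition (n * bump d (2 * Real.pi * L) x - 1) *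
        (n * partialDeriv j (bump d (2 * Real.pi * L)) x)) := by
  set ℓ := 2 * Real.pi * L
  have h1 : cutoff L n ψ =ᶠ[𝓝 x] fun x => ψ x * Real.smoothTransition (n * bump d ℓ x - 1) := by
    filter_upwards [(isOpen_cube d L).mem_nhds hx] with y hy
    rw [cutoff, indicator_of_mem hy]
  have h2 : partialDeriv j (cutoff L n ψ) x =
      partialDeriv j (fun x => ψ x * Real.smoothTransition (n * bump d ℓ x - 1)) x := by
    simp only [partialDeriv]
    rw [h1.fderiv_eq]
  rw [h2, partialDeriv_mul (hψ.differentiable (by simp) x)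
    ((contDiff_smoothTransition_bump d ℓ n).differentiable (by simp) x)]
  congr 2
  have hb : HasFDerivAt (fun x => n * bump d ℓ x - 1) ((n : ℝ) • fderiv ℝ (bump d ℓ) x) x :=
    (((contDiff_bump d ℓ).differentiable (by simp) x).hasFDerivAt.const_mul (n : ℝ)).sub_const 1
  have hs : HasDerivAt Real.smoothTransition (deriv Real.smoothTransition (n * bump d ℓ x - 1))
      (n * bump d ℓ x - 1) :=
    ((Real.smoothTransition.contDiff (n := 1)).differentiable (by simp) _).hasDerivAt
  have h3 := hs.comp_hasFDerivAt x hb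
  have h4 : fderiv ℝ (fun x => Real.smoothTransition (n * bump d ℓ x - 1)) x =
      deriv Real.smoothTransition (n * bump d ℓ x - 1) • (n : ℝ) • fderiv ℝ (bump d ℓ) x :=
    h3.fderiv
  simp only [partialDeriv]
  rw [h4]
  simp

lemma tendsto_partialDeriv_cutoff {L : ℝ} {ψ : (Fin d → ℝ) → ℝ} (hψ : ContDiff ℝ ∞ ψ) (j : Fin d)
    {x : Fin d → ℝ} (hx : x ∈ cube d L) :
    Tendsto (fun n => partialDeriv j (cutoff L n ψ) x) atTop (𝓝 (partialDeriv j ψ x)) := by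
  obtain ⟨C, -, hC⟩ := exists_abs_deriv_smoothTransition_le
  refine tendsto_const_nhds.congr' ?_
  filter_upwards [eventually_two_lt_mul_bump hx] with n hn
  rw [partialDeriv_cutoff hψ n j hx, Real.smoothTransition.one_of_one_le (by linarith),
    (hC _).2 (Or.inr (by linarith))]
  ring

/-- The dangerous term carries a factor `n` but lives only where `n * bump ≤ 2`. There the
domination by `bump` trades `n` for a constant, uniformly in `n`, as dominated convergence requires.
-/
lemma exists_abs_partialDeriv_cutoff_le {L : ℝ} {ψ : (Fin d → ℝ) → ℝ} (hψ : ContDiff ℝ ∞ ψ)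
    (j : Fin d) {A : ℝ} (hA : ∀ x ∈ cube d L, |ψ x * partialDeriv j (bump d (2 * Real.pi * L)) x| ≤
      A * bump d (2 * Real.pi * L) x) :
    ∃ C, ∀ n, ∀ x ∈ cube d L, |partialDeriv j (cutoff L n ψ) x| ≤ C := by
  obtain ⟨C, hC0, hC⟩ := exists_abs_deriv_smoothTransition_le
  obtain ⟨B, hB⟩ := (isCompact_Icc (a := (0 : Fin d → ℝ))
    (b := fun _ => 2 * Real.pi * L)).exists_bound_of_continuousOn
    (contDiff_partialDeriv hψ j).continuous.continuousOn
  refine ⟨B + C * (2 * |A|), fun n x hx => ?_⟩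
  set ℓ := 2 * Real.pi * L
  have hxI : x ∈ Icc (0 : Fin d → ℝ) (fun _ => ℓ) :=
    ⟨fun j => (hx j (mem_univ _)).1.le, fun j => (hx j (mem_univ _)).2.le⟩
  have hbp := bump_pos hx
  rw [partialDeriv_cutoff hψ n j hx]
  refine (abs_add_le _ _).trans (add_le_add ?_ ?_)
  · rw [abs_mul, abs_of_nonneg (Real.smoothTransition.nonneg _)]
    exact (mul_le_of_le_one_right (abs_nonneg _) (Real.smoothTransition.le_one _)).trans (hB x hxI)
  · rw [show ψ x * (deriv Real.smoothTransition (n * bump d ℓ x - 1) *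
      (n * partialDeriv j (bump d ℓ) x)) = deriv Real.smoothTransition (n * bump d ℓ x - 1) *
      (n * (ψ x * partialDeriv j (bump d ℓ) x)) by ring, abs_mul]
    by_cases hy : 1 < (n : ℝ) * bump d ℓ x - 1
    · rw [(hC _).2 (Or.inr hy), abs_zero, zero_mul]
      positivity
    · refine mul_le_mul (hC _).1 ?_ (abs_nonneg _) hC0
      rw [abs_mul, Nat.abs_cast]
      calc (n : ℝ) * |ψ x * partialDeriv j (bump d ℓ) x| ≤ n * (A * bump d ℓ x) := by
            gcongr; exact hA x hx
        _ = (n * bump d ℓ x) * A := by ring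
        _ ≤ (n * bump d ℓ x) * |A| := by gcongr; exact le_abs_self A
        _ ≤ 2 * |A| := by gcongr; linarith

/-- If a tensor product `tensor h` is dominated by the bump function in the `j`-th variable, then
the boundary layer terms of its cutoffs are bounded. -/
lemma abs_tensor_mul_partialDeriv_bump_le {L : ℝ} {h : Fin d → ℝ → ℝ}
    (hh : ∀ i, ContDiff ℝ ∞ (h i)) (j : Fin d) {B : ℝ}
    (hB : ∀ t ∈ Ioo 0 (2 * Real.pi * L), |h j t| ≤ B * Real.sin (Real.pi / (2 * Real.pi * L) * t)) :
    ∃ A, ∀ x ∈ cube d L, |tensor h x * partialDeriv j (bump d (2 * Real.pi * L)) x| ≤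
      A * bump d (2 * Real.pi * L) x := by
  set ℓ := 2 * Real.pi * L
  have hc : Continuous fun x : Fin d → ℝ =>
      (∏ i ∈ Finset.univ.erase j, h i (x i)) * deriv (fun t => Real.sin (Real.pi / ℓ * t)) (x j) := by
    refine Continuous.mul (continuous_finsetProd _ fun i _ =>
      (hh i).continuous.comp (continuous_apply i)) ?_
    have : ContDiff ℝ 1 fun t => Real.sin (Real.pi / ℓ * t) := by fun_prop
    exact (this.continuous_deriv le_rfl).comp (continuous_apply j)
  obtain ⟨C, hC⟩ := (isCompact_Icc (a := (0 : Fin d → ℝ)) (b := fun _ => ℓ)).exists_bound_of_continuousOn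
    hc.continuousOn
  refine ⟨C * B, fun x hx => ?_⟩
  have hxI : x ∈ Icc (0 : Fin d → ℝ) (fun _ => ℓ) :=
    ⟨fun j => (hx j (mem_univ _)).1.le, fun j => (hx j (mem_univ _)).2.le⟩
  have hsin : ∀ i, 0 < Real.sin (Real.pi / ℓ * x i) :=
    fun i => sin_pi_div_mul_pos (hx i (mem_univ _))
  have hP : 0 ≤ ∏ i ∈ Finset.univ.erase j, Real.sin (Real.pi / ℓ * x i) :=
    Finset.prod_nonneg fun i _ => (hsin i).le
  -- Differentiating `bump` in `x j` destroys only its `j`-th sine; the others survive as factors.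
  -- Vanishing of `h j` at the two ends of the interval is therefore enough.
  rw [bump, partialDeriv_tensor (fun _ => by fun_prop), tensor_update, tensor_eq_mul h j,
    tensor_eq_mul (fun _ t => Real.sin (Real.pi / ℓ * t)) j]
  have h1 := hC x hxI
  rw [Real.norm_eq_abs] at h1
  have h2 := hB (x j) (hx j (mem_univ _))
  have hC0 : 0 ≤ C := (abs_nonneg _).trans h1
  set P := ∏ i ∈ Finset.univ.erase j, Real.sin (Real.pi / ℓ * x i)
  set H := ∏ i ∈ Finset.univ.erase j, h i (x i)
  set D := deriv (fun t => Real.sin (Real.pi / ℓ * t)) (x j)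
  calc |h j (x j) * H * (D * P)| = |H * D| * |h j (x j)| * P := by
        rw [show h j (x j) * H * (D * P) = (H * D) * h j (x j) * P by ring, abs_mul, abs_mul,
          abs_of_nonneg hP]
    _ ≤ C * (B * Real.sin (Real.pi / ℓ * x j)) * P := by gcongr
    _ = _ := by ring

end HeatCube

/-! ### Products of trigonometric functions as weak eigenfunctions and as a Hilbert basis. -/

namespace HeatCube

open Filter Topology

variable {d : ℕ}

instance instIsFiniteMeasureCube (d : ℕ) (L : ℝ) :
    IsFiniteMeasure (volume.restrict (cube d L)) := by
  refine ⟨?_⟩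
  rw [Measure.restrict_apply_univ, measure_congr (cube_ae_eq_Icc d L)]
  exact isCompact_Icc.measure_lt_top

lemma exists_bound_cube {f : (Fin d → ℝ) → ℝ} (hf : Continuous f) (L : ℝ) :
    ∃ C, ∀ x ∈ cube d L, |f x| ≤ C := by
  obtain ⟨C, hC⟩ := (isCompact_Icc (a := (0 : Fin d → ℝ))
    (b := fun _ => 2 * Real.pi * L)).exists_bound_of_continuousOn hf.continuousOn
  exact ⟨C, fun x hx => hC x ⟨fun j => (hx j (mem_univ _)).1.le,
    fun j => (hx j (mem_univ _)).2.le⟩⟩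

lemma memLp_cube {f : (Fin d → ℝ) → ℝ} (hf : Continuous f) (L : ℝ) :
    MemLp f 2 (volume.restrict (cube d L)) := by
  obtain ⟨C, hC⟩ := exists_bound_cube hf L
  exact MemLp.of_bound hf.aestronglyMeasurable C
    ((ae_restrict_iff' (measurableSet_cube d L)).2 (ae_of_all _ hC))

/-- The class in `L²` of the cube of a continuous function. -/
noncomputable def toL2 (L : ℝ) (f : (Fin d → ℝ) → ℝ) (hf : Continuous f) : L2 (cube d L) :=
  (memLp_cube hf L).toLp f

lemma coeFn_toL2 {L : ℝ} {f : (Fin d → ℝ) → ℝ} (hf : Continuous f) :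
    toL2 L f hf =ᵐ[volume.restrict (cube d L)] f :=
  (memLp_cube hf L).coeFn_toLp

lemma inner_eq_integral {Ω : Set (Fin d → ℝ)} (f g : L2 Ω) : ⟪f, g⟫ = ∫ x in Ω, f x * g x := by
  rw [L2.inner_def]
  refine integral_congr_ae (ae_of_all _ fun x => ?_)
  simp [mul_comm]

lemma inner_toL2 {L : ℝ} {f : (Fin d → ℝ) → ℝ} (hf : Continuous f) (w : L2 (cube d L)) :
    ⟪toL2 L f hf, w⟫ = ∫ x in cube d L, f x * w x := by
  rw [inner_eq_integral]
  refine integral_congr_ae ?_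
  filter_upwards [coeFn_toL2 hf] with x hx
  rw [hx]

lemma norm_sq_toL2_sub {L : ℝ} {f g : (Fin d → ℝ) → ℝ} (hf : Continuous f) (hg : Continuous g) :
    ‖toL2 L f hf - toL2 L g hg‖ ^ 2 = ∫ x in cube d L, (f x - g x) ^ 2 := by
  rw [← real_inner_self_eq_norm_sq, inner_eq_integral]
  refine integral_congr_ae ?_
  filter_upwards [coeFn_toL2 hf, coeFn_toL2 hg,
    Lp.coeFn_sub (toL2 L f hf) (toL2 L g hg)] with x h1 h2 h3
  rw [h3, Pi.sub_apply, h1, h2, sq]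

lemma tendsto_toL2 {L : ℝ} {F : ℕ → (Fin d → ℝ) → ℝ} {f : (Fin d → ℝ) → ℝ}
    (hF : ∀ n, Continuous (F n)) (hf : Continuous f) {C : ℝ}
    (hC : ∀ n, ∀ x ∈ cube d L, |F n x| ≤ C)
    (h : ∀ x ∈ cube d L, Tendsto (fun n => F n x) atTop (𝓝 (f x))) :
    Tendsto (fun n => toL2 L (F n) (hF n)) atTop (𝓝 (toL2 L f hf)) := by
  rw [tendsto_iff_norm_sub_tendsto_zero]
  have h1 : Tendsto (fun n => ∫ x in cube d L, (F n x - f x) ^ 2) atTop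
      (𝓝 (∫ x in cube d L, (0 : ℝ))) := by
    refine tendsto_integral_of_dominated_convergence (fun _ => (2 * C) ^ 2)
      (fun n => (((hF n).sub hf).pow 2).aestronglyMeasurable) (integrable_const _) ?_ ?_
    · intro n
      refine (ae_restrict_iff' (measurableSet_cube d L)).2 (ae_of_all _ fun x hx => ?_)
      have h2 : |f x| ≤ C := le_of_tendsto ((h x hx).abs) (Eventually.of_forall fun n => hC n x hx)
      rw [Real.norm_eq_abs, abs_pow]
      refine pow_le_pow_left₀ (abs_nonneg _) ?_ 2
      have := hC n x hx
      exact (abs_sub _ _).trans (by linarith)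
    · refine (ae_restrict_iff' (measurableSet_cube d L)).2 (ae_of_all _ fun x hx => ?_)
      have := ((h x hx).sub_const (f x)).pow 2
      simpa using this
  rw [integral_zero] at h1
  have h2 := h1.sqrt
  rw [Real.sqrt_zero] at h2
  refine h2.congr fun n => ?_
  rw [← norm_sq_toL2_sub (hF n) hf, Real.sqrt_sq (norm_nonneg _)]

lemma integrable_mul_L2 {L : ℝ} {f : (Fin d → ℝ) → ℝ} (hf : Continuous f) (w : L2 (cube d L)) :
    IntegrableOn (fun x => f x * w x) (cube d L) := by
  have h := L2.integrable_inner (𝕜 := ℝ) (toL2 L f hf) w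
  refine h.congr ?_
  filter_upwards [coeFn_toL2 hf] with x hx
  rw [hx]
  simp [mul_comm]

/-- The form `∫ ∇φ · ∇w` for a smooth eigenfunction `φ`. -/
lemma isLaplacian_of_smooth {bc : BoundaryCondition} {L lam : ℝ} {φ : (Fin d → ℝ) → ℝ}
    (hφ : ContDiff ℝ ∞ φ)
    (hlap : ∀ x, ∑ j, partialDeriv j (partialDeriv j φ) x = -lam * φ x)
    (hmem : (toL2 L φ hφ.continuous, fun j => toL2 L (partialDeriv j φ)
      (contDiff_partialDeriv hφ j).continuous) ∈ formDomain bc d L)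
    (hib : ∀ w ∈ formDomain bc d L, ∀ j, ∫ x in cube d L, partialDeriv j φ x * w.2 j x =
      -∫ x in cube d L, partialDeriv j (partialDeriv j φ) x * w.1 x) :
    IsLaplacian bc (toL2 L φ hφ.continuous) ((-lam) • toL2 L φ hφ.continuous) := by
  refine ⟨_, hmem, fun w hw => ?_⟩
  simp_rw [inner_toL2]
  rw [Finset.sum_congr rfl fun j _ => hib w hw j, Finset.sum_neg_distrib, real_inner_smul_left,
    inner_toL2, ← integral_finsetSum _ fun j _ => integrable_mul_L2
      (contDiff_partialDeriv (contDiff_partialDeriv hφ j) j).continuous w.1]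
  simp_rw [← Finset.sum_mul, hlap, mul_assoc]
  rw [integral_const_mul]

section IntegrationByParts

variable {L : ℝ} {ψ : (Fin d → ℝ) → ℝ}

lemma isClosed_setOf_inner_eq (A B : L2 (cube d L)) (j : Fin d) :
    IsClosed {p : L2 (cube d L) × (Fin d → L2 (cube d L)) | ⟪A, p.2 j⟫ = -⟪B, p.1⟫} :=
  isClosed_eq (continuous_const.inner ((continuous_apply j).comp continuous_snd))
    (continuous_const.inner continuous_fst).neg

lemma setIntegral_mul_classicalPair {f : (Fin d → ℝ) → ℝ} {η : (Fin d → ℝ) → ℝ}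
    {u : L2 (cube d L)} (hu : u =ᵐ[volume.restrict (cube d L)] η) :
    ∫ x in cube d L, f x * u x = ∫ x in cube d L, f x * η x := by
  refine integral_congr_ae ?_
  filter_upwards [hu] with x hx
  rw [hx]

/-- The identity is a closed condition on pairs, so it passes from test functions to their closure.
-/
lemma integral_mul_of_mem_sobolevH1Zero (hψ : ContDiff ℝ ∞ ψ) (j : Fin d)
    {w : L2 (cube d L) × (Fin d → L2 (cube d L))} (hw : w ∈ sobolevH1Zero (cube d L)) :
    ∫ x in cube d L, ψ x * w.2 j x = -∫ x in cube d L, partialDeriv j ψ x * w.1 x := by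
  have hψ' := contDiff_partialDeriv hψ j
  rw [← inner_toL2 hψ.continuous, ← inner_toL2 hψ'.continuous]
  refine closure_minimal ?_ (isClosed_setOf_inner_eq _ _ j) hw
  rintro p ⟨η, hη, hp1, hp2⟩
  rw [mem_ofPred_eq, inner_toL2, inner_toL2, setIntegral_mul_classicalPair (hp2 j),
    setIntegral_mul_classicalPair hp1]
  exact setIntegral_mul_partialDeriv hψ hη j

lemma integral_mul_of_mem_sobolevH1Per (hL : 0 < L) (hψ : ContDiff ℝ ∞ ψ)
    (hper : ∀ j x, ψ (x + Pi.single j (2 * Real.pi * L)) = ψ x) (j : Fin d)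
    {w : L2 (cube d L) × (Fin d → L2 (cube d L))} (hw : w ∈ sobolevH1Per d L) :
    ∫ x in cube d L, ψ x * w.2 j x = -∫ x in cube d L, partialDeriv j ψ x * w.1 x := by
  have hψ' := contDiff_partialDeriv hψ j
  rw [← inner_toL2 hψ.continuous, ← inner_toL2 hψ'.continuous]
  refine closure_minimal ?_ (isClosed_setOf_inner_eq _ _ j) hw
  rintro p ⟨η, hη, hηper, hp1, hp2⟩
  rw [mem_ofPred_eq, inner_toL2, inner_toL2, setIntegral_mul_classicalPair (hp2 j),
    setIntegral_mul_classicalPair hp1]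
  have hη' := contDiff_partialDeriv hη j
  have h1 := setIntegral_partialDeriv_periodic hL (hψ.mul hη)
    (fun i x => by simp only [hper, hηper]) j
  have h2 : ∀ x, partialDeriv j (fun y => ψ y * η y) x =
      partialDeriv j ψ x * η x + ψ x * partialDeriv j η x := fun x =>
    partialDeriv_mul (hψ.differentiable (by simp) x) (hη.differentiable (by simp) x) j
  simp_rw [h2] at h1
  have h3 : IntegrableOn (fun x => partialDeriv j ψ x * η x) (cube d L) :=
    integrableOn_cube (hψ'.continuous.mul hη.continuous)
  have h4 : IntegrableOn (fun x => ψ x * partialDeriv j η x) (cube d L) :=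
    integrableOn_cube (hψ.continuous.mul hη'.continuous)
  rw [integral_add h3 h4] at h1
  linarith

/-- The weak derivative is tested with the cutoffs of `ψ`. Their values and `j`-th derivatives stay
bounded and converge pointwise, so dominated convergence removes the cutoff without any trace
theory. -/
lemma integral_mul_of_mem_sobolevH1 (hL : 0 < L) (hψ : ContDiff ℝ ∞ ψ) (j : Fin d) {A : ℝ}
    (hA : ∀ x ∈ cube d L, |ψ x * partialDeriv j (bump d (2 * Real.pi * L)) x| ≤
      A * bump d (2 * Real.pi * L) x)
    {w : L2 (cube d L) × (Fin d → L2 (cube d L))} (hw : w ∈ sobolevH1 (cube d L)) :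
    ∫ x in cube d L, ψ x * w.2 j x = -∫ x in cube d L, partialDeriv j ψ x * w.1 x := by
  obtain ⟨C, hC⟩ := exists_abs_partialDeriv_cutoff_le hψ j hA
  obtain ⟨B, hB⟩ := exists_bound_cube hψ.continuous L
  have hcont := fun n => (isTestFunction_cutoff hL hψ n).smooth
  have hlim : ∀ (F : ℕ → (Fin d → ℝ) → ℝ) (f : (Fin d → ℝ) → ℝ) (D : ℝ) (u : L2 (cube d L)),
      (∀ n, Continuous (F n)) → (∀ n, ∀ x ∈ cube d L, |F n x| ≤ D) →
      (∀ x ∈ cube d L, Tendsto (fun n => F n x) atTop (𝓝 (f x))) →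
      Tendsto (fun n => ∫ x in cube d L, F n x * u x) atTop
        (𝓝 (∫ x in cube d L, f x * u x)) := by
    intro F f D u hF hD hlim
    refine tendsto_integral_of_dominated_convergence (fun x => D * |u x|)
      (fun n => (hF n).aestronglyMeasurable.mul (Lp.aestronglyMeasurable u))
      ((((Lp.memLp u).integrable one_le_two).abs).const_mul D) ?_ ?_
    · intro n
      refine (ae_restrict_iff' (measurableSet_cube d L)).2 (ae_of_all _ fun x hx => ?_)
      rw [Real.norm_eq_abs, abs_mul]
      exact mul_le_mul_of_nonneg_right (hD n x hx) (abs_nonneg _)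
    · exact (ae_restrict_iff' (measurableSet_cube d L)).2
        (ae_of_all _ fun x hx => (hlim x hx).mul_const _)
  have h1 := hlim (fun n => cutoff L n ψ) ψ B (w.2 j) (fun n => (hcont n).continuous)
    (fun n x hx => (abs_cutoff_le ψ n x).trans (hB x hx)) (fun x hx => tendsto_cutoff ψ hx)
  have h2 := hlim (fun n => partialDeriv j (cutoff L n ψ)) (partialDeriv j ψ) C w.1
    (fun n => (contDiff_partialDeriv (hcont n) j).continuous) hC
    (fun x hx => tendsto_partialDeriv_cutoff hψ j hx)
  refine tendsto_nhds_unique h1 (h2.neg.congr fun n => ?_)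
  have h3 := hw j (cutoff L n ψ) (isTestFunction_cutoff hL hψ n)
  simp_rw [mul_comm _ (w.1 _), mul_comm _ (w.2 j _)]
  rw [h3, neg_neg]

lemma mem_sobolevH1 (hψ : ContDiff ℝ ∞ ψ) :
    (toL2 L ψ hψ.continuous, fun j => toL2 L (partialDeriv j ψ)
      (contDiff_partialDeriv hψ j).continuous) ∈ sobolevH1 (cube d L) := by
  intro j η hη
  have h1 : ∫ x in cube d L, toL2 L ψ hψ.continuous x * partialDeriv j η x =
      ∫ x in cube d L, ψ x * partialDeriv j η x := by
    refine integral_congr_ae ?_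
    filter_upwards [coeFn_toL2 (L := L) hψ.continuous] with x hx
    rw [hx]
  have h2 : ∫ x in cube d L, toL2 L (partialDeriv j ψ)
      (contDiff_partialDeriv hψ j).continuous x * η x =
      ∫ x in cube d L, partialDeriv j ψ x * η x := by
    refine integral_congr_ae ?_
    filter_upwards [coeFn_toL2 (L := L) (contDiff_partialDeriv hψ j).continuous] with x hx
    rw [hx]
  exact h1.trans ((setIntegral_mul_partialDeriv hψ hη j).trans (congrArg Neg.neg h2.symm))

lemma mem_sobolevH1Per (hψ : ContDiff ℝ ∞ ψ)
    (hper : ∀ j x, ψ (x + Pi.single j (2 * Real.pi * L)) = ψ x) :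
    (toL2 L ψ hψ.continuous, fun j => toL2 L (partialDeriv j ψ)
      (contDiff_partialDeriv hψ j).continuous) ∈ sobolevH1Per d L :=
  subset_closure ⟨ψ, hψ, hper, coeFn_toL2 hψ.continuous,
    fun j => coeFn_toL2 (contDiff_partialDeriv hψ j).continuous⟩

/-- The cutoffs converge to `ψ` in `H¹`: the domination by `bump` in every direction keeps all
gradients bounded. -/
lemma mem_sobolevH1Zero (hL : 0 < L) (hψ : ContDiff ℝ ∞ ψ)
    (hA : ∀ j, ∃ A, ∀ x ∈ cube d L, |ψ x * partialDeriv j (bump d (2 * Real.pi * L)) x| ≤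
      A * bump d (2 * Real.pi * L) x) :
    (toL2 L ψ hψ.continuous, fun j => toL2 L (partialDeriv j ψ)
      (contDiff_partialDeriv hψ j).continuous) ∈ sobolevH1Zero (cube d L) := by
  have hcont := fun n => (isTestFunction_cutoff hL hψ n).smooth
  obtain ⟨B, hB⟩ := exists_bound_cube hψ.continuous L
  have h1 : Tendsto (fun n => toL2 L (cutoff L n ψ) (hcont n).continuous) atTop
      (𝓝 (toL2 L ψ hψ.continuous)) :=
    tendsto_toL2 _ _ (fun n x hx => (abs_cutoff_le ψ n x).trans (hB x hx))
      (fun x hx => tendsto_cutoff ψ hx)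
  have h2 : ∀ j, Tendsto (fun n => toL2 L (partialDeriv j (cutoff L n ψ))
      (contDiff_partialDeriv (hcont n) j).continuous) atTop
      (𝓝 (toL2 L (partialDeriv j ψ) (contDiff_partialDeriv hψ j).continuous)) := by
    intro j
    obtain ⟨A, hA⟩ := hA j
    obtain ⟨C, hC⟩ := exists_abs_partialDeriv_cutoff_le hψ j hA
    exact tendsto_toL2 _ _ hC (fun x hx => tendsto_partialDeriv_cutoff hψ j hx)
  refine mem_closure_of_tendsto (h1.prodMk_nhds (tendsto_pi_nhds.2 h2))
    (Eventually.of_forall fun n => ?_)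
  exact ⟨cutoff L n ψ, isTestFunction_cutoff hL hψ n, coeFn_toL2 (hcont n).continuous,
    fun j => coeFn_toL2 (contDiff_partialDeriv (hcont n) j).continuous⟩

end IntegrationByParts

/-- Compares a sine of higher frequency with the first one, the factor of `bump`; this verifies the
domination hypothesis of the cutoff lemmas. -/
lemma abs_sin_nat_mul_le (k : ℕ) (θ : ℝ) : |Real.sin (k * θ)| ≤ k * |Real.sin θ| := by
  induction k with
  | zero => simp
  | succ k ih =>
    push_cast
    rw [add_mul, one_mul, Real.sin_add, add_mul, one_mul]
    refine (abs_add_le _ _).trans (add_le_add ?_ ?_)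
    · rw [abs_mul]
      exact (mul_le_of_le_one_right (abs_nonneg _) (Real.abs_cos_le_one θ)).trans ih
    · rw [abs_mul]
      exact mul_le_of_le_one_left (abs_nonneg _) (Real.abs_cos_le_one _)

section Eigenfunctions

variable {ℓ : ℝ} {κ : Type} {e : κ → ℝ → ℝ} {μ : κ → ℝ}

lemma partialDeriv_partialDeriv_prodFun (he : IsEigensystem ℓ e μ) (k : Fin d → κ) (j : Fin d)
    (x : Fin d → ℝ) :
    partialDeriv j (partialDeriv j (prodFun e k)) x = -(μ (k j)) ^ 2 * prodFun e k x := by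
  have hd : ContDiff ℝ ∞ (deriv (e (k j))) := (he.smooth (k j)).iterate_deriv 1
  have h1 : prodFun e k = tensor fun i => e (k i) := rfl
  rw [h1, partialDeriv_tensor (fun i => he.smooth (k i)), partialDeriv_tensor,
    Function.update_idem, Function.update_self, tensor_update, he.deriv_deriv, tensor_eq_mul _ j]
  · ring
  · intro i
    rcases eq_or_ne i j with rfl | hij
    · rw [Function.update_self]; exact hd
    · rw [Function.update_of_ne hij]; exact he.smooth (k i)

lemma sum_partialDeriv_partialDeriv_prodFun (he : IsEigensystem ℓ e μ) (k : Fin d → κ)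
    (x : Fin d → ℝ) : ∑ j, partialDeriv j (partialDeriv j (prodFun e k)) x =
      -(∑ j, μ (k j) ^ 2) * prodFun e k x := by
  simp_rw [partialDeriv_partialDeriv_prodFun he]
  rw [← Finset.sum_neg_distrib, Finset.sum_mul]

/-- The `L²` classes of the products of eigenfunctions. -/
noncomputable def eigenVec {L : ℝ} (he : IsEigensystem (2 * Real.pi * L) e μ) (k : Fin d → κ) :
    L2 (cube d L) :=
  toL2 L (prodFun e k) (he.contDiff_prodFun k).continuous

lemma orthonormal_eigenVec {L : ℝ} (he : IsEigensystem (2 * Real.pi * L) e μ) :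
    Orthonormal ℝ (eigenVec he : (Fin d → κ) → L2 (cube d L)) := by
  classical
  rw [orthonormal_iff_ite]
  intro k l
  rw [eigenVec, inner_toL2, ← integral_cube_prodFun_mul he]
  exact setIntegral_mul_classicalPair (coeFn_toL2 _)

lemma span_eigenVec_orthogonal {L : ℝ} [Countable κ] (he : IsEigensystem (2 * Real.pi * L) e μ) :
    (Submodule.span ℝ (range (eigenVec he : (Fin d → κ) → L2 (cube d L))))ᗮ = ⊥ := by
  rw [eq_bot_iff]
  intro f hf
  rw [Submodule.mem_orthogonal] at hf
  have h := he.ae_eq_zero d f ((Lp.memLp f).integrable one_le_two) (fun k => by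
    have h1 := hf _ (Submodule.subset_span ⟨k, rfl⟩)
    rw [eigenVec, inner_toL2] at h1
    simp_rw [mul_comm (f _)]
    exact h1)
  rw [Submodule.mem_bot, Lp.eq_zero_iff_ae_eq_zero]
  exact (ae_restrict_iff' (measurableSet_cube d L)).2 h

/-- The Hilbert basis of products of eigenfunctions. -/
noncomputable def eigenBasis {L : ℝ} [Countable κ] (he : IsEigensystem (2 * Real.pi * L) e μ) :
    HilbertBasis (Fin d → κ) ℝ (L2 (cube d L)) :=
  HilbertBasis.mkOfOrthogonalEqBot (orthonormal_eigenVec he) (span_eigenVec_orthogonal he)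

lemma eigenBasis_apply {L : ℝ} [Countable κ] (he : IsEigensystem (2 * Real.pi * L) e μ)
    (k : Fin d → κ) : eigenBasis he k = eigenVec he k := by
  rw [eigenBasis, HilbertBasis.coe_mkOfOrthogonalEqBot]

end Eigenfunctions

lemma isLaplacian_dirichlet {L : ℝ} (hL : 0 < L) (hℓ : 0 < 2 * Real.pi * L) (k : Fin d → ℕ) :
    IsLaplacian .dirichlet (eigenVec (isEigensystem_dirichlet hℓ) k)
      ((-∑ j, (((k j + 1 : ℕ) : ℝ) * (Real.pi / (2 * Real.pi * L))) ^ 2) •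
        eigenVec (isEigensystem_dirichlet hℓ) k) := by
  have he := isEigensystem_dirichlet hℓ
  have hφ := he.contDiff_prodFun k
  refine isLaplacian_of_smooth hφ (sum_partialDeriv_partialDeriv_prodFun he k)
    (mem_sobolevH1Zero hL hφ fun j => ?_)
    fun w hw j => integral_mul_of_mem_sobolevH1Zero (contDiff_partialDeriv hφ j) j hw
  refine abs_tensor_mul_partialDeriv_bump_le (fun i => he.smooth (k i)) j
    (B := Real.sqrt (2 / (2 * Real.pi * L)) * (k j + 1 : ℕ)) fun t ht => ?_
  have hs := abs_of_pos (sin_pi_div_mul_pos ht)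
  simp only [dirichletFun, trigFun]
  generalize 2 * Real.pi * L = ℓ at hs ⊢
  rw [zero_mul, zero_add, abs_mul, abs_of_nonneg (Real.sqrt_nonneg _), mul_assoc, mul_assoc, ← hs]
  exact mul_le_mul_of_nonneg_left (abs_sin_nat_mul_le _ _) (Real.sqrt_nonneg _)

lemma isLaplacian_neumann {L : ℝ} (hL : 0 < L) (hℓ : 0 < 2 * Real.pi * L) (k : Fin d → ℕ) :
    IsLaplacian .neumann (eigenVec (isEigensystem_neumann hℓ) k)
      ((-∑ j, ((k j : ℝ) * (Real.pi / (2 * Real.pi * L))) ^ 2) •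
        eigenVec (isEigensystem_neumann hℓ) k) := by
  have he := isEigensystem_neumann hℓ
  have hφ := he.contDiff_prodFun k
  refine isLaplacian_of_smooth hφ (sum_partialDeriv_partialDeriv_prodFun he k)
    (mem_sobolevH1 hφ) fun w hw j => ?_
  have h1 : partialDeriv j (prodFun (neumannFun (2 * Real.pi * L)) k) =
      tensor (Function.update (fun i => neumannFun (2 * Real.pi * L) (k i)) j
        (deriv (neumannFun (2 * Real.pi * L) (k j)))) :=
    partialDeriv_tensor (fun i => he.smooth (k i)) j
  -- The Neumann condition in usable form: the `j`-th factor of `∂_j φ` is a multiple of a sine and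
  -- vanishes on both faces orthogonal to direction `j`, so integration by parts against all of `H¹`
  -- leaves no boundary term.
  have h2 : ∃ A, ∀ x ∈ cube d L, |partialDeriv j (prodFun (neumannFun (2 * Real.pi * L)) k) x *
      partialDeriv j (bump d (2 * Real.pi * L)) x| ≤ A * bump d (2 * Real.pi * L) x := by
    rw [h1]
    refine abs_tensor_mul_partialDeriv_bump_le (fun i => ?_) j
      (B := |Real.sqrt ((if k j = 0 then 1 else 2) / (2 * Real.pi * L)) *
        ((k j : ℝ) * (Real.pi / (2 * Real.pi * L)))| * (k j : ℕ)) fun t ht => ?_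
    · rcases eq_or_ne i j with rfl | hij
      · rw [Function.update_self]; exact (he.smooth (k i)).iterate_deriv 1
      · rw [Function.update_of_ne hij]; exact he.smooth (k i)
    · rw [Function.update_self, neumannFun, deriv_trigFun]
      simp only [trigFun]
      rw [zero_mul, zero_mul, zero_add, abs_mul, abs_neg, mul_assoc |_|, mul_assoc (k j : ℝ),
        ← abs_of_pos (sin_pi_div_mul_pos ht)]
      exact mul_le_mul_of_nonneg_left (abs_sin_nat_mul_le _ _) (abs_nonneg _)
  obtain ⟨A, hA⟩ := h2
  exact integral_mul_of_mem_sobolevH1 hL (contDiff_partialDeriv hφ j) j hA hw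

lemma isLaplacian_periodic {L : ℝ} (hL : 0 < L) (hℓ : 0 < 2 * Real.pi * L) (k : Fin d → ℤ) :
    IsLaplacian .periodic (eigenVec (isEigensystem_periodic hℓ) k)
      ((-∑ j, ((k j : ℝ) * (2 * Real.pi / (2 * Real.pi * L))) ^ 2) •
        eigenVec (isEigensystem_periodic hℓ) k) := by
  have he := isEigensystem_periodic hℓ
  have hφ := he.contDiff_prodFun k
  have hper1 : ∀ (m : ℤ) (t : ℝ), periodicFun (2 * Real.pi * L) m (t + 2 * Real.pi * L) =
      periodicFun (2 * Real.pi * L) m t := by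
    intro m t
    simp only [periodicFun, trigFun]
    rw [mul_add, show (m : ℝ) * (2 * Real.pi / (2 * Real.pi * L)) * (2 * Real.pi * L) =
      m * (2 * Real.pi) by field_simp, Real.cos_add_int_mul_two_pi, Real.sin_add_int_mul_two_pi]
  have hper : ∀ (j : Fin d) x, prodFun (periodicFun (2 * Real.pi * L)) k
      (x + Pi.single j (2 * Real.pi * L)) = prodFun (periodicFun (2 * Real.pi * L)) k x := by
    intro j x
    refine Finset.prod_congr rfl fun i _ => ?_
    rcases eq_or_ne i j with rfl | hij
    · rw [Pi.add_apply, Pi.single_eq_same, hper1]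
    · rw [Pi.add_apply, Pi.single_eq_of_ne hij, add_zero]
  have hper' : ∀ (j i : Fin d) x, partialDeriv j (prodFun (periodicFun (2 * Real.pi * L)) k)
      (x + Pi.single i (2 * Real.pi * L)) =
      partialDeriv j (prodFun (periodicFun (2 * Real.pi * L)) k) x := by
    intro j i x
    simp only [partialDeriv]
    rw [← fderiv_comp_add_right]
    congr 2
    funext y
    exact hper i y
  exact isLaplacian_of_smooth hφ (sum_partialDeriv_partialDeriv_prodFun he k)
    (mem_sobolevH1Per hφ hper) fun w hw j =>
      integral_mul_of_mem_sobolevH1Per hL (contDiff_partialDeriv hφ j) (hper' j) j hw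

/-- Every boundary condition has a complete system of eigenfunctions. -/
theorem exists_isEigensystem (bc : BoundaryCondition) {L : ℝ} (hL : 0 < L) :
    ∃ (κ : Type) (_ : Countable κ) (e : κ → ℝ → ℝ) (μ : κ → ℝ)
      (he : IsEigensystem (2 * Real.pi * L) e μ), ∀ (d : ℕ) (k : Fin d → κ),
      IsLaplacian bc (eigenVec he k) ((-∑ j, μ (k j) ^ 2) • eigenVec he k) := by
  have hℓ : 0 < 2 * Real.pi * L := by positivity
  cases bc with
  | periodic =>
    exact ⟨ℤ, inferInstance, _, _, isEigensystem_periodic hℓ, fun d => isLaplacian_periodic hL hℓ⟩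
  | dirichlet =>
    exact ⟨ℕ, inferInstance, _, _, isEigensystem_dirichlet hℓ, fun d => isLaplacian_dirichlet hL hℓ⟩
  | neumann =>
    exact ⟨ℕ, inferInstance, _, _, isEigensystem_neumann hℓ, fun d => isLaplacian_neumann hL hℓ⟩

end HeatCube

/-! ### From interpolation to observability, and the abstract moment problem. -/

namespace HeatCube

open Filter Topology

/-- The passage from an interpolation estimate to an observability estimate. -/
lemma observability_of_interpolation {N O : ℝ → ℝ} (hO : Continuous O) (hO0 : ∀ t, 0 ≤ O t)
    (hN0 : ∀ t, 0 ≤ N t) (hN : ∀ s t, s ≤ t → N t ≤ N s) {D₀ D₁ T : ℝ} (hD₀ : 1 ≤ D₀)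
    (hD₁ : 0 ≤ D₁) (hT : 0 < T)
    (h : ∀ Λ t₀ t, 0 ≤ Λ → t₀ ≤ t → N t ≤ 2 * (D₀ * Real.exp (D₁ * Λ)) * O t +
      3 * (D₀ * Real.exp (D₁ * Λ)) * Real.exp (-2 * Λ ^ 2 * (t - t₀)) * N t₀) :
    N T ≤ 48 * D₀ ^ 2 * Real.exp ((5 * D₁ ^ 2 + 1) / T) * ∫ t in (0 : ℝ)..T, O t := by
  have hD₀0 : 0 < D₀ := by linarith
  set l := Real.log (6 * D₀) with hl
  have hl0 : 0 ≤ l := Real.log_nonneg (by linarith)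
  set r := Real.sqrt (T * l) with hr
  have hr0 : 0 ≤ r := Real.sqrt_nonneg _
  have hr2 : r ^ 2 = T * l := Real.sq_sqrt (by positivity)
  -- Chosen so that `A² - 2 D₁ A = A r ≥ r² = T log (6 D₀)`, exactly what is needed below for the
  -- weights to telescope.
  set A := 2 * D₁ + r with hA
  have hA0 : 0 ≤ A := by positivity
  have hAA : T * l ≤ A ^ 2 - 2 * D₁ * A := by rw [hA]; nlinarith
  set α : ℝ → ℝ := fun τ => τ / (4 * D₀) * Real.exp (-(D₁ * (A / τ))) with hα
  have hint : ∀ a b, IntervalIntegrable O volume a b := fun a b => hO.intervalIntegrable a b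
  have hstep : ∀ τ, 0 < τ → τ ≤ T →
      α τ * N (τ + τ) ≤ (∫ t in τ..τ + τ, O t) + α (τ / 2) * N τ := by
    intro τ hτ hτT
    set G := D₀ * Real.exp (D₁ * (A / τ)) with hG
    have hG0 : 0 < G := by positivity
    -- The interpolation estimate is used with `Λ = A / τ` and `t₀ = τ`, and integrated over the
    -- second half of `[τ, 2 τ]`, where `t - t₀ ≥ τ / 2`. Dividing by `2 G` turns the length `τ / 2`
    -- into the weight `α τ`.
    set ε := Real.exp (-(A / τ) ^ 2 * τ) with hε
    have hpt : ∀ t ∈ Icc (τ + τ / 2) (τ + τ), N (τ + τ) ≤ 2 * G * O t + 3 * G * ε * N τ := by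
      intro t ht
      refine (hN t _ ht.2).trans ((h (A / τ) τ t (by positivity) (by linarith [ht.1])).trans ?_)
      have h1 : Real.exp (-2 * (A / τ) ^ 2 * (t - τ)) ≤ ε := by
        rw [hε]
        apply Real.exp_le_exp.2
        nlinarith [ht.1, sq_nonneg (A / τ)]
      have := hN0 τ
      gcongr
    have hI : τ / 2 * N (τ + τ) ≤ 2 * G * (∫ t in τ..τ + τ, O t) + τ / 2 * (3 * G * ε * N τ) := by
      have h1 := intervalIntegral.integral_mono_on (a := τ + τ / 2) (b := τ + τ) (by linarith)
        (intervalIntegrable_const (c := N (τ + τ)) (μ := volume))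
        (((hint _ _).const_mul (2 * G)).add (intervalIntegrable_const (c := 3 * G * ε * N τ))) hpt
      rw [intervalIntegral.integral_const, intervalIntegral.integral_add
        ((hint _ _).const_mul (2 * G)) intervalIntegrable_const,
        intervalIntegral.integral_const_mul, intervalIntegral.integral_const, smul_eq_mul,
        smul_eq_mul, show τ + τ - (τ + τ / 2) = τ / 2 by ring] at h1
      have h2 : ∫ t in τ + τ / 2..τ + τ, O t ≤ ∫ t in τ..τ + τ, O t := by
        rw [← intervalIntegral.integral_add_adjacent_intervals (hint τ (τ + τ / 2)) (hint _ _)]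
        have := intervalIntegral.integral_nonneg (μ := volume) (f := O) (a := τ) (b := τ + τ / 2)
          (by linarith) (fun t _ => hO0 t)
        linarith
      nlinarith
    have hαG : α τ = τ / 4 / G := by
      rw [hα, hG]
      simp only
      rw [Real.exp_neg]
      field_simp
    have h3 : α τ * N (τ + τ) ≤ (∫ t in τ..τ + τ, O t) + 3 * τ / 4 * ε * N τ := by
      rw [hαG, div_mul_eq_mul_div, div_le_iff₀ hG0]
      linarith
    refine h3.trans (add_le_add le_rfl (mul_le_mul_of_nonneg_right ?_ (hN0 τ)))
    -- This says `(3 τ / 4) ε ≤ α (τ / 2)`: the leftover energy at time `τ` carries precisely the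
    -- weight of the next dyadic step.
    have h4 : 6 * D₀ ≤ Real.exp ((A / τ) ^ 2 * τ - 2 * (D₁ * (A / τ))) := by
      rw [← Real.exp_log (show 0 < 6 * D₀ by linarith), ← hl]
      apply Real.exp_le_exp.2
      have h5 : (A / τ) ^ 2 * τ - 2 * (D₁ * (A / τ)) = (A ^ 2 - 2 * D₁ * A) / τ := by field_simp
      rw [h5, le_div_iff₀ hτ]
      nlinarith
    have h6 : ε = Real.exp (-((A / τ) ^ 2 * τ - 2 * (D₁ * (A / τ)))) *
        Real.exp (-(D₁ * (A / (τ / 2)))) := by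
      rw [hε, ← Real.exp_add]
      congr 1
      field_simp
      ring
    simp only [hα]
    rw [h6, ← mul_assoc]
    refine mul_le_mul_of_nonneg_right ?_ (Real.exp_pos _).le
    rw [Real.exp_neg, ← div_eq_mul_inv, div_le_div_iff₀ (Real.exp_pos _) (by positivity)]
    nlinarith
  set t : ℕ → ℝ := fun n => T / 2 ^ n with ht
  have ht0 : ∀ n, 0 < t n := fun n => by positivity
  have htT : ∀ n, t n ≤ T := fun n => div_le_self hT.le (one_le_pow₀ one_le_two)
  have ht1 : ∀ n, t (n + 1) + t (n + 1) = t n := fun n => by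
    simp only [ht, pow_succ]; field_simp; norm_num
  have ht2 : ∀ n, t n / 2 = t (n + 1) := fun n => by simp only [ht, pow_succ]; field_simp
  have hsum : ∀ n, α (t 1) * N T ≤ (∫ s in t n..T, O s) + α (t (n + 1)) * N (t n) := by
    intro n
    induction n with
    | zero => simp [ht]
    | succ n ih =>
      have h1 := hstep (t (n + 1)) (ht0 _) (htT _)
      rw [ht1, ht2] at h1
      rw [← intervalIntegral.integral_add_adjacent_intervals (hint (t (n + 1)) (t n)) (hint _ _)]
      linarith
  -- The remainder `α (t (n + 1)) * N (t n)` tends to zero since `α τ ≤ τ / (4 D₀)` and the energy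
  -- stays below `N 0`.
  have hlim : Tendsto (fun n => (∫ s in (0 : ℝ)..T, O s) + t (n + 1) / (4 * D₀) * N 0) atTop
      (𝓝 ((∫ s in (0 : ℝ)..T, O s) + 0 / (4 * D₀) * N 0)) := by
    refine tendsto_const_nhds.add (Tendsto.mul_const _ (Tendsto.div_const ?_ _))
    have : Tendsto t atTop (𝓝 0) := tendsto_const_nhds.div_atTop
      (tendsto_pow_atTop_atTop_of_one_lt one_lt_two)
    exact this.comp (tendsto_add_atTop_nat 1)
  have hfin : α (t 1) * N T ≤ ∫ s in (0 : ℝ)..T, O s := by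
    have hb : ∀ n, α (t 1) * N T ≤
        (∫ s in (0 : ℝ)..T, O s) + t (n + 1) / (4 * D₀) * N 0 := fun n => (hsum n).trans (by
      refine add_le_add ?_ ?_
      · rw [← intervalIntegral.integral_add_adjacent_intervals (hint 0 (t n)) (hint _ _)]
        have := intervalIntegral.integral_nonneg (μ := volume) (f := O) (ht0 n).le
          (fun t _ => hO0 t)
        linarith
      · refine mul_le_mul ?_ (hN _ _ (ht0 n).le) (hN0 _) (by have := ht0 (n + 1); positivity)
        refine mul_le_of_le_one_right (by have := ht0 (n + 1); positivity) ?_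
        rw [Real.exp_le_one_iff]
        have := ht0 (n + 1)
        have : 0 ≤ D₁ * (A / t (n + 1)) := by positivity
        linarith)
    simpa using ge_of_tendsto' hlim hb
  have hI0 : 0 ≤ ∫ s in (0 : ℝ)..T, O s := intervalIntegral.integral_nonneg hT.le fun t _ => hO0 t
  have ht11 : t 1 = T / 2 := by simp [ht]
  have hα0 : 0 < α (t 1) := by
    simp only [hα]
    have := ht0 1
    positivity
  -- This bounds `1 / α (T / 2)`. The cross term satisfies `2 D₁ r ≤ D₁² + r²`, with `r² / T = log
  -- (6 D₀)` giving the second factor `D₀`, and the remaining `1 / T` is absorbed by `exp (1 / T)`.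
  have hcost : 1 ≤ 48 * D₀ ^ 2 * Real.exp ((5 * D₁ ^ 2 + 1) / T) * α (t 1) := by
    have h1 : D₁ * (A / (T / 2)) ≤ 5 * D₁ ^ 2 / T + l := by
      have h2 : D₁ * (A / (T / 2)) = (4 * D₁ ^ 2 + 2 * D₁ * r) / T := by
        rw [hA]; field_simp; ring
      have h3 : l = T * l / T := by field_simp
      rw [h2, h3, ← add_div, ← hr2]
      exact div_le_div_of_nonneg_right (by nlinarith [sq_nonneg (D₁ - r)]) hT.le
    have h2 : 1 / T ≤ Real.exp (1 / T) := by linarith [Real.add_one_le_exp (1 / T)]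
    have h3 : Real.exp (D₁ * (A / (T / 2))) ≤ Real.exp (5 * D₁ ^ 2 / T) * (6 * D₀) := by
      rw [← Real.exp_log (show 0 < 6 * D₀ by linarith), ← hl, ← Real.exp_add]
      exact Real.exp_le_exp.2 h1
    have h4 : (8 * D₀ * (1 / T)) * Real.exp (D₁ * (A / (T / 2))) ≤
        48 * D₀ ^ 2 * Real.exp ((5 * D₁ ^ 2 + 1) / T) := by
      rw [add_div (5 * D₁ ^ 2) 1 T, Real.exp_add]
      calc (8 * D₀ * (1 / T)) * Real.exp (D₁ * (A / (T / 2)))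
          ≤ (8 * D₀ * Real.exp (1 / T)) * (Real.exp (5 * D₁ ^ 2 / T) * (6 * D₀)) := by gcongr
        _ = _ := by ring
    have h5 : (8 * D₀ * (1 / T)) * Real.exp (D₁ * (A / (T / 2))) * α (t 1) = 1 := by
      simp only [hα, ht11]
      rw [Real.exp_neg]
      field_simp
      norm_num
    exact h5.symm.le.trans (mul_le_mul_of_nonneg_right h4 hα0.le)
  calc N T ≤ 48 * D₀ ^ 2 * Real.exp ((5 * D₁ ^ 2 + 1) / T) * α (t 1) * N T :=
        le_mul_of_one_le_left (hN0 T) hcost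
    _ = 48 * D₀ ^ 2 * Real.exp ((5 * D₁ ^ 2 + 1) / T) * (α (t 1) * N T) := by ring
    _ ≤ _ := by gcongr

/-- Solvability of a moment problem in a Hilbert space. -/
lemma exists_forall_inner_eq {H ι : Type*} [NormedAddCommGroup H] [InnerProductSpace ℝ H]
    [CompleteSpace H] (ψ : ι → H) (b : ι → ℝ) {M : ℝ} (hM : 0 ≤ M)
    (h : ∀ (s : Finset ι) (c : ι → ℝ), |∑ k ∈ s, c k * b k| ≤ M * ‖∑ k ∈ s, c k • ψ k‖) :
    ∃ v : H, ‖v‖ ≤ M ∧ ∀ k, ⟪v, ψ k⟫ = b k := by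
  set Ψ : (ι →₀ ℝ) →ₗ[ℝ] H := Finsupp.linearCombination ℝ ψ with hΨ
  set β : (ι →₀ ℝ) →ₗ[ℝ] ℝ := Finsupp.linearCombination ℝ b with hβ
  have hle : ∀ c, ‖β c‖ ≤ M * ‖Ψ c‖ := by
    intro c
    have := h c.support c
    simpa [hΨ, hβ, Finsupp.linearCombination_apply, Finsupp.sum, Real.norm_eq_abs] using this
  -- By the assumed bound, the functional sending `∑ c_k ψ_k` to `∑ c_k b_k` is well defined even if
  -- the `ψ_k` are dependent, and has norm at most `M`. Hahn–Banach extends it without enlarging the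
  -- norm, and Riesz represents it.
  have hker : LinearMap.ker Ψ ≤ LinearMap.ker β := by
    intro c hc
    rw [LinearMap.mem_ker] at hc ⊢
    have := hle c
    rw [hc, norm_zero, mul_zero] at this
    exact norm_le_zero_iff.1 this
  set g : LinearMap.range Ψ →ₗ[ℝ] ℝ :=
    ((LinearMap.ker Ψ).liftQ β hker).comp Ψ.quotKerEquivRange.symm.toLinearMap with hg
  have hgΨ : ∀ c, g ⟨Ψ c, LinearMap.mem_range_self Ψ c⟩ = β c := by
    intro c
    have h1 : Ψ.quotKerEquivRange.symm ⟨Ψ c, LinearMap.mem_range_self Ψ c⟩ =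
        Submodule.Quotient.mk c := by
      rw [LinearEquiv.symm_apply_eq]
      rfl
    simp only [hg, LinearMap.comp_apply, LinearEquiv.coe_coe]
    rw [h1]
    rfl
  have hgb : ∀ x, ‖g x‖ ≤ M * ‖x‖ := by
    rintro ⟨_, c, rfl⟩
    rw [hgΨ]
    exact hle c
  obtain ⟨G, hG1, hG2⟩ := exists_extension_norm_eq (LinearMap.range Ψ) (g.mkContinuous M hgb)
  refine ⟨(InnerProductSpace.toDual ℝ H).symm G, ?_, fun k => ?_⟩
  · rw [LinearIsometryEquiv.norm_map, hG2]
    exact LinearMap.mkContinuous_norm_le _ hM _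
  · rw [InnerProductSpace.toDual_symm_apply]
    have h1 : Ψ (Finsupp.single k 1) = ψ k := by simp [hΨ]
    have h2 : β (Finsupp.single k 1) = b k := by simp [hβ]
    have h3 := hG1 ⟨Ψ (Finsupp.single k 1), LinearMap.mem_range_self Ψ _⟩
    rw [LinearMap.mkContinuous_apply, hgΨ, h2] at h3
    rw [← h3, ← h1]

end HeatCube

/-! ### Observability for finite sums of eigenfunctions. -/

namespace HeatCube

open Filter Topology

variable {κ : Type} {e : κ → ℝ → ℝ} {μ : κ → ℝ} {d : ℕ} {L : ℝ}

/-- The eigenvalue of the negative Laplacian that belongs to the multi-index `k`. -/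
noncomputable def eigenvalue (μ : κ → ℝ) (k : Fin d → κ) : ℝ := ∑ j, μ (k j) ^ 2

lemma eigenvalue_nonneg (k : Fin d → κ) : 0 ≤ eigenvalue μ k :=
  Finset.sum_nonneg fun _ _ => sq_nonneg _

lemma continuous_sum_prodFun (he : IsEigensystem (2 * Real.pi * L) e μ)
    (s : Finset (Fin d → κ)) (c : (Fin d → κ) → ℝ) :
    Continuous fun x => ∑ k ∈ s, c k * prodFun e k x :=
  continuous_finsetSum _ fun k _ => continuous_const.mul (he.contDiff_prodFun k).continuous

lemma continuous_integral_sum_sq (he : IsEigensystem (2 * Real.pi * L) e μ)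
    (s : Finset (Fin d → κ)) {c : ℝ → (Fin d → κ) → ℝ} (hc : ∀ k, Continuous fun t => c t k)
    {U : Set (Fin d → ℝ)} (hU : U ⊆ cube d L) :
    Continuous fun t => ∫ x in U, (∑ k ∈ s, c t k * prodFun e k x) ^ 2 := by
  have h1 : ∀ t, ∫ x in U, (∑ k ∈ s, c t k * prodFun e k x) ^ 2 =
      ∑ k ∈ s, ∑ l ∈ s, c t k * c t l * ∫ x in U, prodFun e k x * prodFun e l x := by
    intro t
    have hi : ∀ k l, IntegrableOn (fun x => c t k * c t l * (prodFun e k x * prodFun e l x)) U :=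
      fun k l => (integrableOn_cube (continuous_const.mul
        ((he.contDiff_prodFun k).continuous.mul (he.contDiff_prodFun l).continuous))).mono_set hU
    simp_rw [← integral_const_mul]
    rw [Finset.sum_congr rfl fun k _ => (integral_finsetSum s fun l _ => hi k l).symm,
      ← integral_finsetSum _ fun k _ => integrable_finsetSum _ fun l _ => hi k l]
    refine integral_congr_ae (ae_of_all _ fun x => ?_)
    simp only
    rw [sq, Finset.sum_mul_sum]
    exact Finset.sum_congr rfl fun k _ => Finset.sum_congr rfl fun l _ => by ring
  simp_rw [h1]
  exact continuous_finsetSum _ fun k _ => continuous_finsetSum _ fun l _ =>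
    ((hc k).mul (hc l)).mul continuous_const

/-- The interpolation estimate between the energy at time `t`, the observation at time `t` and
the energy at time `t₀`. -/
lemma sum_sq_le_interpolation (he : IsEigensystem (2 * Real.pi * L) e μ)
    {U : Set (Fin d → ℝ)} (hU : U ⊆ cube d L) {D₀ D₁ : ℝ} (hD₀ : 1 ≤ D₀) (hD₁ : 0 ≤ D₁)
    (hspec : ∀ (s : Finset (Fin d → κ)) (c : (Fin d → κ) → ℝ) (Λ : ℝ), 0 ≤ Λ →
      (∀ k ∈ s, eigenvalue μ k ≤ Λ ^ 2) → ∑ k ∈ s, c k ^ 2 ≤ D₀ * Real.exp (D₁ * Λ) *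
        ∫ x in U, (∑ k ∈ s, c k * prodFun e k x) ^ 2)
    (s : Finset (Fin d → κ)) (c : (Fin d → κ) → ℝ) {Λ t₀ t : ℝ} (hΛ : 0 ≤ Λ) (ht : t₀ ≤ t) :
    ∑ k ∈ s, (c k * Real.exp (-(eigenvalue μ k * t))) ^ 2 ≤
      2 * (D₀ * Real.exp (D₁ * Λ)) *
        (∫ x in U, (∑ k ∈ s, c k * Real.exp (-(eigenvalue μ k * t)) * prodFun e k x) ^ 2) +
      3 * (D₀ * Real.exp (D₁ * Λ)) * Real.exp (-2 * Λ ^ 2 * (t - t₀)) *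
        ∑ k ∈ s, (c k * Real.exp (-(eigenvalue μ k * t₀))) ^ 2 := by
  classical
  set C : (Fin d → κ) → ℝ := fun k => c k * Real.exp (-(eigenvalue μ k * t)) with hC
  set G := D₀ * Real.exp (D₁ * Λ) with hG
  have hG1 : 1 ≤ G := one_le_mul_of_one_le_of_one_le hD₀ (Real.one_le_exp (by positivity))
  -- Frequencies up to `Λ` obey the spectral inequality. Their observation is compared with that of
  -- the full sum at the price of the high frequencies, which have decayed since `t₀`.
  set p := s.filter fun k => eigenvalue μ k ≤ Λ ^ 2 with hp
  set q := s.filter fun k => ¬ eigenvalue μ k ≤ Λ ^ 2 with hq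
  have hsplit : ∀ f : (Fin d → κ) → ℝ, ∑ k ∈ s, f k = ∑ k ∈ p, f k + ∑ k ∈ q, f k := fun f =>
    (Finset.sum_filter_add_sum_filter_not s _ f).symm
  have hlow := hspec p C Λ hΛ fun k hk => (Finset.mem_filter.1 hk).2
  have hint : ∀ r : Finset (Fin d → κ),
      IntegrableOn (fun x => (∑ k ∈ r, C k * prodFun e k x) ^ 2) (cube d L) := fun r =>
    integrableOn_cube ((continuous_sum_prodFun he r C).pow 2)
  have hhigh : ∫ x in U, (∑ k ∈ q, C k * prodFun e k x) ^ 2 ≤ ∑ k ∈ q, C k ^ 2 := by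
    rw [← integral_cube_sum_sq he q C]
    exact setIntegral_mono_set (hint q) (ae_of_all _ fun x => sq_nonneg _) hU.eventuallyLE
  have hmid : ∫ x in U, (∑ k ∈ p, C k * prodFun e k x) ^ 2 ≤
      2 * (∫ x in U, (∑ k ∈ s, C k * prodFun e k x) ^ 2) +
        2 * ∫ x in U, (∑ k ∈ q, C k * prodFun e k x) ^ 2 := by
    rw [← integral_const_mul, ← integral_const_mul,
      ← integral_add (((hint s).mono_set hU).const_mul 2) (((hint q).mono_set hU).const_mul 2)]
    refine integral_mono ((hint p).mono_set hU)
      ((((hint s).mono_set hU).const_mul 2).add (((hint q).mono_set hU).const_mul 2)) fun x => ?_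
    simp only
    rw [hsplit fun k => C k * prodFun e k x]
    nlinarith [sq_nonneg (∑ k ∈ p, C k * prodFun e k x + 2 * ∑ k ∈ q, C k * prodFun e k x)]
  have hdecay : ∑ k ∈ q, C k ^ 2 ≤ Real.exp (-2 * Λ ^ 2 * (t - t₀)) *
      ∑ k ∈ s, (c k * Real.exp (-(eigenvalue μ k * t₀))) ^ 2 := by
    rw [Finset.mul_sum]
    refine (Finset.sum_le_sum fun k hk => ?_).trans
      (Finset.sum_le_sum_of_subset_of_nonneg (Finset.filter_subset _ s) fun k _ _ => by positivity)
    have hk : Λ ^ 2 < eigenvalue μ k := not_le.1 (Finset.mem_filter.1 hk).2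
    simp only [hC]
    rw [mul_pow, mul_pow, ← Real.exp_nat_mul, ← Real.exp_nat_mul, mul_left_comm, ← Real.exp_add]
    refine mul_le_mul_of_nonneg_left (Real.exp_le_exp.2 ?_) (sq_nonneg _)
    push_cast
    nlinarith [mul_nonneg (sub_nonneg.2 hk.le) (sub_nonneg.2 ht)]
  have hq0 : 0 ≤ ∑ k ∈ q, C k ^ 2 := Finset.sum_nonneg fun _ _ => sq_nonneg _
  rw [hsplit fun k => (c k * Real.exp (-(eigenvalue μ k * t))) ^ 2]
  calc ∑ k ∈ p, C k ^ 2 + ∑ k ∈ q, C k ^ 2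
      ≤ G * (2 * (∫ x in U, (∑ k ∈ s, C k * prodFun e k x) ^ 2) + 2 * ∑ k ∈ q, C k ^ 2) +
          ∑ k ∈ q, C k ^ 2 := by
        refine add_le_add (hlow.trans (mul_le_mul_of_nonneg_left ?_ (by linarith))) le_rfl
        linarith
    _ ≤ 2 * G * (∫ x in U, (∑ k ∈ s, C k * prodFun e k x) ^ 2) + 3 * G * ∑ k ∈ q, C k ^ 2 := by
        nlinarith
    _ ≤ _ := by
        rw [mul_assoc (3 * G)]
        exact add_le_add le_rfl (mul_le_mul_of_nonneg_left hdecay (by linarith))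

/-- The observability estimate for finite linear combinations of eigenfunctions. -/
theorem observability (he : IsEigensystem (2 * Real.pi * L) e μ)
    {U : Set (Fin d → ℝ)} (hU : U ⊆ cube d L) {D₀ D₁ T : ℝ} (hD₀ : 1 ≤ D₀) (hD₁ : 0 ≤ D₁)
    (hT : 0 < T)
    (hspec : ∀ (s : Finset (Fin d → κ)) (c : (Fin d → κ) → ℝ) (Λ : ℝ), 0 ≤ Λ →
      (∀ k ∈ s, eigenvalue μ k ≤ Λ ^ 2) → ∑ k ∈ s, c k ^ 2 ≤ D₀ * Real.exp (D₁ * Λ) *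
        ∫ x in U, (∑ k ∈ s, c k * prodFun e k x) ^ 2)
    (s : Finset (Fin d → κ)) (c : (Fin d → κ) → ℝ) :
    ∑ k ∈ s, (c k * Real.exp (-(eigenvalue μ k * T))) ^ 2 ≤
      48 * D₀ ^ 2 * Real.exp ((5 * D₁ ^ 2 + 1) / T) * ∫ t in (0 : ℝ)..T,
        ∫ x in U, (∑ k ∈ s, c k * Real.exp (-(eigenvalue μ k * t)) * prodFun e k x) ^ 2 := by
  refine observability_of_interpolation
    (N := fun t => ∑ k ∈ s, (c k * Real.exp (-(eigenvalue μ k * t))) ^ 2)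
    (O := fun t => ∫ x in U, (∑ k ∈ s, c k * Real.exp (-(eigenvalue μ k * t)) *
      prodFun e k x) ^ 2) ?_ ?_ ?_ ?_ hD₀ hD₁ hT ?_
  · exact continuous_integral_sum_sq he s (fun k => by fun_prop) hU
  · exact fun t => integral_nonneg fun x => sq_nonneg _
  · exact fun t => Finset.sum_nonneg fun _ _ => sq_nonneg _
  · intro t₁ t₂ h
    refine Finset.sum_le_sum fun k _ => ?_
    rw [mul_pow, mul_pow]
    refine mul_le_mul_of_nonneg_left (pow_le_pow_left₀ (Real.exp_pos _).le
      (Real.exp_le_exp.2 ?_) 2) (sq_nonneg _)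
    exact neg_le_neg (mul_le_mul_of_nonneg_left h (eigenvalue_nonneg k))
  · intro Λ t₀ t hΛ ht
    exact sum_sq_le_interpolation he hU hD₀ hD₁ hspec s c hΛ ht

end HeatCube

/-! ### Construction of the control from observability. -/

namespace HeatCube

open Filter Topology

variable {κ : Type} {e : κ → ℝ → ℝ} {μ : κ → ℝ} {d : ℕ} {L : ℝ}

/-- The product of the Lebesgue measures on the time interval and on a set. -/
noncomputable abbrev spaceTime (T : ℝ) (U : Set (Fin d → ℝ)) : Measure (ℝ × (Fin d → ℝ)) :=
  (volume.restrict (Icc 0 T)).prod (volume.restrict U)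

lemma isFiniteMeasure_restrict {U : Set (Fin d → ℝ)} (hU : U ⊆ cube d L) :
    IsFiniteMeasure (volume.restrict U) :=
  isFiniteMeasure_of_le _ (Measure.restrict_mono hU le_rfl)

lemma memLp_spaceTime (T : ℝ) {U : Set (Fin d → ℝ)} (hUm : MeasurableSet U)
    (hU : U ⊆ cube d L) {f : ℝ → ℝ} {g : (Fin d → ℝ) → ℝ} (hf : Continuous f)
    (hg : Continuous g) : MemLp (fun p : ℝ × (Fin d → ℝ) => f p.1 * g p.2) 2 (spaceTime T U) := by
  have := isFiniteMeasure_restrict hU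
  obtain ⟨A, hA⟩ := (isCompact_Icc (a := (0 : ℝ)) (b := T)).exists_bound_of_continuousOn
    hf.continuousOn
  obtain ⟨B, hB⟩ := exists_bound_cube hg L
  refine MemLp.of_bound ((hf.comp continuous_fst).mul
    (hg.comp continuous_snd)).aestronglyMeasurable (A * B) ?_
  rw [spaceTime, Measure.prod_restrict]
  refine (ae_restrict_iff' (measurableSet_Icc.prod hUm)).2 (ae_of_all _ fun p hp => ?_)
  rw [norm_mul]
  exact mul_le_mul (hA _ hp.1) (hB _ (hU hp.2)) (norm_nonneg _)
    ((norm_nonneg _).trans (hA _ hp.1))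

/-- The class of `exp(-λ_k (T - t)) e_k(x)` in `L²` of space-time. -/
noncomputable def adjointState (T : ℝ) {U : Set (Fin d → ℝ)} (hUm : MeasurableSet U)
    (hU : U ⊆ cube d L) (he : IsEigensystem (2 * Real.pi * L) e μ) (k : Fin d → κ) :
    Lp ℝ 2 (spaceTime T U) :=
  (memLp_spaceTime T hUm hU (f := fun t => Real.exp (-(eigenvalue μ k * (T - t)))) (by fun_prop)
    (he.contDiff_prodFun k).continuous).toLp _

lemma coeFn_adjointState (T : ℝ) {U : Set (Fin d → ℝ)} (hUm : MeasurableSet U)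
    (hU : U ⊆ cube d L) (he : IsEigensystem (2 * Real.pi * L) e μ) (k : Fin d → κ) :
    adjointState T hUm hU he k =ᵐ[spaceTime T U]
      fun p => Real.exp (-(eigenvalue μ k * (T - p.1))) * prodFun e k p.2 :=
  MemLp.coeFn_toLp _

/-- The reversal `t ↦ T - t` identifies the norm of a combination of backward adjoint states with
the observation of the forward heat flow. -/
lemma norm_sum_adjointState {T : ℝ} (hT : 0 < T) {U : Set (Fin d → ℝ)} (hUm : MeasurableSet U)
    (hU : U ⊆ cube d L) (he : IsEigensystem (2 * Real.pi * L) e μ)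
    (s : Finset (Fin d → κ)) (c : (Fin d → κ) → ℝ) :
    ‖∑ k ∈ s, c k • adjointState T hUm hU he k‖ ^ 2 = ∫ t in (0 : ℝ)..T,
      ∫ x in U, (∑ k ∈ s, c k * Real.exp (-(eigenvalue μ k * t)) * prodFun e k x) ^ 2 := by
  have := isFiniteMeasure_restrict hU
  set F : ℝ × (Fin d → ℝ) → ℝ := fun p =>
    ∑ k ∈ s, c k * Real.exp (-(eigenvalue μ k * (T - p.1))) * prodFun e k p.2 with hF
  have hae : (∑ k ∈ s, c k • adjointState T hUm hU he k : Lp ℝ 2 (spaceTime T U)) =ᵐ[spaceTime T U] F := by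
    refine (Lp.coeFn_finsetSum s fun k => c k • adjointState T hUm hU he k).trans ?_
    have h1 : ∀ᵐ p ∂(spaceTime T U), ∀ k ∈ s, (c k • adjointState T hUm hU he k) p =
        c k * (Real.exp (-(eigenvalue μ k * (T - p.1))) * prodFun e k p.2) := by
      refine (ae_ball_iff s.countable_toSet).2 fun k _ => ?_
      filter_upwards [coeFn_adjointState T hUm hU he k,
        Lp.coeFn_smul (c k) (adjointState T hUm hU he k)] with p h1 h2
      rw [h2, Pi.smul_apply, h1, smul_eq_mul]
    filter_upwards [h1] with p hp
    rw [Finset.sum_apply, hF]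
    exact Finset.sum_congr rfl fun k hk => by rw [hp k hk, mul_assoc]
  have hFm : MemLp F 2 (spaceTime T U) := (memLp_congr_ae hae).1 (Lp.memLp _)
  have h1 : ‖∑ k ∈ s, c k • adjointState T hUm hU he k‖ ^ 2 = ∫ p, F p ^ 2 ∂(spaceTime T U) := by
    rw [← real_inner_self_eq_norm_sq, L2.inner_def]
    refine integral_congr_ae ?_
    filter_upwards [hae] with p hp
    rw [hp]
    simp [sq]
  rw [h1, spaceTime, integral_prod _ hFm.integrable_sq, integral_Icc_eq_integral_Ioc,
    ← intervalIntegral.integral_of_le hT.le]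
  have h2 := intervalIntegral.integral_comp_sub_left (a := 0) (b := T) (fun t =>
    ∫ x in U, (∑ k ∈ s, c k * Real.exp (-(eigenvalue μ k * t)) * prodFun e k x) ^ 2) T
  rw [sub_self, sub_zero] at h2
  rw [← h2]

/-- Observability implies the existence of a control that solves the moment problem. -/
theorem exists_control {T C : ℝ} (hT : 0 < T) (hC : 0 ≤ C) {U : Set (Fin d → ℝ)}
    (hUm : MeasurableSet U)
    (hU : U ⊆ cube d L) (he : IsEigensystem (2 * Real.pi * L) e μ)
    (hobs : ∀ (s : Finset (Fin d → κ)) (c : (Fin d → κ) → ℝ),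
      ∑ k ∈ s, (c k * Real.exp (-(eigenvalue μ k * T))) ^ 2 ≤ C * ∫ t in (0 : ℝ)..T,
        ∫ x in U, (∑ k ∈ s, c k * Real.exp (-(eigenvalue μ k * t)) * prodFun e k x) ^ 2)
    (u₀ : L2 (cube d L)) :
    ∃ v : ℝ → (Fin d → ℝ) → ℝ, Measurable (Function.uncurry v) ∧ (∀ t, ∀ x ∉ U, v t x = 0) ∧
      MemLp (Function.uncurry v) 2 (spaceTime T (cube d L)) ∧
      eLpNorm (Function.uncurry v) 2 (spaceTime T U) ≤ ENNReal.ofReal (Real.sqrt C * ‖u₀‖) ∧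
      ∀ k, ∫ t in (0 : ℝ)..T, Real.exp (-(eigenvalue μ k * (T - t))) *
        ∫ x in cube d L, v t x * prodFun e k x =
          -(Real.exp (-(eigenvalue μ k * T)) * ⟪eigenVec he k, u₀⟫) := by
  have := isFiniteMeasure_restrict hU
  -- The bound required by the moment problem is Cauchy–Schwarz: observability controls the factor
  -- with `c_k exp(-λ_k T)`, and Bessel's inequality controls the coefficients of `u₀`.
  obtain ⟨V, hV1, hV2⟩ := exists_forall_inner_eq (adjointState T hUm hU he)
    (fun k => -(Real.exp (-(eigenvalue μ k * T)) * ⟪eigenVec he k, u₀⟫))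
    (M := Real.sqrt C * ‖u₀‖) (by positivity) (by
      intro s c
      have h1 : ∑ k ∈ s, c k * -(Real.exp (-(eigenvalue μ k * T)) * ⟪eigenVec he k, u₀⟫) =
          -∑ k ∈ s, (c k * Real.exp (-(eigenvalue μ k * T))) * ⟪eigenVec he k, u₀⟫ := by
        rw [← Finset.sum_neg_distrib]
        exact Finset.sum_congr rfl fun k _ => by ring
      rw [h1, abs_neg]
      refine abs_le_of_sq_le_sq ?_ (by positivity)
      rw [mul_pow, mul_pow, Real.sq_sqrt hC, norm_sum_adjointState hT hUm hU he]
      refine (Finset.sum_mul_sq_le_sq_mul_sq s _ _).trans ?_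
      have h2 : ∑ k ∈ s, ⟪eigenVec he k, u₀⟫ ^ 2 ≤ ‖u₀‖ ^ 2 := by
        have := (orthonormal_eigenVec he).sum_inner_products_le u₀ (s := s)
        simpa using this
      calc _ ≤ (C * _) * ‖u₀‖ ^ 2 := mul_le_mul (hobs s c) h2
            (Finset.sum_nonneg fun _ _ => sq_nonneg _)
            ((Finset.sum_nonneg fun _ _ => sq_nonneg _).trans (hobs s c))
        _ = _ := by ring)
  have hVm : Measurable (V : ℝ × (Fin d → ℝ) → ℝ) := (Lp.stronglyMeasurable V).measurable
  have hUm' : MeasurableSet ((univ : Set ℝ) ×ˢ U) := MeasurableSet.univ.prod hUm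
  -- Extending the `L²` class by zero off `U` gives a measurable function on all of space-time, so
  -- that slices and integrals over the whole cube make sense.
  set w : ℝ × (Fin d → ℝ) → ℝ := ((univ : Set ℝ) ×ˢ U).indicator V with hw
  have hwm : Measurable w := hVm.indicator hUm'
  have hres : (spaceTime T (cube d L)).restrict ((univ : Set ℝ) ×ˢ U) = spaceTime T U := by
    rw [spaceTime, ← Measure.prod_restrict, Measure.restrict_univ, Measure.restrict_restrict hUm,
      inter_eq_left.2 hU]
  have hwL : MemLp w 2 (spaceTime T (cube d L)) := by
    rw [hw, memLp_indicator_iff_restrict hUm', hres]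
    exact Lp.memLp V
  have hwV : w =ᵐ[spaceTime T U] V := by
    have h1 := indicator_ae_eq_restrict (μ := spaceTime T (cube d L)) (f := V) hUm'
    rwa [hres] at h1
  refine ⟨fun t x => w (t, x), hwm, fun t x hx => ?_, hwL, ?_, fun k => ?_⟩
  · exact indicator_of_notMem (fun h => hx h.2) _
  · have h1 : eLpNorm w 2 (spaceTime T U) = ENNReal.ofReal ‖V‖ := by
      rw [eLpNorm_congr_ae hwV, Lp.norm_def, ENNReal.ofReal_toReal (Lp.eLpNorm_ne_top V)]
    exact h1.le.trans (ENNReal.ofReal_le_ofReal hV1)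
  · rw [← hV2 k, L2.inner_def]
    have h1 : ∫ p, ⟪V p, adjointState T hUm hU he k p⟫ ∂(spaceTime T U) =
        ∫ p, w p * (Real.exp (-(eigenvalue μ k * (T - p.1))) * prodFun e k p.2)
          ∂(spaceTime T U) := by
      refine integral_congr_ae ?_
      filter_upwards [hwV, coeFn_adjointState T hUm hU he k] with p h2 h3
      rw [h2, h3]
      simp [mul_comm]
    have h4 : Integrable (fun p => w p * (Real.exp (-(eigenvalue μ k * (T - p.1))) *
        prodFun e k p.2)) (spaceTime T U) := by
      refine MemLp.integrable_mul ((memLp_congr_ae hwV).2 (Lp.memLp V))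
        (memLp_spaceTime T hUm hU (f := fun t => Real.exp (-(eigenvalue μ k * (T - t))))
          (by fun_prop) (he.contDiff_prodFun k).continuous)
    rw [h1, spaceTime, integral_prod _ h4, integral_Icc_eq_integral_Ioc,
      ← intervalIntegral.integral_of_le hT.le]
    refine intervalIntegral.integral_congr fun t _ => ?_
    simp only
    rw [← integral_const_mul, ← setIntegral_eq_of_subset_of_forall_sdiff_eq_zero
      (measurableSet_cube d L) hU]
    · refine integral_congr_ae (ae_of_all _ fun x => ?_)
      simp only
      ring
    · intro x hx
      rw [hw, indicator_of_notMem (fun h => hx.2 h.2)]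
      ring

end HeatCube

/-! ### Duhamel's formula and mild solutions of diagonal equations. -/

namespace HeatCube

open Filter Topology

/-- The solution of `y' = -l y + w`, `y(0) = a`. -/
noncomputable def duhamel (l a : ℝ) (w : ℝ → ℝ) (t : ℝ) : ℝ :=
  Real.exp (-(l * t)) * (a + ∫ s in (0 : ℝ)..t, Real.exp (l * s) * w s)

lemma intervalIntegrable_exp_mul (l : ℝ) {w : ℝ → ℝ} (hw : Integrable w) (s t : ℝ) :
    IntervalIntegrable (fun s => Real.exp (l * s) * w s) volume s t :=
  hw.intervalIntegrable.continuousOn_mul (by fun_prop)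

lemma continuous_duhamel (l a : ℝ) {w : ℝ → ℝ} (hw : Integrable w) :
    Continuous (duhamel l a w) :=
  Continuous.mul (by fun_prop) (continuous_const.add
    (intervalIntegral.continuous_primitive (intervalIntegrable_exp_mul l hw) 0))

/-- The forcing is merely integrable, so the differential equation holds only almost everywhere;
absolute continuity of the product of the exponential and the primitive recovers the integral form.
-/
lemma duhamel_eq (l a : ℝ) {w : ℝ → ℝ} (hw : Integrable w) (t : ℝ) :
    duhamel l a w t = a + ∫ s in (0 : ℝ)..t, (-l * duhamel l a w s + w s) := by
  have hJ := intervalIntegrable_exp_mul l hw 0 t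
  have hJac := hJ.absolutelyContinuousOnInterval_intervalIntegral (c := 0) left_mem_uIcc
  have hlin : ∀ x, HasDerivAt (fun s : ℝ => Real.exp (-(l * s))) (-l * Real.exp (-(l * x))) x := by
    intro x
    have := (((hasDerivAt_id x).const_mul l).neg).exp
    simpa [mul_comm] using this
  have hconst : ∀ c : ℝ, AbsolutelyContinuousOnInterval (fun _ => c) 0 t := fun c =>
    (LipschitzWith.const c).lipschitzOnWith.absolutelyContinuousOnInterval
  have hexp : AbsolutelyContinuousOnInterval (fun s : ℝ => Real.exp (-(l * s))) 0 t :=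
    ContDiffOn.absolutelyContinuousOnInterval (by fun_prop)
  have hac : AbsolutelyContinuousOnInterval (duhamel l a w) 0 t :=
    hexp.fun_mul ((hconst a).add hJac)
  have h1 := hac.integral_deriv_eq_sub
  have h2 : ∫ s in (0 : ℝ)..t, deriv (duhamel l a w) s =
      ∫ s in (0 : ℝ)..t, (-l * duhamel l a w s + w s) := by
    refine intervalIntegral.integral_congr_ae ?_
    filter_upwards [hJ.ae_hasDerivAt_integral] with x hx hxt
    have h3 := (hlin x).mul ((hx (uIoc_subset_uIcc hxt) 0 left_mem_uIcc).const_add a)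
    have h4 : HasDerivAt (duhamel l a w) _ x := h3
    rw [h4.deriv, duhamel, ← mul_assoc (Real.exp _), ← Real.exp_add]
    simp [mul_assoc]
  rw [← h2, h1]
  simp [duhamel]

lemma abs_duhamel_le {l a : ℝ} (hl : 0 ≤ l) {w : ℝ → ℝ} (hw : Integrable w) {t : ℝ}
    (ht : 0 ≤ t) : |duhamel l a w t| ≤ |a| + ∫ s, |w s| := by
  rw [duhamel, mul_add, ← intervalIntegral.integral_const_mul]
  refine (abs_add_le _ _).trans (add_le_add ?_ ?_)
  · rw [abs_mul, Real.abs_exp]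
    exact mul_le_of_le_one_left (abs_nonneg _) (Real.exp_le_one_iff.2 (by nlinarith))
  · rw [intervalIntegral.integral_of_le ht]
    refine (abs_integral_le_integral_abs).trans ?_
    refine (setIntegral_mono_on ?_ hw.abs.integrableOn measurableSet_Ioc fun s hs => ?_).trans
      (setIntegral_le_integral hw.abs (ae_of_all _ fun s => abs_nonneg _))
    · exact (((intervalIntegrable_iff_integrableOn_Ioc_of_le ht).1
        (intervalIntegrable_exp_mul l hw 0 t)).const_mul _).abs
    · rw [← mul_assoc, ← Real.exp_add, abs_mul, Real.abs_exp]
      refine mul_le_of_le_one_left (abs_nonneg _) (Real.exp_le_one_iff.2 ?_)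
      nlinarith [hs.2]

section HilbertBasis

variable {H ι : Type*} [NormedAddCommGroup H] [InnerProductSpace ℝ H]

lemma exists_forall_basis_inner_eq (b : HilbertBasis ι ℝ H) {z : ι → ℝ}
    (hz : Summable fun k => z k ^ 2) : ∃ x : H, ∀ k, ⟪b k, x⟫ = z k := by
  have hm : Memℓp z 2 := memℓp_gen (by simpa using hz)
  refine ⟨b.repr.symm ⟨z, hm⟩, fun k => ?_⟩
  rw [← b.repr_apply_apply, LinearIsometryEquiv.apply_symm_apply]

lemma hasSum_sq_inner (b : HilbertBasis ι ℝ H) (x : H) :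
    HasSum (fun k => ⟪b k, x⟫ ^ 2) (‖x‖ ^ 2) := by
  have h := b.hasSum_inner_mul_inner x x
  rw [real_inner_self_eq_norm_sq] at h
  refine h.congr_fun fun k => ?_
  rw [sq, real_inner_comm]

lemma summable_mul_of_summable_sq {f g : ι → ℝ} (hf : Summable fun k => f k ^ 2)
    (hg : Summable fun k => g k ^ 2) : Summable fun k => f k * g k := by
  refine (hf.add hg).of_norm_bounded fun k => ?_
  rw [Real.norm_eq_abs, abs_le]
  constructor <;> nlinarith [sq_nonneg (f k + g k), sq_nonneg (f k - g k)]

/-- The mild solution of a diagonal evolution equation in a Hilbert space. -/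
theorem exists_mild_solution [Countable ι] (b : HilbertBasis ι ℝ H) {l : ι → ℝ}
    (hl : ∀ k, 0 ≤ l k) {w : ι → ℝ → ℝ} (hw : ∀ k, Integrable (w k))
    (hsum : Summable fun k => (∫ s, |w k s|) ^ 2) (u₀ : H) :
    ∃ u : ℝ → H, Continuous u ∧ (∀ k, ∀ t, 0 ≤ t → ⟪b k, u t⟫ = duhamel (l k) ⟪b k, u₀⟫ (w k) t) ∧
      ∀ (φ f : H) (g : ℝ → ℝ) (t : ℝ), 0 ≤ t → (∀ k, ⟪b k, f⟫ = -l k * ⟪b k, φ⟫) →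
        (∀ᵐ s ∂(volume.restrict (Ioc 0 t)), HasSum (fun k => w k s * ⟪b k, φ⟫) (g s)) →
        ⟪u t, φ⟫ = ⟪u₀, φ⟫ + ∫ s in (0 : ℝ)..t, (⟪u s, f⟫ + g s) := by
  set y : ι → ℝ → ℝ := fun k => duhamel (l k) ⟪b k, u₀⟫ (w k) with hy
  -- A square-summable majorant of the coefficients, uniform over `t ≥ 0`. It gives both the
  -- existence of `u t` and, by dominated convergence of series, its continuity.
  set M : ι → ℝ := fun k => |⟪b k, u₀⟫| + ∫ s, |w k s| with hM
  have hM0 : ∀ k, 0 ≤ M k := fun k =>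
    add_nonneg (abs_nonneg _) (integral_nonneg fun _ => abs_nonneg _)
  have hyc : ∀ k, Continuous (y k) := fun k => continuous_duhamel _ _ (hw k)
  have hyM : ∀ k t, 0 ≤ t → |y k t| ≤ M k := fun k t ht => abs_duhamel_le (hl k) (hw k) ht
  have hMs : Summable fun k => M k ^ 2 := by
    refine ((((hasSum_sq_inner b u₀).summable.mul_left 2)).add (hsum.mul_left 2)).of_nonneg_of_le
      (fun k => sq_nonneg _) fun k => ?_
    simp only [hM]
    rw [← sq_abs ⟪b k, u₀⟫]
    nlinarith [sq_nonneg (|⟪b k, u₀⟫| - ∫ s, |w k s|)]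
  -- Replacing `t` by `max 0 t` freezes the solution at its initial value for negative times, where
  -- the exponential would destroy the bound.
  have hys : ∀ t, Summable fun k => y k (max 0 t) ^ 2 := fun t =>
    hMs.of_nonneg_of_le (fun k => sq_nonneg _) fun k =>
      sq_le_sq' (neg_le_of_abs_le (hyM k _ (le_max_left 0 t)))
        (le_of_abs_le (hyM k _ (le_max_left 0 t)))
  choose u hu using fun t => exists_forall_basis_inner_eq b (hys t)
  have huk : ∀ k t, 0 ≤ t → ⟪b k, u t⟫ = y k t := fun k t ht => by rw [hu, max_eq_right ht]
  have huc : Continuous u := by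
    rw [continuous_iff_continuousAt]
    intro t
    rw [ContinuousAt, tendsto_iff_norm_sub_tendsto_zero]
    have h1 : ∀ s, ‖u s - u t‖ ^ 2 = ∑' k, (y k (max 0 s) - y k (max 0 t)) ^ 2 := by
      intro s
      rw [← (hasSum_sq_inner b (u s - u t)).tsum_eq]
      simp_rw [inner_sub_right, hu]
    have h2 : Tendsto (fun s => ∑' k, (y k (max 0 s) - y k (max 0 t)) ^ 2) (𝓝 t)
        (𝓝 (∑' _ : ι, (0 : ℝ))) := by
      refine tendsto_tsum_of_dominated_convergence (hMs.mul_left 4) (fun k => ?_)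
        (Eventually.of_forall fun s k => ?_)
      · have h3 : Continuous fun s => (y k (max 0 s) - y k (max 0 t)) ^ 2 :=
          (((hyc k).comp (continuous_const.max continuous_id)).sub continuous_const).pow 2
        have h4 := h3.tendsto t
        simpa using h4
      · rw [Real.norm_eq_abs, abs_pow]
        have h3 := (abs_sub (y k (max 0 s)) (y k (max 0 t))).trans
          (add_le_add (hyM k _ (le_max_left 0 s)) (hyM k _ (le_max_left 0 t)))
        have := pow_le_pow_left₀ (abs_nonneg _) h3 2
        nlinarith
    rw [tsum_zero] at h2
    have h3 := h2.sqrt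
    rw [Real.sqrt_zero] at h3
    refine h3.congr fun s => ?_
    rw [← h1, Real.sqrt_sq (norm_nonneg _)]
  refine ⟨u, huc, huk, fun φ f g t ht hf hg => ?_⟩
  have hφ := (hasSum_sq_inner b φ).summable
  have hφ' : Summable fun k => |⟪b k, φ⟫| ^ 2 := by simpa using hφ
  have hf' : Summable fun k => |⟪b k, f⟫| ^ 2 := by simpa using (hasSum_sq_inner b f).summable
  have hparseval : ∀ x z : H, HasSum (fun k => ⟪b k, x⟫ * ⟪b k, z⟫) ⟪x, z⟫ := fun x z =>
    (b.hasSum_inner_mul_inner x z).congr_fun fun k => by rw [real_inner_comm]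
  set F : ι → ℝ → ℝ := fun k s => y k s * ⟪b k, f⟫ + w k s * ⟪b k, φ⟫ with hF
  have hF1 : ∀ k, IntegrableOn (fun s => y k s * ⟪b k, f⟫) (Ioc 0 t) := fun k =>
    ((hyc k).mul continuous_const).integrableOn_Ioc
  have hF2 : ∀ k, IntegrableOn (fun s => w k s * ⟪b k, φ⟫) (Ioc 0 t) := fun k =>
    ((hw k).mul_const _).integrableOn
  have hFi : ∀ k, IntegrableOn (F k) (Ioc 0 t) := fun k => (hF1 k).add (hF2 k)
  -- Absolute summability of the time integrals justifies exchanging the series over `k` with the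
  -- integral in the weak formulation.
  have hFs : Summable fun k => ∫ s in Ioc 0 t, ‖F k s‖ := by
    refine (((summable_mul_of_summable_sq hMs hf').mul_left t).add
      (summable_mul_of_summable_sq hsum hφ')).of_nonneg_of_le
      (fun k => integral_nonneg fun _ => norm_nonneg _) fun k => ?_
    have h1 : ∫ s in Ioc 0 t, ‖F k s‖ ≤
        ∫ s in Ioc 0 t, (M k * |⟪b k, f⟫| + |w k s| * |⟪b k, φ⟫|) := by
      refine setIntegral_mono_on (hFi k).norm ((integrable_const _).add
        ((hw k).abs.integrableOn.mul_const _)) measurableSet_Ioc fun s hs => ?_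
      refine (norm_add_le _ _).trans ?_
      rw [norm_mul, norm_mul]
      exact add_le_add (mul_le_mul_of_nonneg_right (hyM k s hs.1.le) (abs_nonneg _)) le_rfl
    refine h1.trans ?_
    rw [integral_add (integrable_const _) ((hw k).abs.integrableOn.mul_const _),
      setIntegral_const, integral_mul_const, Real.volume_real_Ioc_of_le ht, sub_zero, smul_eq_mul]
    refine add_le_add le_rfl (mul_le_mul_of_nonneg_right ?_ (abs_nonneg _))
    exact setIntegral_le_integral (hw k).abs (ae_of_all _ fun s => abs_nonneg _)
  have h1 := hasSum_integral_of_summable_integral_norm hFi hFs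
  have h2 : ∫ s in Ioc 0 t, ∑' k, F k s = ∫ s in (0 : ℝ)..t, (⟪u s, f⟫ + g s) := by
    rw [intervalIntegral.integral_of_le ht]
    refine integral_congr_ae ?_
    filter_upwards [hg, ae_restrict_mem measurableSet_Ioc] with s hs hst
    refine HasSum.tsum_eq ?_
    refine HasSum.add ?_ hs
    refine (hparseval (u s) f).congr_fun fun k => ?_
    rw [huk k s hst.1.le]
  rw [h2] at h1
  refine (hparseval (u t) φ).unique (((hparseval u₀ φ).add h1).congr_fun fun k => ?_)
  rw [huk k t ht]
  simp only [hy]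
  rw [duhamel_eq _ _ (hw k), add_mul, ← intervalIntegral.integral_mul_const,
    intervalIntegral.integral_of_le ht]
  congr 1
  refine integral_congr_ae (ae_of_all _ fun s => ?_)
  simp only [hF, hy, hf]
  ring

end HilbertBasis

end HeatCube

/-! ### The solution of the moment problem is a null control. -/

namespace HeatCube

open Filter Topology

lemma sq_setIntegral_Icc_abs_le {T : ℝ} (hT : 0 < T) {f : ℝ → ℝ} (hf : IntegrableOn f (Icc 0 T))
    (hf2 : IntegrableOn (fun t => f t ^ 2) (Icc 0 T)) :
    (∫ t in Icc 0 T, |f t|) ^ 2 ≤ T * ∫ t in Icc 0 T, f t ^ 2 := by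
  set I := ∫ t in Icc 0 T, |f t| with hI
  have h1 : 0 ≤ ∫ t in Icc 0 T, (f t ^ 2 - 2 * (I / T) * |f t| + (I / T) ^ 2) := by
    refine integral_nonneg fun t => ?_
    simp only [Pi.zero_apply]
    rw [← sq_abs (f t)]
    nlinarith [sq_nonneg (|f t| - I / T)]
  have h3 : IntegrableOn (fun t => 2 * (I / T) * |f t|) (Icc 0 T) := hf.abs.const_mul _
  have h4 : IntegrableOn (fun t => f t ^ 2 - 2 * (I / T) * |f t|) (Icc 0 T) := hf2.sub h3
  rw [integral_add h4 (integrable_const _), integral_sub hf2 h3, integral_const_mul, ← hI, setIntegral_const,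
    Real.volume_real_Icc_of_le hT.le, sub_zero, smul_eq_mul] at h1
  have h2 : T * ((∫ t in Icc 0 T, f t ^ 2) - 2 * (I / T) * I + T * (I / T) ^ 2) =
      T * (∫ t in Icc 0 T, f t ^ 2) - I ^ 2 := by
    field_simp
    ring
  nlinarith [mul_nonneg hT.le h1]

variable {κ : Type} {e : κ → ℝ → ℝ} {μ : κ → ℝ} {d : ℕ} {L T : ℝ}

/-- The coefficient of the control at time `t` with respect to an eigenfunction. -/
noncomputable def controlCoeff (L : ℝ) (e : κ → ℝ → ℝ) (v : ℝ → (Fin d → ℝ) → ℝ) (k : Fin d → κ)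
    (t : ℝ) : ℝ :=
  ∫ x in cube d L, v t x * prodFun e k x

section Coefficients

variable {v : ℝ → (Fin d → ℝ) → ℝ}

lemma controlCoeff_eq_inner (he : IsEigensystem (2 * Real.pi * L) e μ) {t : ℝ}
    (hv : MemLp (v t) 2 (volume.restrict (cube d L)))
    (k : Fin d → κ) : controlCoeff L e v k t = ⟪eigenVec he k, hv.toLp (v t)⟫ := by
  rw [eigenVec, inner_toL2, controlCoeff]
  refine integral_congr_ae ?_
  filter_upwards [hv.coeFn_toLp] with x hx
  rw [hx, mul_comm]

lemma sum_controlCoeff_sq_le (he : IsEigensystem (2 * Real.pi * L) e μ) {t : ℝ}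
    (hv : MemLp (v t) 2 (volume.restrict (cube d L)))
    (s : Finset (Fin d → κ)) :
    ∑ k ∈ s, controlCoeff L e v k t ^ 2 ≤ ∫ x in cube d L, v t x ^ 2 := by
  have h1 := (orthonormal_eigenVec he).sum_inner_products_le (hv.toLp (v t)) (s := s)
  have h2 : ‖hv.toLp (v t)‖ ^ 2 = ∫ x in cube d L, v t x ^ 2 := by
    rw [← real_inner_self_eq_norm_sq, inner_eq_integral]
    refine integral_congr_ae ?_
    filter_upwards [hv.coeFn_toLp] with x hx
    rw [hx, sq]
  rw [h2] at h1
  refine le_trans (le_of_eq (Finset.sum_congr rfl fun k _ => ?_)) h1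
  rw [controlCoeff_eq_inner he hv, Real.norm_eq_abs, sq_abs]

lemma hasSum_controlCoeff_mul [Countable κ] (he : IsEigensystem (2 * Real.pi * L) e μ)
    {t : ℝ}
    (hv : MemLp (v t) 2 (volume.restrict (cube d L))) (φ : L2 (cube d L)) :
    HasSum (fun k => controlCoeff L e v k t * ⟪eigenVec he k, φ⟫)
      (∫ x in cube d L, v t x * φ x) := by
  have h1 := (eigenBasis he).hasSum_inner_mul_inner (hv.toLp (v t)) φ
  have h2 : ⟪hv.toLp (v t), φ⟫ = ∫ x in cube d L, v t x * φ x := by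
    rw [inner_eq_integral]
    refine integral_congr_ae ?_
    filter_upwards [hv.coeFn_toLp] with x hx
    rw [hx]
  rw [h2] at h1
  refine h1.congr_fun fun k => ?_
  rw [eigenBasis_apply, controlCoeff_eq_inner he hv, real_inner_comm]

lemma integrableOn_controlCoeff (he : IsEigensystem (2 * Real.pi * L) e μ)
    (hv : MemLp (Function.uncurry v) 2 (spaceTime T (cube d L)))
    (k : Fin d → κ) : IntegrableOn (controlCoeff L e v k) (Icc 0 T) := by
  have h1 := hv.integrable_mul (memLp_spaceTime T (measurableSet_cube d L) subset_rfl
    (f := fun _ => 1) continuous_const (he.contDiff_prodFun k).continuous)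
  refine h1.integral_prod_left.congr (ae_of_all _ fun t => ?_)
  simp [controlCoeff, Function.uncurry]

lemma ae_memLp_slice (hvm : Measurable (Function.uncurry v))
    (hv : MemLp (Function.uncurry v) 2 (spaceTime T (cube d L))) :
    ∀ᵐ t ∂(volume.restrict (Icc 0 T)), MemLp (v t) 2 (volume.restrict (cube d L)) := by
  filter_upwards [hv.integrable_sq.prod_right_ae] with t ht
  exact (memLp_two_iff_integrable_sq
    (hvm.comp measurable_prodMk_left).aestronglyMeasurable).2 ht

/-- Cauchy–Schwarz in time, followed by Bessel's inequality in space at almost every time, bounds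
the sum by `T` times the squared norm of `v`. -/
lemma summable_sq_integral_controlCoeff (he : IsEigensystem (2 * Real.pi * L) e μ)
    (hT : 0 < T) (hvm : Measurable (Function.uncurry v))
    (hv : MemLp (Function.uncurry v) 2 (spaceTime T (cube d L))) :
    Summable fun k => (∫ t in Icc 0 T, |controlCoeff L e v k t|) ^ 2 := by
  have hE : IntegrableOn (fun t => ∫ x in cube d L, v t x ^ 2) (Icc 0 T) :=
    hv.integrable_sq.integral_prod_left
  have hW := integrableOn_controlCoeff he hv
  have hW2 : ∀ k, IntegrableOn (fun t => controlCoeff L e v k t ^ 2) (Icc 0 T) := by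
    intro k
    refine hE.mono' ((hW k).1.pow 2) ?_
    filter_upwards [ae_memLp_slice hvm hv] with t ht
    have := sum_controlCoeff_sq_le he ht {k}
    rw [Finset.sum_singleton] at this
    rwa [Real.norm_eq_abs, abs_of_nonneg (sq_nonneg _)]
  have h1 : Summable fun k => T * ∫ t in Icc 0 T, controlCoeff L e v k t ^ 2 := by
    refine Summable.mul_left T (summable_of_sum_le
      (c := ∫ t in Icc 0 T, ∫ x in cube d L, v t x ^ 2)
      (fun k => integral_nonneg fun _ => sq_nonneg _) fun s => ?_)
    rw [← integral_finsetSum _ fun k _ => hW2 k]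
    refine integral_mono_ae (integrable_finsetSum _ fun k _ => hW2 k) hE ?_
    filter_upwards [ae_memLp_slice hvm hv] with t ht
    exact sum_controlCoeff_sq_le he ht s
  exact h1.of_nonneg_of_le (fun k => sq_nonneg _) fun k =>
    sq_setIntegral_Icc_abs_le hT (hW k) (hW2 k)

end Coefficients

/-- Both functions lie in the form domain, so each may test the weak equation of the other; symmetry
of the form gives the identity without any regularity of `φ`. -/
lemma inner_eigenVec_of_isLaplacian {bc : BoundaryCondition}
    (he : IsEigensystem (2 * Real.pi * L) e μ) {k : Fin d → κ}
    (hlap : IsLaplacian bc (eigenVec he k) ((-eigenvalue μ k) • eigenVec he k))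
    {φ f : L2 (cube d L)} (h : IsLaplacian bc φ f) :
    ⟪eigenVec he k, f⟫ = -eigenvalue μ k * ⟪eigenVec he k, φ⟫ := by
  obtain ⟨g, hg, hgw⟩ := hlap
  obtain ⟨g', hg', hgw'⟩ := h
  have h1 : ∑ j, ⟪g j, g' j⟫ = _ := hgw _ hg'
  have h2 : ∑ j, ⟪g' j, g j⟫ = _ := hgw' _ hg
  have h3 : ∑ j, ⟪g j, g' j⟫ = ∑ j, ⟪g' j, g j⟫ :=
    Finset.sum_congr rfl fun j _ => real_inner_comm _ _
  rw [real_inner_smul_left] at h1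
  rw [real_inner_comm] at h2
  linarith

/-- A control that solves the moment problem is a null control. -/
theorem isNullControl_of_moments [Countable κ] {bc : BoundaryCondition}
    (he : IsEigensystem (2 * Real.pi * L) e μ)
    (hlap : ∀ k : Fin d → κ, IsLaplacian bc (eigenVec he k) ((-eigenvalue μ k) • eigenVec he k))
    (hT : 0 < T) {S U : Set (Fin d → ℝ)} (hU : U ⊆ cube d L)
    (hUS : U =ᵐ[volume] (S ∩ cube d L : Set (Fin d → ℝ)))
    {u₀ : L2 (cube d L)} {v : ℝ → (Fin d → ℝ) → ℝ}
    (hvm : Measurable (Function.uncurry v)) (hv0 : ∀ t, ∀ x ∉ U, v t x = 0)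
    (hv : MemLp (Function.uncurry v) 2 (spaceTime T (cube d L)))
    (hmom : ∀ k, ∫ t in (0 : ℝ)..T, Real.exp (-(eigenvalue μ k * (T - t))) *
      controlCoeff L e v k t = -(Real.exp (-(eigenvalue μ k * T)) * ⟪eigenVec he k, u₀⟫)) :
    IsNullControl bc S T u₀ v := by
  have hrestr : ∀ (t : ℝ) (φ : (Fin d → ℝ) → ℝ),
      ∫ x in S ∩ cube d L, v t x * φ x = ∫ x in cube d L, v t x * φ x := by
    intro t φ
    rw [← setIntegral_congr_set hUS, setIntegral_eq_of_subset_of_forall_sdiff_eq_zero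
      (measurableSet_cube d L) hU]
    intro x hx
    rw [hv0 t x hx.2, zero_mul]
  have hW := integrableOn_controlCoeff he hv
  -- The coefficients of the control are extended by zero outside `[0, T]`, since the abstract
  -- result asks for forcing integrable on the whole line.
  obtain ⟨u, huc, huk, hweak⟩ := exists_mild_solution (eigenBasis he)
    (fun k : Fin d → κ => eigenvalue_nonneg (μ := μ) k)
    (w := fun k => (Icc 0 T).indicator (controlCoeff L e v k))
    (fun k => (integrable_indicator_iff measurableSet_Icc).2 (hW k)) (by
      refine (summable_sq_integral_controlCoeff he hT hvm hv).congr fun k => ?_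
      rw [← integral_indicator measurableSet_Icc]
      congr 2
      funext t
      by_cases ht : t ∈ Icc 0 T <;> simp [ht]) u₀
  simp only [eigenBasis_apply] at huk hweak
  have hext : ∀ x y : L2 (cube d L), (∀ k, ⟪eigenVec he k, x⟫ = ⟪eigenVec he k, y⟫) → x = y := by
    intro x y h
    refine (eigenBasis he).repr.injective (lp.ext (funext fun k => ?_))
    rw [HilbertBasis.repr_apply_apply, HilbertBasis.repr_apply_apply, eigenBasis_apply, h]
  refine ⟨hv, u, ⟨huc.continuousOn, ?_, ?_⟩, ?_⟩
  · refine hext _ _ fun k => ?_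
    rw [huk k 0 le_rfl]
    simp [duhamel]
  · intro φ f hφ t ht
    refine hweak φ f (fun s => ∫ x in S ∩ cube d L, v s x * φ x) t ht.1
      (fun k => inner_eigenVec_of_isLaplacian he (hlap k) hφ) ?_
    have hsub : Ioc 0 t ⊆ Icc 0 T := Ioc_subset_Icc_self.trans (Icc_subset_Icc_right ht.2)
    filter_upwards [ae_restrict_of_ae_restrict_of_subset hsub (ae_memLp_slice hvm hv),
      ae_restrict_mem measurableSet_Ioc] with s hs hst
    rw [hrestr]
    refine (hasSum_controlCoeff_mul he hs φ).congr_fun fun k => ?_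
    rw [indicator_of_mem (hsub hst)]
  -- By Duhamel, the vanishing of the `k`-th coefficient of `u T` is the `k`-th moment equation.
  · refine hext _ _ fun k => ?_
    rw [huk k T hT.le, inner_zero_right, duhamel, mul_add, ← intervalIntegral.integral_const_mul,
      ← eq_neg_iff_add_eq_zero, neg_eq_iff_eq_neg.symm, ← hmom k]
    rw [eq_comm]
    refine intervalIntegral.integral_congr fun t ht => ?_
    rw [uIcc_of_le hT.le] at ht
    rw [indicator_of_mem ht, ← mul_assoc, ← Real.exp_add]
    ring_nf

end HeatCube

/-! ### Assembly and comparison of constants. -/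

namespace HeatCube

open Filter Topology

variable {d : ℕ} {T L γ : ℝ} {a : Fin d → ℝ} {S : Set (Fin d → ℝ)}

/-- The observability constant that the spectral inequality gives. -/
noncomputable def obsConstant (T γ : ℝ) (a : Fin d → ℝ) : ℝ :=
  48 * specFactor d γ ^ 2 * Real.exp ((5 * specRate γ a ^ 2 + 1) / T)

lemma obsConstant_nonneg (T γ : ℝ) (a : Fin d → ℝ) : 0 ≤ obsConstant T γ a := by
  unfold obsConstant
  positivity

theorem exists_isNullControl (bc : BoundaryCondition) (hT : 0 < T) (hL : 0 < L)
    (hS : IsThick S γ a) (ha : ∀ j, a j ≤ 2 * Real.pi * L) (u₀ : L2 (cube d L)) :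
    ∃ v : ℝ → (Fin d → ℝ) → ℝ, IsNullControl bc S T u₀ v ∧
      eLpNorm (fun p : ℝ × (Fin d → ℝ) => v p.1 p.2) 2
        ((volume.restrict (Icc 0 T)).prod (volume.restrict (S ∩ cube d L))) ≤
        ENNReal.ofReal (Real.sqrt (obsConstant T γ a) * ‖u₀‖) := by
  obtain ⟨κ, hκ, e, μ, he, hlap⟩ := exists_isEigensystem bc hL
  obtain ⟨U, hUS, hUm, hUae⟩ := (hS.measurable.inter
    (measurableSet_cube d L).nullMeasurableSet).exists_measurable_subset_ae_eq
  have hU : U ⊆ cube d L := hUS.trans inter_subset_right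
  have hX := twelve_le_specBase hS.gamma_pos hS.gamma_le_one d
  have hA : 0 ≤ ∑ j, a j := Finset.sum_nonneg fun j _ => (hS.side_pos j).le
  have hD₀ : 1 ≤ specFactor d γ := by
    have := one_le_pow₀ (show 1 ≤ specBase d γ by linarith) (n := 16 * d)
    rw [specFactor]
    linarith
  have hD₁ : 0 ≤ specRate γ a := by
    have := Real.log_nonneg (show 1 ≤ specBase d γ by linarith)
    have : 0 ≤ specBase d γ := by linarith
    rw [specRate]
    positivity
  have hspec : ∀ (s : Finset (Fin d → κ)) (c : (Fin d → κ) → ℝ) (Λ : ℝ), 0 ≤ Λ →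
      (∀ k ∈ s, eigenvalue μ k ≤ Λ ^ 2) → ∑ k ∈ s, c k ^ 2 ≤
        specFactor d γ * Real.exp (specRate γ a * Λ) *
          ∫ x in U, (∑ k ∈ s, c k * prodFun e k x) ^ 2 := by
    intro s c Λ hΛ hs
    rw [setIntegral_congr_set hUae]
    exact spectral_inequality he hS hL ha s c hΛ hs
  obtain ⟨v, hvm, hv0, hv, hvn, hmom⟩ := exists_control hT (obsConstant_nonneg T γ a) hUm hU he
    (fun s c => observability he hU hD₀ hD₁ hT hspec s c) u₀
  refine ⟨v, isNullControl_of_moments he (hlap d) hT hU hUae hvm hv0 hv hmom, ?_⟩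
  rw [← Measure.restrict_congr_set hUae]
  exact hvn

/-- Everything is compared with powers of `Y = K^d / γ ≥ 336`. Besides `‖a‖₁`, all factors are at
most `Y^(33 d)`, and `1 + ‖a‖₁² ≤ exp (2 ‖a‖₁) ≤ Y^(K ‖a‖₁)`. Because the target is itself a power
of `Y`, a spectral rate polynomial in `specBase` rather than logarithmic is affordable. -/
lemma costConstant_bounds (hd : 1 ≤ d) (hγ : 0 < γ) (hγ1 : γ ≤ 1) (ha : ∀ j, 0 ≤ a j) {K : ℝ}
    (hK : 336 ≤ K) :
    48 * specFactor d γ ^ 2 ≤ costConstant K γ a ∧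
      5 * specRate γ a ^ 2 + 1 ≤ costConstant K γ a := by
  have hA : 0 ≤ ∑ j, a j := Finset.sum_nonneg fun j _ => ha j
  have hX12 := twelve_le_specBase hγ hγ1 d
  have hdr : (1 : ℝ) ≤ d := by exact_mod_cast hd
  set A := ∑ j, a j with hAdef
  set X := specBase d γ with hX
  set Y := K ^ d / γ with hY
  have hXY : X ≤ Y := by
    rw [hX, hY, specBase]
    refine div_le_div_of_nonneg_right ?_ hγ.le
    calc (12 : ℝ) * 4 ^ d ≤ 12 ^ d * 4 ^ d :=
          mul_le_mul_of_nonneg_right (le_self_pow₀ (by norm_num) (by omega)) (by positivity)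
      _ = 48 ^ d := by rw [← mul_pow]; norm_num
      _ ≤ K ^ d := pow_le_pow_left₀ (by norm_num) (by linarith) d
  have hY336 : 336 ≤ Y := by
    rw [hY, le_div_iff₀ hγ]
    have : K ≤ K ^ d := le_self_pow₀ (by linarith) (by omega)
    nlinarith
  have hY0 : 0 < Y := by linarith
  have hY1 : 1 ≤ Y := by linarith
  have hX0 : 0 < X := by linarith
  have hC : costConstant K γ a = Y ^ (K * d) * Y ^ (K * A) := by
    rw [costConstant, mul_add, Real.rpow_add hY0]
  have hpow : ∀ n : ℕ, n ≤ 33 * d → Y ^ n ≤ Y ^ (K * d) := by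
    intro n hn
    rw [← Real.rpow_natCast]
    refine Real.rpow_le_rpow_of_exponent_le hY1 ?_
    have : (n : ℝ) ≤ 33 * d := by exact_mod_cast hn
    nlinarith
  have hYA : 1 + A ^ 2 ≤ Y ^ (K * A) := by
    have h1 : Real.exp (2 * A) ≤ Y ^ (K * A) := by
      rw [Real.rpow_def_of_pos hY0]
      refine Real.exp_le_exp.2 ?_
      have h2 : 1 ≤ Real.log Y := by
        rw [Real.le_log_iff_exp_le hY0]
        have := Real.exp_one_lt_d9
        linarith
      have h3 : 2 * A ≤ K * A := mul_le_mul_of_nonneg_right (by linarith) hA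
      nlinarith [mul_nonneg (sub_nonneg.2 h2) (mul_nonneg (show 0 ≤ K by linarith) hA)]
    have h2 := Real.quadratic_le_exp_of_nonneg (show 0 ≤ 2 * A by linarith)
    nlinarith
  have hYd : 0 ≤ Y ^ (K * d) := Real.rpow_nonneg hY0.le _
  rw [hC]
  constructor
  · have h1 : X ^ (32 * d) ≤ Y ^ (32 * d) := pow_le_pow_left₀ hX0.le hXY _
    calc 48 * specFactor d γ ^ 2 = 192 * X ^ (32 * d) := by
          rw [specFactor, ← hX, mul_pow, ← pow_mul]
          ring_nf
      _ ≤ Y * Y ^ (32 * d) := mul_le_mul (by linarith) h1 (by positivity) hY0.le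
      _ = Y ^ (32 * d + 1) := by ring
      _ ≤ Y ^ (K * d) * 1 := by rw [mul_one]; exact hpow _ (by omega)
      _ ≤ _ := mul_le_mul_of_nonneg_left (by nlinarith [sq_nonneg A]) hYd
  · have hlog : Real.log X ≤ X := (Real.log_le_sub_one_of_pos hX0).trans (by linarith)
    have hlog0 : 0 ≤ Real.log X := Real.log_nonneg (by linarith)
    have hdY : (d : ℝ) ≤ Y ^ d := by
      have h1 : (d : ℝ) ≤ 2 ^ d := by exact_mod_cast Nat.lt_two_pow_self.le
      exact h1.trans (pow_le_pow_left₀ (by norm_num) (by linarith) d)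
    have h1 : specRate γ a ≤ 48 * Y ^ d * A * Y ^ (2 * d) * Y := by
      rw [specRate]
      have := pow_le_pow_left₀ hX0.le hXY (2 * d)
      have := hlog.trans hXY
      gcongr
    have h0 : 0 ≤ specRate γ a := by
      rw [specRate]
      positivity
    have h2 : 5 * specRate γ a ^ 2 ≤ Y ^ (10 * d) * A ^ 2 := by
      calc 5 * specRate γ a ^ 2 ≤ 5 * (48 * Y ^ d * A * Y ^ (2 * d) * Y) ^ 2 := by gcongr
        _ = 11520 * (Y ^ (6 * d + 2) * A ^ 2) := by ring
        _ ≤ Y ^ 2 * (Y ^ (6 * d + 2) * A ^ 2) :=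
            mul_le_mul_of_nonneg_right (by nlinarith) (by positivity)
        _ = Y ^ (6 * d + 4) * A ^ 2 := by ring
        _ ≤ _ := mul_le_mul_of_nonneg_right (pow_le_pow_right₀ hY1 (by omega)) (sq_nonneg A)
    calc 5 * specRate γ a ^ 2 + 1 ≤ Y ^ (10 * d) * A ^ 2 + Y ^ (10 * d) :=
          add_le_add h2 (one_le_pow₀ hY1)
      _ = Y ^ (10 * d) * (1 + A ^ 2) := by ring
      _ ≤ _ := mul_le_mul (hpow _ (by omega)) hYA (by positivity) hYd

lemma sqrt_obsConstant_le (hd : 1 ≤ d) (hT : 0 < T) (hγ : 0 < γ) (hγ1 : γ ≤ 1)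
    (ha : ∀ j, 0 ≤ a j) {K : ℝ} (hK : 336 ≤ K) :
    Real.sqrt (obsConstant T γ a) ≤
      costConstant K γ a ^ (1 / 2 : ℝ) * Real.exp (costConstant K γ a / (2 * T)) := by
  obtain ⟨h1, h2⟩ := costConstant_bounds hd hγ hγ1 ha hK
  have hC : 0 ≤ costConstant K γ a := (by positivity : (0 : ℝ) ≤ _).trans h1
  rw [← Real.sqrt_eq_rpow]
  refine Real.sqrt_le_iff.2 ⟨by positivity, ?_⟩
  rw [mul_pow, Real.sq_sqrt hC, ← Real.exp_nat_mul]
  have h3 : ((2 : ℕ) : ℝ) * (costConstant K γ a / (2 * T)) = costConstant K γ a / T := by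
    push_cast
    field_simp
  rw [h3, obsConstant]
  gcongr

end HeatCube

theorem mainTheorem2 :
    ∃ K₁ : ℝ, Real.exp 1 ≤ K₁ ∧ 7 / 2 ≤ K₁ ∧
      ∀ (d : ℕ) (_ : 1 ≤ d) (bc : HeatCube.BoundaryCondition) (T L γ : ℝ) (a : Fin d → ℝ)
        (S : Set (Fin d → ℝ)),
        0 < T → 0 < L → HeatCube.IsThick S γ a → (∀ j, a j ≤ 2 * Real.pi * L) →
          HeatCube.IsNullControllable bc L S T ∧
          HeatCube.controlCost bc L S T ≤
            ENNReal.ofReal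
              (HeatCube.costConstant (24 * Real.sqrt 2 * K₁) γ a ^ (1 / 2 : ℝ) *
                Real.exp (HeatCube.costConstant (24 * Real.sqrt 2 * K₁) γ a / (2 * T))) := by
  -- The value `10` is chosen so that `24 √2 · 10 ≥ 24 · 1.4 · 10 = 336`, the threshold in the
  -- comparison of constants.
  refine ⟨10, ?_, by norm_num, fun d hd bc T L γ a S hT hL hS ha => ⟨fun u₀ => ?_, ?_⟩⟩
  · have := Real.exp_one_lt_d9
    linarith
  · obtain ⟨v, hv, _⟩ := HeatCube.exists_isNullControl bc hT hL hS ha u₀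
    exact ⟨v, hv⟩
  · have hK : 336 ≤ 24 * Real.sqrt 2 * 10 := by
      have : (1.4 : ℝ) ≤ Real.sqrt 2 := Real.le_sqrt_of_sq_le (by norm_num)
      linarith
    refine iSup₂_le fun u₀ hu₀ => ?_
    obtain ⟨v, hv, hvn⟩ := HeatCube.exists_isNullControl bc hT hL hS ha u₀
    refine (iInf₂_le v hv).trans (hvn.trans (ENNReal.ofReal_le_ofReal ?_))
    rw [hu₀, mul_one]
    exact HeatCube.sqrt_obsConstant_le hd hT hS.gamma_pos hS.gamma_le_one
      (fun j => (hS.side_pos j).le) hK
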